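/- Work in $\mathbb{CP}^2=\mathbb{C}^2\cup\mathcal{L}_\infty$; points of $\mathbb{C}^2$ are called finite. Let $\gamma,\Gamma\subset\mathbb{CP}^2$ be smooth conics and $n\ge 3$; indices are taken modulo $n$. A Poncelet $n$-gon is a polygon $(V_1,\dots,V_n)$ for which there are lines $\ell_1,\dots,\ell_n$ tangent to $\gamma$ such that, for every $i$, the line $\ell_i$ meets $\Gamma$ exactly in $V_i$ and $V_{i+1}$ (which coincide iff $\ell_i$ is tangent to $\Gamma$), and $\ell_i,\ell_{i+1}$ are exactly the tangent lines of $\gamma$ through $V_{i+1}$ (which coincide iff $V_{i+1}\in\gamma$). The pair $\gamma,\Gamma$ admits a $1$-parameter family of Poncelet $n$-gons if for every $p\in\Gamma$ and every tangent line $\ell$ of $\gamma$ through $p$ there is a Poncelet $n$-gon with $V_1=p$ and $\ell_1=\ell$. A Poncelet polygon is degenerate if for some $i$ either $V_i\in\gamma\cap\Gamma$ or the tangent line of $\Gamma$ at $V_i$ is also tangent to $\gamma$; otherwise it is non-degenerate. For a polygon $P$ with finite vertices $V_i=(x_i,y_i)\in\mathbb{C}^2$ put $$A(P)=\frac12\sum_{i=1}^n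 (x_iy_{i+1}-x_{i+1}y_i),$$ and, if $A(P)\ne 0$, $$CCM(P)=\frac{1}{4A(P)}\Bigl(\sum_{i=1}^n y_i(x_{i-1}^2+y_{i-1}^2-x_{i+1}^2-y_{i+1}^2),\ \sum_{i=1}^n -x_i(x_{i-1}^2+y_{i-1}^2-x_{i+1}^2-y_{i+1}^2)\Bigr),$$ $$CM_2(P)=\frac{1}{6A(P)}\sum_{i=1}^n (x_iy_{i+1}-x_{i+1}y_i)\,(x_i+x_{i+1},\,y_i+y_{i+1}).$$ **Proposition.** Let $\gamma,\Gamma$ admit a $1$-parameter family of Poncelet $n$-gons whose area is not identically zero, i.e. some Poncelet $n$-gon with finite vertices has nonzero area. Let $P$ be a degenerate Poncelet $n$-gon with finite vertices, and let $P_t$ ($t\ne 0$ near $0$ in $\mathbb{R}$ or in $\mathbb{C}$) be non-degenerate Poncelet $n$-gons with finite vertices such that $\lim_{t\to 0}P_t=P$. Then $A(P_t)\neq 0$ for all sufficiently small $t\ne 0$, so that $CCM(P_t)$ and $CM_2(P_t)$ are defined, and the limits $$\lim_{t\to 0}CCM(P_t)\qquad\text{and}\qquad \lim_{t\to 0}CM_2(P_t)$$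 exist in $\mathbb{C}^2$. -/

import Mathlib

open Filter Topology
open scoped LinearAlgebra.Projectivization Matrix

/-- The complex projective plane `ℂP²`. Its lines are represented by points of the same type: the
line `[a : b : c]` is `{[x : y : z] | a x + b y + c z = 0}`, so that the point `p` lies on the line
`ℓ` iff `Projectivization.orthogonal p ℓ`. -/
abbrev CP2 : Type := ℙ ℂ (Fin 3 → ℂ)

/-- The inclusion of the affine plane, `(x, y) ↦ [x : y : 1]`; its image consists of the finite
points. -/
noncomputable def CP2.ofAffine (v : ℂ × ℂ) : CP2 :=
  Projectivization.mk ℂ ![v.1, v.2, 1] (fun h => one_ne_zero (congrFun h 2))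

/-- A smooth conic in `ℂP²`, given by a nonsingular symmetric matrix `M`;
its equation is `pᵀ M p = 0`. -/
structure SmoothConic where
  M : Matrix (Fin 3) (Fin 3) ℂ
  symm : M.IsSymm
  det_ne_zero : M.det ≠ 0

namespace SmoothConic

theorem mulVec_injective (C : SmoothConic) : Function.Injective (Matrix.toLin' C.M) := by
  have h : IsUnit C.M := (Matrix.isUnit_iff_isUnit_det _).2 (isUnit_iff_ne_zero.2 C.det_ne_zero)
  exact Matrix.mulVec_injective_of_isUnit h

/-- The line with coefficient vector `M p`. If `p` is a point of the conic, the vector `2 M p` is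
the gradient of the equation `pᵀ M p = 0` at `p`, so this is the tangent line of the conic
at `p`. -/
noncomputable def tangentLine (C : SmoothConic) : CP2 → CP2 :=
  Projectivization.map (Matrix.toLin' C.M) C.mulVec_injective

/-- The points of the conic: the points `p` with `pᵀ M p = 0`, i.e. with `p` on the line with
coefficient vector `M p`. -/
def points (C : SmoothConic) : Set CP2 :=
  {p | Projectivization.orthogonal p (C.tangentLine p)}

/-- The set of all tangent lines of the conic. -/
def tangents (C : SmoothConic) : Set CP2 :=
  C.tangentLine '' C.points

end SmoothConic

/-- `V` is the sequence of vertices and `ℓ` the sequence of sides of a closed `n`-gon which is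
inscribed in `Γ` and circumscribed about `γ`, with indices modulo `n`: the line `ℓ i` meets `Γ` in
exactly `V i` and `V (i + 1)` (one point if `ℓ i` is tangent to `Γ`), and the tangent lines of `γ`
through `V (i + 1)` are exactly `ℓ i` and `ℓ (i + 1)` (one line if `V (i + 1)` is on `γ`). -/
def IsPonceletChain (γ Γ : SmoothConic) {n : ℕ} (V ℓ : ZMod n → CP2) : Prop :=
  ∀ i, {p | p ∈ Γ.points ∧ Projectivization.orthogonal p (ℓ i)} = {V i, V (i + 1)} ∧
    {m | m ∈ γ.tangents ∧ Projectivization.orthogonal (V (i + 1)) m} = {ℓ i, ℓ (i + 1)}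

/-- `V` is a Poncelet `n`-gon, with vertices on `Γ` and sides tangent to `γ`. -/
def IsPonceletPolygon (γ Γ : SmoothConic) {n : ℕ} (V : ZMod n → CP2) : Prop :=
  ∃ ℓ, IsPonceletChain γ Γ V ℓ

/-- The conics admit a `1`-parameter family of Poncelet `n`-gons: the construction closes after
`n` steps, whatever the first vertex `p` on `Γ` and the first side `m` through `p` tangent
to `γ`. -/
def AdmitsPonceletFamily (γ Γ : SmoothConic) (n : ℕ) : Prop :=
  ∀ p ∈ Γ.points, ∀ m ∈ γ.tangents, Projectivization.orthogonal p m →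
    ∃ V ℓ : ZMod n → CP2, IsPonceletChain γ Γ V ℓ ∧ V 0 = p ∧ ℓ 0 = m

/-- Some vertex `V i` lies on `γ ∩ Γ`, or the tangent line of `Γ` at some vertex `V i` is also
tangent to `γ`. -/
def IsDegeneratePolygon (γ Γ : SmoothConic) {n : ℕ} (V : ZMod n → CP2) : Prop :=
  ∃ i, V i ∈ γ.points ∩ Γ.points ∨ Γ.tangentLine (V i) ∈ γ.tangents

/-- The algebraic area of the polygon with vertices `P i = (x i, y i)`. -/
noncomputable def polygonArea {n : ℕ} [NeZero n] (P : ZMod n → ℂ × ℂ) : ℂ :=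
  1 / 2 * ∑ i, ((P i).1 * (P (i + 1)).2 - (P (i + 1)).1 * (P i).2)

/-- The circumcenter of mass of a polygon of nonzero area. -/
noncomputable def polygonCCM {n : ℕ} [NeZero n] (P : ZMod n → ℂ × ℂ) : ℂ × ℂ :=
  (1 / (4 * polygonArea P)) •
    (∑ i, (P i).2 * ((P (i - 1)).1 ^ 2 + (P (i - 1)).2 ^ 2
        - (P (i + 1)).1 ^ 2 - (P (i + 1)).2 ^ 2),
     ∑ i, -(P i).1 * ((P (i - 1)).1 ^ 2 + (P (i - 1)).2 ^ 2
        - (P (i + 1)).1 ^ 2 - (P (i + 1)).2 ^ 2))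

/-- The center of mass of a polygon of nonzero area, as a homogeneous lamina. -/
noncomputable def polygonCM₂ {n : ℕ} [NeZero n] (P : ZMod n → ℂ × ℂ) : ℂ × ℂ :=
  (1 / (6 * polygonArea P)) •
    ∑ i, ((P i).1 * (P (i + 1)).2 - (P (i + 1)).1 * (P i).2) • (P i + P (i + 1))

/-! Vertices lie on `Γ` and sides are points of `γ.dual`, so a Poncelet polygon unrolls to a doubly
infinite chain `z` alternating between two conics, where `z (k - 1)` and `z (k + 1)` are the two
points incident with `z k`. Two consecutive terms determine a chain, and one term determines it up
to reversal. A special index, `z (k - 1) = z (k + 1)`, forces degeneracy, and the chain is then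
symmetric about `k`.

The area and the numerators of both centers are odd: invariant under cyclic shifts, of opposite sign
for the reversed polygon. They all vanish at symmetric polygons, and it must be shown that the
numerators vanish there at least to the order of the area. The order of the area is controlled by an
invariant. The area cleared of denominators, `homArea`, has degree 1 in each vertex vector;
`specialProduct` has degree 4 and is nonzero on nonspecial chains. So `areaRatio`, the fourth power
of `homArea` over `specialProduct`, depends only on the polygon, even up to reversal, hence only on
the first vertex, a point of a rational curve. It is analytic off finitely many points and bounded,
so it is constant (`MinClosing.areaRatio_const`). The constant is nonzero because some polygon has
nonzero area; this gives nonzero area for every nonspecial polygon.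

Boundedness and the limits both come from `LocalModel`: near any chain there is an analytic family
with parameter `s` in which odd functions are divisible by `s ^ m`, while `specialProduct` is at
least of size `‖s‖ ^ (4 * m)`. Constancy of the ratio then makes the order of the area exactly `m`,
and odd function over area extends continuously to `s = 0` (`LocalModel.exists_tendsto`). For a
chain not constant on each parity, `m ≤ 1`: reflections about two special indices compose to a
translation, and translations fixing one nonconstant chain are multiples of the minimal period `N`
(`MinClosing.dvd_of_fixed`), so a period contains at most two special indices. For a constant chain,
where the conics touch, the recursion becomes linear with characteristic root a primitive `N`-th
root of unity `η`; the cyclic shift acts on the parameter by `η`, so odd functions are divisible by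
`s ^ N`, and `m = N`. -/

/-! ### Homogeneous coordinates and dual conics. -/

/-- The nonzero vector `v` represents the point `p`. -/
def IsLift (p : CP2) (v : Fin 3 → ℂ) : Prop :=
  ∃ hv : v ≠ 0, Projectivization.mk ℂ v hv = p

namespace IsLift

theorem ne_zero {p : CP2} {v : Fin 3 → ℂ} (h : IsLift p v) : v ≠ 0 := h.1

theorem rep (p : CP2) : IsLift p p.rep := ⟨p.rep_nonzero, p.mk_rep⟩

theorem unique {p q : CP2} {v : Fin 3 → ℂ} (hp : IsLift p v) (hq : IsLift q v) : p = q := by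
  obtain ⟨h, rfl⟩ := hp
  obtain ⟨h', rfl⟩ := hq
  rfl

theorem of_ne_zero {v : Fin 3 → ℂ} (hv : v ≠ 0) : ∃ p, IsLift p v := ⟨_, hv, rfl⟩

theorem smul {p : CP2} {v : Fin 3 → ℂ} (h : IsLift p v) {a : ℂ} (ha : a ≠ 0) :
    IsLift p (a • v) := by
  obtain ⟨h, rfl⟩ := h
  exact ⟨smul_ne_zero ha h, (Projectivization.mk_eq_mk_iff' ℂ _ _ _ _).2 ⟨a, rfl⟩⟩

theorem exists_smul {p : CP2} {v w : Fin 3 → ℂ} (hv : IsLift p v) (hw : IsLift p w) :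
    ∃ a : ℂ, a ≠ 0 ∧ w = a • v := by
  obtain ⟨h, rfl⟩ := hv
  obtain ⟨h', e⟩ := hw
  obtain ⟨a, ha⟩ := (Projectivization.mk_eq_mk_iff' ℂ _ _ _ _).1 e
  refine ⟨a, ?_, ha.symm⟩
  rintro rfl
  exact h' (by simpa using ha.symm)

theorem of_eq_smul {p : CP2} {v w : Fin 3 → ℂ} (hv : IsLift p v) {a : ℂ} (e : v = a • w) :
    IsLift p w := by
  have ha : a ≠ 0 := fun h => hv.ne_zero (by rw [e, h, zero_smul])
  have := hv.smul (inv_ne_zero ha)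
  rwa [e, smul_smul, inv_mul_cancel₀ ha, one_smul] at this

theorem orthogonal_iff {p q : CP2} {v w : Fin 3 → ℂ} (hp : IsLift p v) (hq : IsLift q w) :
    Projectivization.orthogonal p q ↔ v ⬝ᵥ w = 0 := by
  obtain ⟨h, rfl⟩ := hp
  obtain ⟨h', rfl⟩ := hq
  exact Projectivization.orthogonal_mk h h'

theorem tangentLine {p : CP2} {v : Fin 3 → ℂ} (h : IsLift p v) (C : SmoothConic) :
    IsLift (C.tangentLine p) (C.M *ᵥ v) := by
  obtain ⟨h, rfl⟩ := h
  refine ⟨fun h0 => h (C.mulVec_injective ?_), ?_⟩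
  · simpa using h0
  · simp [SmoothConic.tangentLine, Projectivization.map_mk]

theorem mem_points_iff {p : CP2} {v : Fin 3 → ℂ} (h : IsLift p v) (C : SmoothConic) :
    p ∈ C.points ↔ v ⬝ᵥ C.M *ᵥ v = 0 :=
  h.orthogonal_iff (h.tangentLine C)

end IsLift

namespace SmoothConic

theorem isUnit_det (C : SmoothConic) : IsUnit C.M.det := isUnit_iff_ne_zero.2 C.det_ne_zero

/-- The conic of the tangent lines of `C`. -/
noncomputable def dual (C : SmoothConic) : SmoothConic where
  M := C.M⁻¹
  symm := by
    have := C.symm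
    unfold Matrix.IsSymm at *
    rw [Matrix.transpose_nonsing_inv, this]
  det_ne_zero := by
    rw [Matrix.det_nonsing_inv]
    exact C.isUnit_det.ringInverse.ne_zero

theorem dual_M_inv (C : SmoothConic) : C.dual.M⁻¹ = C.M :=
  Matrix.nonsing_inv_nonsing_inv _ C.isUnit_det

theorem M_mulVec_dual (C : SmoothConic) (v : Fin 3 → ℂ) : C.M *ᵥ (C.dual.M *ᵥ v) = v := by
  simp [dual, Matrix.mulVec_mulVec, Matrix.mul_nonsing_inv _ C.isUnit_det]

theorem dual_mulVec_M (C : SmoothConic) (v : Fin 3 → ℂ) : C.dual.M *ᵥ (C.M *ᵥ v) = v := by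
  simp [dual, Matrix.mulVec_mulVec, Matrix.nonsing_inv_mul _ C.isUnit_det]

/-- Duality puts sides on the same footing as vertices: all later arguments treat a polygon as one
sequence alternating between two conics. -/
theorem tangents_eq (C : SmoothConic) : C.tangents = C.dual.points := by
  ext m
  constructor
  · rintro ⟨p, hp, rfl⟩
    have h := IsLift.rep p
    rw [(h.tangentLine C).mem_points_iff, C.dual_mulVec_M, dotProduct_comm]
    exact (h.mem_points_iff C).1 hp
  · intro hm
    have h := IsLift.rep m
    have h' := h.tangentLine C.dual
    refine ⟨C.dual.tangentLine m, ?_, ?_⟩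
    · rw [h'.mem_points_iff, C.M_mulVec_dual, dotProduct_comm]
      exact (h.mem_points_iff _).1 hm
    · have := h'.tangentLine C
      rw [C.M_mulVec_dual] at this
      exact this.unique h

end SmoothConic

/-! ### Rational parametrizations of a conic. -/

/-- The matrix of the quadratic form `2 (x z - y ^ 2)`. -/
def conicModel : Matrix (Fin 3) (Fin 3) ℂ := !![0, 0, 1; 0, -2, 0; 1, 0, 0]

/-- The affine part of the parametrization of a conic by the matrix `B`. -/
def par (B : Matrix (Fin 3) (Fin 3) ℂ) (x : ℂ) : Fin 3 → ℂ := B *ᵥ ![x ^ 2, x, 1]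

/-- The point at infinity of the parametrization of a conic by the matrix `B`. -/
def infPar (B : Matrix (Fin 3) (Fin 3) ℂ) : Fin 3 → ℂ := B *ᵥ ![1, 0, 0]

/-- The matrix `B` transforms the model conic into `C`. -/
def IsParam (C : SmoothConic) (B : Matrix (Fin 3) (Fin 3) ℂ) : Prop :=
  Bᵀ * C.M * B = conicModel

theorem par_dot (B : Matrix (Fin 3) (Fin 3) ℂ) (v : Fin 3 → ℂ) (x : ℂ) :
    par B x ⬝ᵥ v = (Bᵀ *ᵥ v) 0 * x ^ 2 + (Bᵀ *ᵥ v) 1 * x + (Bᵀ *ᵥ v) 2 := by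
  rw [par, dotProduct_comm, Matrix.dotProduct_mulVec, ← Matrix.mulVec_transpose]
  generalize Bᵀ *ᵥ v = z
  simp [dotProduct, Fin.sum_univ_three]

theorem infPar_dot (B : Matrix (Fin 3) (Fin 3) ℂ) (v : Fin 3 → ℂ) : infPar B ⬝ᵥ v = (Bᵀ *ᵥ v) 0 := by
  rw [infPar, dotProduct_comm, Matrix.dotProduct_mulVec, ← Matrix.mulVec_transpose]
  generalize Bᵀ *ᵥ v = z
  simp [dotProduct, Fin.sum_univ_three]

theorem det_conicModel : conicModel.det = 2 := by
  simp [conicModel, Matrix.det_fin_three]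

namespace IsParam

variable {C : SmoothConic} {B : Matrix (Fin 3) (Fin 3) ℂ}

theorem det_ne_zero (h : IsParam C B) : B.det ≠ 0 := by
  intro h0
  have := congrArg Matrix.det h
  rw [det_conicModel, Matrix.det_mul, h0, mul_zero] at this
  norm_num at this

theorem isUnit_det (h : IsParam C B) : IsUnit B.det := isUnit_iff_ne_zero.2 h.det_ne_zero

theorem inv_mulVec (h : IsParam C B) (v : Fin 3 → ℂ) : B⁻¹ *ᵥ (B *ᵥ v) = v := by
  simp [Matrix.mulVec_mulVec, Matrix.nonsing_inv_mul _ h.isUnit_det]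

theorem mulVec_inv (h : IsParam C B) (v : Fin 3 → ℂ) : B *ᵥ (B⁻¹ *ᵥ v) = v := by
  simp [Matrix.mulVec_mulVec, Matrix.mul_nonsing_inv _ h.isUnit_det]

theorem mulVec_ne_zero (h : IsParam C B) {v : Fin 3 → ℂ} (hv : v ≠ 0) : B *ᵥ v ≠ 0 := by
  intro h0
  apply hv
  rw [← h.inv_mulVec v, h0, Matrix.mulVec_zero]

theorem par_ne_zero (h : IsParam C B) (x : ℂ) : par B x ≠ 0 :=
  h.mulVec_ne_zero fun h0 => one_ne_zero (congrFun h0 2)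

theorem infPar_ne_zero (h : IsParam C B) : infPar B ≠ 0 :=
  h.mulVec_ne_zero fun h0 => one_ne_zero (congrFun h0 0)

theorem dotProduct_mulVec (h : IsParam C B) (v w : Fin 3 → ℂ) :
    (B *ᵥ v) ⬝ᵥ C.M *ᵥ (B *ᵥ w) = v ⬝ᵥ conicModel *ᵥ w := by
  rw [← h, Matrix.mulVec_mulVec, Matrix.dotProduct_mulVec, Matrix.dotProduct_mulVec,
    ← Matrix.vecMul_transpose, Matrix.vecMul_vecMul, Matrix.mul_assoc]

theorem par_dot_par (h : IsParam C B) (x y : ℂ) :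
    par B x ⬝ᵥ C.M *ᵥ par B y = (x - y) ^ 2 := by
  rw [par, par, h.dotProduct_mulVec]
  simp [conicModel, Matrix.mulVec, dotProduct, Fin.sum_univ_three]
  ring

theorem infPar_isotropic (h : IsParam C B) : infPar B ⬝ᵥ C.M *ᵥ infPar B = 0 := by
  rw [infPar, h.dotProduct_mulVec]
  simp [conicModel, Matrix.mulVec, dotProduct, Fin.sum_univ_three]

theorem inv_eq (h : IsParam C B) :
    C.M⁻¹ = B * !![0, 0, 1; 0, -(1 / 2), 0; 1, 0, 0] * Bᵀ := by
  have hJ : conicModel * !![0, 0, 1; 0, -(1 / 2), 0; 1, 0, 0] = 1 := by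
    ext i j
    fin_cases i <;> fin_cases j <;> simp [conicModel, Matrix.mul_apply, Fin.sum_univ_three]
  apply Matrix.inv_eq_right_inv
  have hT : IsUnit Bᵀ.det := by rw [Matrix.det_transpose]; exact h.isUnit_det
  have h1 : C.M * B = (Bᵀ)⁻¹ * conicModel := by
    rw [← h, Matrix.mul_assoc, Matrix.nonsing_inv_mul_cancel_left _ _ hT]
  calc C.M * (B * !![0, 0, 1; 0, -(1 / 2), 0; 1, 0, 0] * Bᵀ)
      = (C.M * B) * !![0, 0, 1; 0, -(1 / 2), 0; 1, 0, 0] * Bᵀ := by simp only [Matrix.mul_assoc]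
    _ = (Bᵀ)⁻¹ * (conicModel * !![0, 0, 1; 0, -(1 / 2), 0; 1, 0, 0]) * Bᵀ := by
        rw [h1]; simp only [Matrix.mul_assoc]
    _ = 1 := by rw [hJ, Matrix.mul_one, Matrix.nonsing_inv_mul _ hT]

/-- The dual form in terms of the coefficients of the restriction of a line to the conic. -/
theorem dual_form (h : IsParam C B) (v : Fin 3 → ℂ) :
    v ⬝ᵥ C.M⁻¹ *ᵥ v =
      -(1 / 2) * ((Bᵀ *ᵥ v) 1 ^ 2 - 4 * (Bᵀ *ᵥ v) 0 * (Bᵀ *ᵥ v) 2) := by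
  have : v ⬝ᵥ C.M⁻¹ *ᵥ v =
      (Bᵀ *ᵥ v) ⬝ᵥ !![0, 0, 1; 0, -(1 / 2), 0; 1, 0, 0] *ᵥ (Bᵀ *ᵥ v) := by
    rw [h.inv_eq, ← Matrix.mulVec_mulVec, ← Matrix.mulVec_mulVec, Matrix.dotProduct_mulVec v,
      ← Matrix.mulVec_transpose]
  rw [this]
  generalize Bᵀ *ᵥ v = z
  simp [Matrix.mulVec, dotProduct, Fin.sum_univ_three]
  ring

/-- An isotropic vector outside the line at infinity of the parametrization. -/
theorem eq_smul_par (h : IsParam C B) {v : Fin 3 → ℂ} (hv : v ⬝ᵥ C.M *ᵥ v = 0)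
    (h2 : (B⁻¹ *ᵥ v) 2 ≠ 0) :
    v = (B⁻¹ *ᵥ v) 2 • par B ((B⁻¹ *ᵥ v) 1 / (B⁻¹ *ᵥ v) 2) := by
  have e := h.mulVec_inv v
  rw [← e, h.dotProduct_mulVec] at hv
  conv_lhs => rw [← e]
  generalize B⁻¹ *ᵥ v = y at *
  simp [conicModel, Matrix.mulVec, dotProduct, Fin.sum_univ_three] at hv
  rw [par, ← Matrix.mulVec_smul]
  congr 1
  ext i
  fin_cases i
  · simp; field_simp; linear_combination (1 / 2) * hv
  · simp; field_simp
  · simp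

theorem eq_smul_infPar (h : IsParam C B) {v : Fin 3 → ℂ} (hv : v ⬝ᵥ C.M *ᵥ v = 0)
    (h2 : (B⁻¹ *ᵥ v) 2 = 0) : v = (B⁻¹ *ᵥ v) 0 • infPar B := by
  have e := h.mulVec_inv v
  rw [← e, h.dotProduct_mulVec] at hv
  conv_lhs => rw [← e]
  generalize B⁻¹ *ᵥ v = y at *
  simp [conicModel, Matrix.mulVec, dotProduct, Fin.sum_univ_three, h2] at hv
  rw [infPar, ← Matrix.mulVec_smul]
  congr 1
  ext i
  fin_cases i <;> simp [h2, hv]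

theorem inv_mulVec_par (h : IsParam C B) (x : ℂ) : B⁻¹ *ᵥ par B x = ![x ^ 2, x, 1] :=
  h.inv_mulVec _

theorem isLift_par_inj (h : IsParam C B) {p : CP2} {x y : ℂ} (hx : IsLift p (par B x))
    (hy : IsLift p (par B y)) : x = y := by
  obtain ⟨a, ha, e⟩ := hx.exists_smul hy
  have e' := congrArg (B⁻¹ *ᵥ ·) e
  simp only [Matrix.mulVec_smul, h.inv_mulVec_par] at e'
  have h2 := congrFun e' 2
  have h1 := congrFun e' 1
  simp at h1 h2
  rw [h1, ← h2, one_mul]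

theorem not_isLift_infPar (h : IsParam C B) {p : CP2} {x : ℂ} (hx : IsLift p (par B x)) :
    ¬ IsLift p (infPar B) := by
  intro hy
  obtain ⟨a, ha, e⟩ := hx.exists_smul hy
  have e' := congrArg (B⁻¹ *ᵥ ·) e
  simp only [Matrix.mulVec_smul, h.inv_mulVec_par, infPar, h.inv_mulVec] at e'
  have h2 := congrFun e' 2
  simp at h2
  exact ha h2.symm

theorem exists_isLift_par (h : IsParam C B) {p : CP2} (hp : p ∈ C.points)
    (hp' : ¬ IsLift p (infPar B)) : ∃ x, IsLift p (par B x) := by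
  have hl := IsLift.rep p
  have hv := (hl.mem_points_iff C).1 hp
  by_cases h2 : (B⁻¹ *ᵥ p.rep) 2 = 0
  · exact absurd (hl.of_eq_smul (h.eq_smul_infPar hv h2)) hp'
  · exact ⟨_, hl.of_eq_smul (h.eq_smul_par hv h2)⟩

theorem par_mem_points (h : IsParam C B) {p : CP2} {x : ℂ} (hx : IsLift p (par B x)) :
    p ∈ C.points := by
  rw [hx.mem_points_iff, h.par_dot_par, sub_self, zero_pow two_ne_zero]

theorem infPar_mem_points (h : IsParam C B) {p : CP2} (hx : IsLift p (infPar B)) :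
    p ∈ C.points := by
  rw [hx.mem_points_iff, h.infPar_isotropic]

end IsParam

/-- Every point of a conic is the point at infinity of a parametrization. -/
theorem exists_isParam_infPar (C : SmoothConic) {p : CP2} (hp : p ∈ C.points) :
    ∃ B, IsParam C B ∧ IsLift p (infPar B) := by
  have hl := IsLift.rep p
  have hv := (hl.mem_points_iff C).1 hp
  have hv0 := hl.ne_zero
  generalize p.rep = v at *
  have hs : ∀ i j, C.M i j = C.M j i := fun i j => C.symm.apply j i
  have hsym : ∀ x y : Fin 3 → ℂ, x ⬝ᵥ C.M *ᵥ y = y ⬝ᵥ C.M *ᵥ x := by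
    intro x y
    rw [Matrix.dotProduct_mulVec, ← Matrix.mulVec_transpose, C.symm.eq, dotProduct_comm]
  obtain ⟨w, hw⟩ : ∃ w, w ⬝ᵥ C.M *ᵥ v = 1 := by
    have h0 : C.M *ᵥ v ≠ 0 := (hl.tangentLine C).ne_zero
    obtain ⟨i, hi⟩ : ∃ i, (C.M *ᵥ v) i ≠ 0 := by
      by_contra! h
      exact h0 (funext h)
    refine ⟨Pi.single i ((C.M *ᵥ v) i)⁻¹, ?_⟩
    rw [single_dotProduct, inv_mul_cancel₀ hi]
  -- Subtracting a multiple of the isotropic vector `v` makes `w` isotropic and keeps its pairing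
  -- with `v`: `v` and `u` form a hyperbolic pair.
  obtain ⟨u, hu, huv⟩ : ∃ u, u ⬝ᵥ C.M *ᵥ u = 0 ∧ u ⬝ᵥ C.M *ᵥ v = 1 := by
    refine ⟨w - ((w ⬝ᵥ C.M *ᵥ w) / 2) • v, ?_, ?_⟩
    · simp only [Matrix.mulVec_sub, Matrix.mulVec_smul, sub_dotProduct, dotProduct_sub,
        smul_dotProduct, dotProduct_smul, hv, hw, hsym v w, smul_eq_mul]
      ring
    · simp only [sub_dotProduct, smul_dotProduct, hv, hw, smul_eq_mul]
      ring
  -- The vector `m` below is orthogonal to `v` and `u` and has norm `-C.M.det`, so this `c` rescales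
  -- the norm to `-2`, the middle entry of `conicModel`.
  obtain ⟨c, hc⟩ : ∃ c : ℂ, c ^ 2 = 2 / C.M.det := IsAlgClosed.exists_pow_nat_eq _ two_pos
  set m : Fin 3 → ℂ := crossProduct (C.M *ᵥ v) (C.M *ᵥ u) with hm
  have hmv : m ⬝ᵥ C.M *ᵥ v = 0 := by rw [hm, dotProduct_comm, dot_self_cross]
  have hmu : m ⬝ᵥ C.M *ᵥ u = 0 := by rw [hm, dotProduct_comm, dot_cross_self]
  have hmm : m ⬝ᵥ C.M *ᵥ m = C.M.det * ((v ⬝ᵥ C.M *ᵥ v) * (u ⬝ᵥ C.M *ᵥ u)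
      - (u ⬝ᵥ C.M *ᵥ v) ^ 2) := by
    rw [hm]
    simp only [Matrix.mulVec, dotProduct, Fin.sum_univ_three, cross_apply, Matrix.det_fin_three,
      Matrix.cons_val_zero, Matrix.cons_val_one, Matrix.cons_val, hs 1 0, hs 2 0, hs 2 1]
    ring
  rw [hv, huv] at hmm
  have hmm' : (c • m) ⬝ᵥ C.M *ᵥ (c • m) = -2 := by
    simp only [Matrix.mulVec_smul, smul_dotProduct, dotProduct_smul, hmm, smul_eq_mul]
    have := C.det_ne_zero
    have h3 : c ^ 2 * C.M.det = 2 := by rw [hc]; field_simp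
    linear_combination -h3
  set B : Matrix (Fin 3) (Fin 3) ℂ := Matrix.of ![v, c • m, u] with hB
  refine ⟨Bᵀ, ?_, ?_⟩
  · have key : ∀ i j, (B * C.M * Bᵀ) i j = B i ⬝ᵥ C.M *ᵥ B j := by
      intro i j
      rw [Matrix.mul_assoc, Matrix.mul_apply']
      rfl
    rw [IsParam, Matrix.transpose_transpose]
    ext i j
    rw [key]
    have hvm : v ⬝ᵥ C.M *ᵥ (c • m) = 0 := by rw [hsym, smul_dotProduct, hmv, smul_zero]
    have hmv' : (c • m) ⬝ᵥ C.M *ᵥ v = 0 := by rw [smul_dotProduct, hmv, smul_zero]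
    have hum : u ⬝ᵥ C.M *ᵥ (c • m) = 0 := by rw [hsym, smul_dotProduct, hmu, smul_zero]
    have hmu' : (c • m) ⬝ᵥ C.M *ᵥ u = 0 := by rw [smul_dotProduct, hmu, smul_zero]
    have hvu : v ⬝ᵥ C.M *ᵥ u = 1 := by rw [hsym, huv]
    fin_cases i <;> fin_cases j
    exacts [hv, hvm, hvu, hmv', hmm', hmu', huv, hum, hu]
  · convert hl using 1
    ext i
    simp [infPar, Matrix.mulVec, dotProduct, Fin.sum_univ_three, hB]

/-- Parametrizations of a conic with a point at infinity outside a given finite set. -/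
theorem exists_isParam_avoid (C : SmoothConic) (hne : C.points.Nonempty) {F : Set CP2}
    (hF : F.Finite) : ∃ B, IsParam C B ∧ ∀ p ∈ F, ¬ IsLift p (infPar B) := by
  obtain ⟨p, hp⟩ := hne
  obtain ⟨B, hB, -⟩ := exists_isParam_infPar C hp
  choose q hq using fun x => IsLift.of_ne_zero (hB.par_ne_zero x)
  have hinj : Function.Injective q := by
    intro x y h
    exact hB.isLift_par_inj (hq x) (h ▸ hq y)
  obtain ⟨_, ⟨x, rfl⟩, hx⟩ := (Set.infinite_range_of_injective hinj).exists_notMem_finite hF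
  obtain ⟨B', hB', h'⟩ := exists_isParam_infPar C (hB.par_mem_points (hq x))
  refine ⟨B', hB', fun r hr h => hx ?_⟩
  rwa [h'.unique h]

/-! ### Chains on two conics and their dihedral symmetry. -/

/-- The sequence which is `a` at even and `b` at odd indices. -/
def alt {α : Type*} (a b : α) (k : ℤ) : α := if Even k then a else b

section alt

variable {α : Type*} (a b : α)

theorem alt_of_even {k : ℤ} (h : Even k) : alt a b k = a := if_pos h

theorem alt_of_odd {k : ℤ} (h : Odd k) : alt a b k = b := if_neg (Int.not_even_iff_odd.2 h)

theorem alt_congr {k l : ℤ} (h : Even k ↔ Even l) : alt a b k = alt a b l := by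
  simp only [alt, h]

theorem alt_add_two_mul (k j : ℤ) : alt a b (k + 2 * j) = alt a b k :=
  alt_congr a b (by simp only [Int.even_iff]; omega)

theorem alt_sub_one (k : ℤ) : alt a b (k - 1) = alt a b (k + 1) :=
  alt_congr a b (by simp only [Int.even_iff]; omega)

theorem alt_two_mul_sub (k j : ℤ) : alt a b (2 * j - k) = alt a b k :=
  alt_congr a b (by simp [Int.even_sub])

end alt

/-- A doubly infinite sequence of points of the conics `C` (even indices) and `D` (odd indices)
such that the polar line with coefficient vector `z k` meets the conic of the other parity exactly
in `z (k - 1)` and `z (k + 1)`. -/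
def IsDualChain (C D : SmoothConic) (z : ℤ → CP2) : Prop :=
  ∀ k, {p | p ∈ (alt C D (k + 1)).points ∧ Projectivization.orthogonal p (z k)}
    = {z (k - 1), z (k + 1)}

theorem pair_eq_left {α : Type*} {a b b' : α} (h : ({a, b} : Set α) = {a, b'}) : b = b' := by
  have h1 : b ∈ ({a, b'} : Set α) := h ▸ (by simp)
  have h2 : b' ∈ ({a, b} : Set α) := h ▸ (by simp)
  simp only [Set.mem_insert_iff, Set.mem_singleton_iff] at h1 h2
  rcases h1 with h1 | h1
  · rcases h2 with h2 | h2
    · rw [h1, h2]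
    · exact h2.symm
  · exact h1

namespace IsDualChain

variable {C D : SmoothConic} {z z' : ℤ → CP2}

theorem mem_and_orthogonal (h : IsDualChain C D z) (k : ℤ) :
    z (k + 1) ∈ (alt C D (k + 1)).points ∧ Projectivization.orthogonal (z (k + 1)) (z k) := by
  have : z (k + 1) ∈ ({z (k - 1), z (k + 1)} : Set CP2) := by simp
  rw [← h k] at this
  exact this

theorem mem_points (h : IsDualChain C D z) (k : ℤ) : z k ∈ (alt C D k).points := by
  have := (h.mem_and_orthogonal (k - 1)).1
  rwa [sub_add_cancel] at this

theorem zero_mem (h : IsDualChain C D z) : z 0 ∈ C.points := h.mem_points 0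

theorem orthogonal_succ (h : IsDualChain C D z) (k : ℤ) :
    Projectivization.orthogonal (z (k + 1)) (z k) := (h.mem_and_orthogonal k).2

/-- The chain relation does not distinguish the two neighbours, and `2 * j - k` has the parity of
`k`, so the conics keep their places. -/
theorem reflect (h : IsDualChain C D z) (j : ℤ) : IsDualChain C D (fun k => z (2 * j - k)) := by
  intro k
  have := h (2 * j - k)
  have e : alt C D (2 * j - k + 1) = alt C D (k + 1) :=
    alt_congr C D (by simp only [Int.even_iff]; omega)
  rw [e] at this
  rw [this, Set.pair_comm]
  congr 2 <;> ring_nf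

theorem reverse (h : IsDualChain C D z) : IsDualChain C D (fun k => z (-k)) := by
  simpa using h.reflect 0

theorem shift (h : IsDualChain C D z) (j : ℤ) : IsDualChain C D (fun k => z (k + 2 * j)) := by
  intro k
  have := h (k + 2 * j)
  have e : alt C D (k + 2 * j + 1) = alt C D (k + 1) :=
    alt_congr C D (by simp only [Int.even_iff]; omega)
  rw [e] at this
  rw [this]
  congr 2 <;> ring_nf

theorem succ_eq (h : IsDualChain C D z) (h' : IsDualChain C D z') {k : ℤ} (h0 : z k = z' k)
    (h1 : z (k - 1) = z' (k - 1)) : z (k + 1) = z' (k + 1) := by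
  have e := h k
  rw [h0, h' k, h1] at e
  exact (pair_eq_left e).symm

/-- An unordered pair and one of its members determine the other, even when they coincide; the chain
can thus be continued uniquely in both directions. -/
theorem ext_of_eq (h : IsDualChain C D z) (h' : IsDualChain C D z') (k : ℤ) (h0 : z k = z' k)
    (h1 : z (k + 1) = z' (k + 1)) : z = z' := by
  have key : ∀ m : ℤ, z m = z' m ∧ z (m + 1) = z' (m + 1) := by
    intro m
    induction m using Int.inductionOn' (b := k) with
    | zero => exact ⟨h0, h1⟩
    | succ m _ ih =>
      refine ⟨ih.2, h.succ_eq h' ih.2 ?_⟩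
      simpa using ih.1
    | pred m _ ih =>
      refine ⟨?_, by simpa using ih.1⟩
      have e := h m
      rw [ih.1, h' m, ih.2, Set.pair_comm, Set.pair_comm (z (m - 1))] at e
      exact (pair_eq_left e).symm
  exact funext fun m => (key m).1

/-- Only the direction of travel is left open by the first term. Quantities insensitive to reversal
therefore become functions on the conic `C`. -/
theorem eq_or_eq_reverse (h : IsDualChain C D z) (h' : IsDualChain C D z') (h0 : z 0 = z' 0) :
    z' = z ∨ z' = fun k => z (-k) := by
  have e := h 0
  have hm := (h' 0)
  rw [← h0, e] at hm
  have h1 : z' 1 ∈ ({z (0 - 1), z (0 + 1)} : Set CP2) := hm ▸ (by simp)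
  simp only [zero_sub, zero_add, Set.mem_insert_iff, Set.mem_singleton_iff] at h1
  rcases h1 with h1 | h1
  · exact Or.inr (h'.ext_of_eq h.reverse 0 (by simpa using h0.symm) (by simpa using h1))
  · exact Or.inl (h'.ext_of_eq h 0 h0.symm (by simpa using h1))

/-- A chain with a special element is symmetric about it. -/
theorem symmetric_of_special (h : IsDualChain C D z) {k : ℤ} (hk : z (k - 1) = z (k + 1)) (m : ℤ) :
    z (2 * k - m) = z m := by
  refine congrFun ((h.reflect k).ext_of_eq h k ?_ ?_) m
  · ring_nf
  · rw [← hk]; ring_nf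

theorem fixed_iff (h : IsDualChain C D z) (j : ℤ) :
    (∀ k, z (k + 2 * j) = z k) ↔ z (2 * j) = z 0 ∧ z (2 * j + 1) = z 1 := by
  constructor
  · intro H
    refine ⟨by simpa using H 0, ?_⟩
    rw [add_comm]; exact H 1
  · rintro ⟨h0, h1⟩ k
    refine congrFun ((h.shift j).ext_of_eq h 0 ?_ ?_) k
    · simpa using h0
    · simp only [zero_add]; rw [add_comm]; exact h1

end IsDualChain

/-! ### Neighbours as roots of a quadratic equation. -/

section root

variable {C : SmoothConic} {B : Matrix (Fin 3) (Fin 3) ℂ} {p q r : CP2} {v : Fin 3 → ℂ}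

theorem lead_ne_zero_of_section (hB : IsParam C B) (hq : IsLift q v)
    (h : {p | p ∈ C.points ∧ Projectivization.orthogonal p q} = {p, r})
    (hp : ¬ IsLift p (infPar B)) (hr : ¬ IsLift r (infPar B)) : (Bᵀ *ᵥ v) 0 ≠ 0 := by
  intro h0
  obtain ⟨s, hs⟩ := IsLift.of_ne_zero hB.infPar_ne_zero
  have : s ∈ ({p, r} : Set CP2) := by
    rw [← h]
    refine ⟨hB.infPar_mem_points hs, ?_⟩
    rw [hs.orthogonal_iff hq, infPar_dot, h0]
  rcases this with rfl | rfl
  · exact hp hs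
  · exact hr hs

/-- Vieta's formulas with multiplicity, although the section is given only as a set: if `x = y`, the
second root `-b / a - x` also gives a point of the section and so equals `x`. -/
theorem exists_roots_of_section (hB : IsParam C B) (hq : IsLift q v)
    (h : {p | p ∈ C.points ∧ Projectivization.orthogonal p q} = {p, r})
    (h0 : (Bᵀ *ᵥ v) 0 ≠ 0) :
    ∃ x y, IsLift p (par B x) ∧ IsLift r (par B y) ∧
      (Bᵀ *ᵥ v) 1 = -((Bᵀ *ᵥ v) 0 * (x + y)) ∧ (Bᵀ *ᵥ v) 2 = (Bᵀ *ᵥ v) 0 * (x * y) := by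
  have hinf : ∀ s ∈ ({p, r} : Set CP2), ¬ IsLift s (infPar B) := by
    intro s hs hs'
    rw [← h] at hs
    exact h0 (by rw [← infPar_dot, ← hs'.orthogonal_iff hq]; exact hs.2)
  have hp : p ∈ ({p, r} : Set CP2) := by simp
  have hr : r ∈ ({p, r} : Set CP2) := by simp
  have hip := hinf p hp
  have hir := hinf r hr
  have hmem : ∀ x, (Bᵀ *ᵥ v) 0 * x ^ 2 + (Bᵀ *ᵥ v) 1 * x + (Bᵀ *ᵥ v) 2 = 0 →
      IsLift p (par B x) ∨ IsLift r (par B x) := by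
    intro x hx
    obtain ⟨s, hs⟩ := IsLift.of_ne_zero (hB.par_ne_zero x)
    have : s ∈ ({p, r} : Set CP2) := by
      rw [← h]
      refine ⟨hB.par_mem_points hs, ?_⟩
      rw [hs.orthogonal_iff hq, par_dot, hx]
    rcases this with rfl | rfl
    · exact Or.inl hs
    · exact Or.inr hs
  rw [← h] at hp hr
  obtain ⟨x, hx⟩ := hB.exists_isLift_par hp.1 hip
  obtain ⟨y, hy⟩ := hB.exists_isLift_par hr.1 hir
  have ex := (hx.orthogonal_iff hq).1 hp.2
  have ey := (hy.orthogonal_iff hq).1 hr.2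
  rw [par_dot] at ex ey
  refine ⟨x, y, hx, hy, ?_⟩
  generalize (Bᵀ *ᵥ v) 0 = a at *
  generalize (Bᵀ *ᵥ v) 1 = b at *
  generalize (Bᵀ *ᵥ v) 2 = c at *
  have hb : b = -(a * (x + y)) := by
    by_cases hxy : x = y
    · have hx' : a * (-b / a - x) ^ 2 + b * (-b / a - x) + c = 0 := by
        rw [← ex]; field_simp; ring
      have : -b / a - x = x := by
        rcases hmem _ hx' with h' | h'
        · exact hB.isLift_par_inj h' hx
        · rw [hxy] at h' ⊢
          exact hB.isLift_par_inj h' hy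
      field_simp at this
      rw [← hxy]
      linear_combination -this
    · have : (x - y) * (b + a * (x + y)) = 0 := by linear_combination ex - ey
      rcases mul_eq_zero.1 this with h' | h'
      · exact absurd (sub_eq_zero.1 h') hxy
      · linear_combination h'
  exact ⟨hb, by rw [hb] at ex; linear_combination ex⟩

end root

/-- Both sides express the vanishing of the discriminant of the quadratic whose roots are the two
neighbours; the dual form is `-1 / 2` times that discriminant. -/
theorem IsDualChain.special_iff {C D : SmoothConic} {z : ℤ → CP2} (h : IsDualChain C D z) {k : ℤ}
    {v : Fin 3 → ℂ} (hv : IsLift (z k) v) :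
    z (k - 1) = z (k + 1) ↔ v ⬝ᵥ (alt C D (k + 1)).M⁻¹ *ᵥ v = 0 := by
  obtain ⟨B, hB, hB'⟩ := exists_isParam_avoid (alt C D (k + 1)) ⟨_, h.mem_points (k + 1)⟩
    (F := {z (k - 1), z (k + 1)}) (by simp)
  have h0 := lead_ne_zero_of_section hB hv (h k) (hB' _ (by simp)) (hB' _ (by simp))
  obtain ⟨x, y, hx, hy, e1, e2⟩ := exists_roots_of_section hB hv (h k) h0
  rw [hB.dual_form, e1, e2]
  have : z (k - 1) = z (k + 1) ↔ x = y := by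
    constructor
    · intro e
      exact hB.isLift_par_inj (e ▸ hx) hy
    · rintro rfl
      exact hx.unique hy
  rw [this]
  have e : -(1 / 2) * ((-((Bᵀ *ᵥ v) 0 * (x + y))) ^ 2
      - 4 * (Bᵀ *ᵥ v) 0 * ((Bᵀ *ᵥ v) 0 * (x * y)))
      = -(1 / 2) * ((Bᵀ *ᵥ v) 0 * (x - y)) ^ 2 := by ring
  rw [e]
  simp [h0, sub_eq_zero]

theorem exists_mem_points_orthogonal {D : SmoothConic} (hD : D.points.Nonempty) (q : CP2) :
    ∃ p ∈ D.points, Projectivization.orthogonal p q := by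
  obtain ⟨s, hs⟩ := hD
  obtain ⟨B, hB, hi⟩ := exists_isParam_infPar D hs
  have hq := IsLift.rep q
  by_cases h0 : (Bᵀ *ᵥ q.rep) 0 = 0
  · exact ⟨s, hs, by rw [hi.orthogonal_iff hq, infPar_dot, h0]⟩
  · obtain ⟨d, hd⟩ := IsAlgClosed.exists_pow_nat_eq
      ((Bᵀ *ᵥ q.rep) 1 ^ 2 - 4 * (Bᵀ *ᵥ q.rep) 0 * (Bᵀ *ᵥ q.rep) 2) two_pos
    obtain ⟨p, hp⟩ := IsLift.of_ne_zero
      (hB.par_ne_zero ((-(Bᵀ *ᵥ q.rep) 1 + d) / (2 * (Bᵀ *ᵥ q.rep) 0)))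
    refine ⟨p, hB.par_mem_points hp, ?_⟩
    rw [hp.orthogonal_iff hq, par_dot]
    field_simp
    linear_combination hd

/-! ### The incidence relation in affine coordinates. -/

/-- The two-periodic families of coordinate matrices. -/
structure ParamPair (C D : SmoothConic) where
  B : Matrix (Fin 3) (Fin 3) ℂ
  B' : Matrix (Fin 3) (Fin 3) ℂ
  hB : IsParam C B
  hB' : IsParam D B'

namespace ParamPair

variable {C D : SmoothConic} (P : ParamPair C D)

/-- The matrix of the coordinates used at the index `k`. -/
def mat (k : ℤ) : Matrix (Fin 3) (Fin 3) ℂ := alt P.B P.B' k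

theorem isParam (k : ℤ) : IsParam (alt C D k) (P.mat k) := by
  unfold mat alt
  split_ifs
  exacts [P.hB, P.hB']

/-- The matrix of the incidence relation between the coordinates at `k` and `k + 1`. -/
def inc (k : ℤ) : Matrix (Fin 3) (Fin 3) ℂ := (P.mat k)ᵀ * P.mat (k + 1)

theorem mat_add_two_mul (k j : ℤ) : P.mat (k + 2 * j) = P.mat k := alt_add_two_mul _ _ _ _

theorem mat_sub_one (k : ℤ) : P.mat (k - 1) = P.mat (k + 1) := alt_sub_one _ _ _

theorem mat_two_mul_sub (k j : ℤ) : P.mat (2 * j - k) = P.mat k := alt_two_mul_sub _ _ _ _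

theorem inc_succ (k : ℤ) : P.inc (k + 1) = (P.inc k)ᵀ := by
  have : P.mat (k + 1 + 1) = P.mat k := by
    rw [show k + 1 + 1 = k + 2 * 1 by ring, mat_add_two_mul]
  rw [inc, inc, this, Matrix.transpose_mul, Matrix.transpose_transpose]

theorem inc_add_two_mul (k j : ℤ) : P.inc (k + 2 * j) = P.inc k := by
  rw [inc, inc, mat_add_two_mul, show k + 2 * j + 1 = k + 1 + 2 * j by ring, mat_add_two_mul]

end ParamPair

/-- The coefficients of the polynomial `∑ f i j x ^ (2 - i) Y ^ (2 - j)` in `Y`. -/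
def cof (f : Matrix (Fin 3) (Fin 3) ℂ) (x : ℂ) : Fin 3 → ℂ := fᵀ *ᵥ ![x ^ 2, x, 1]

theorem cof_apply (f : Matrix (Fin 3) (Fin 3) ℂ) (x : ℂ) (j : Fin 3) :
    cof f x j = f 0 j * x ^ 2 + f 1 j * x + f 2 j := by
  simp [cof, Matrix.mulVec, dotProduct, Fin.sum_univ_three]

theorem ParamPair.cof_inc {C D : SmoothConic} (P : ParamPair C D) (k : ℤ) (x : ℂ) :
    (P.mat (k + 1))ᵀ *ᵥ par (P.mat k) x = cof (P.inc k) x := by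
  rw [cof, ParamPair.inc, Matrix.transpose_mul, Matrix.transpose_transpose, par,
    Matrix.mulVec_mulVec]

/-- The chain relation in affine coordinates. -/
def IsAffineChain (f : ℤ → Matrix (Fin 3) (Fin 3) ℂ) (x : ℤ → ℂ) : Prop :=
  ∀ k, cof (f k) (x k) 0 ≠ 0 ∧
    cof (f k) (x k) 1 = -(cof (f k) (x k) 0 * (x (k - 1) + x (k + 1))) ∧
    cof (f k) (x k) 2 = cof (f k) (x k) 0 * (x (k - 1) * x (k + 1))

namespace IsDualChain

variable {C D : SmoothConic} {z : ℤ → CP2}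

theorem neighbours (h : IsDualChain C D z) (P : ParamPair C D) {k : ℤ} {x : ℂ}
    (hx : IsLift (z k) (par (P.mat k) x)) (h0 : cof (P.inc k) x 0 ≠ 0) :
    ∃ y y', IsLift (z (k - 1)) (par (P.mat (k + 1)) y) ∧
      IsLift (z (k + 1)) (par (P.mat (k + 1)) y') ∧
      cof (P.inc k) x 1 = -(cof (P.inc k) x 0 * (y + y')) ∧
      cof (P.inc k) x 2 = cof (P.inc k) x 0 * (y * y') := by
  have := exists_roots_of_section (P.isParam (k + 1)) hx (h k)
  rw [P.cof_inc] at this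
  exact this h0

theorem exists_isAffineChain (h : IsDualChain C D z) (P : ParamPair C D)
    (hz : ∀ k, ¬ IsLift (z k) (infPar (P.mat k))) :
    ∃ x, (∀ k, IsLift (z k) (par (P.mat k) (x k))) ∧ IsAffineChain P.inc x := by
  choose x hx using fun k => (P.isParam k).exists_isLift_par (h.mem_points k) (hz k)
  refine ⟨x, hx, fun k => ?_⟩
  have h0 := lead_ne_zero_of_section (P.isParam (k + 1)) (hx k) (h k)
    (by rw [← P.mat_sub_one]; exact hz _) (hz _)
  rw [P.cof_inc] at h0
  obtain ⟨y, y', hy, hy', e1, e2⟩ := h.neighbours P (hx k) h0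
  rw [← P.mat_sub_one] at hy
  rw [(P.isParam _).isLift_par_inj (hx (k - 1)) hy, (P.isParam _).isLift_par_inj (hx (k + 1)) hy']
  exact ⟨h0, e1, e2⟩

end IsDualChain

/-- The incidence relation with matrix `f` in affine coordinates. -/
def Inc (f : Matrix (Fin 3) (Fin 3) ℂ) (x y : ℂ) : Prop :=
  cof f x 0 * y ^ 2 + cof f x 1 * y + cof f x 2 = 0

theorem inc_transpose {f : Matrix (Fin 3) (Fin 3) ℂ} {x y : ℂ} : Inc fᵀ y x ↔ Inc f x y := by
  simp only [Inc, cof_apply, Matrix.transpose_apply]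
  constructor <;> intro h <;> linear_combination h

theorem analyticAt_cof (f : Matrix (Fin 3) (Fin 3) ℂ) (j : Fin 3) (x : ℂ) :
    AnalyticAt ℂ (fun x => cof f x j) x := by
  simp only [cof_apply]
  fun_prop

theorem continuous_cof (f : Matrix (Fin 3) (Fin 3) ℂ) (j : Fin 3) :
    Continuous fun x => cof f x j := by
  simp only [cof_apply]
  fun_prop

/-! ### Analytic germs of families of chains. -/

/-- The analytic branch of a simple root. -/
theorem exists_root_branch (f : Matrix (Fin 3) (Fin 3) ℂ) {x₀ y₀ y₁ : ℂ}
    (h0 : cof f x₀ 0 ≠ 0) (h1 : cof f x₀ 1 = -(cof f x₀ 0 * (y₀ + y₁)))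
    (h2 : cof f x₀ 2 = cof f x₀ 0 * (y₀ * y₁)) (hy : y₀ ≠ y₁) :
    ∃ g : ℂ → ℂ, AnalyticAt ℂ g x₀ ∧ g x₀ = y₀ ∧ (∀ᶠ x in 𝓝 x₀, Inc f x (g x)) ∧
      ∀ᶠ p : ℂ × ℂ in 𝓝 (x₀, y₀), Inc f p.1 p.2 → p.2 = g p.1 := by
  set d : ℂ → ℂ := fun x => cof f x 1 ^ 2 - 4 * cof f x 0 * cof f x 2 with hd
  set e : ℂ := cof f x₀ 0 * (y₀ - y₁) with he
  have hy' : y₀ - y₁ ≠ 0 := sub_ne_zero.2 hy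
  have he0 : e ≠ 0 := mul_ne_zero h0 hy'
  have hde : d x₀ = e ^ 2 := by simp only [hd, he, h1, h2]; ring
  have hd0 : d x₀ ≠ 0 := by rw [hde]; exact pow_ne_zero 2 he0
  have hda : AnalyticAt ℂ d x₀ :=
    ((analyticAt_cof f 1 x₀).pow 2).sub
      ((analyticAt_const.mul (analyticAt_cof f 0 x₀)).mul (analyticAt_cof f 2 x₀))
  -- An analytic square root of `d` with value `e` at `x₀`; dividing by `d x₀` keeps the argument of
  -- the logarithm near 1, away from the cut.
  set q : ℂ → ℂ := fun x => e * Complex.exp (Complex.log (d x / d x₀) / 2) with hq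
  have hslit : d x₀ / d x₀ ∈ Complex.slitPlane := by
    rw [div_self hd0]; exact Complex.one_mem_slitPlane
  have hqa : AnalyticAt ℂ q x₀ := by
    have h3 : AnalyticAt ℂ (fun x => Complex.log (d x / d x₀)) x₀ :=
      (hda.div analyticAt_const hd0).clog hslit
    exact analyticAt_const.mul (h3.div analyticAt_const two_ne_zero).cexp
  have hqx : q x₀ = e := by simp [hq, div_self hd0]
  have hqq : ∀ x, d x ≠ 0 → q x ^ 2 = d x := by
    intro x hx
    simp only [hq, mul_pow, ← Complex.exp_nat_mul]
    rw [show ((2 : ℕ) : ℂ) * (Complex.log (d x / d x₀) / 2) = Complex.log (d x / d x₀) by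
      push_cast; ring, Complex.exp_log (div_ne_zero hx hd0), hde]
    field_simp
  have hev : ∀ᶠ x in 𝓝 x₀, cof f x 0 ≠ 0 ∧ d x ≠ 0 :=
    ((continuous_cof f 0).continuousAt.eventually_ne h0).and
      (hda.continuousAt.eventually_ne hd0)
  have hfac : ∀ x, cof f x 0 ≠ 0 → d x ≠ 0 → ∀ y, cof f x 0 * y ^ 2 + cof f x 1 * y + cof f x 2 =
      cof f x 0 * (y - (-cof f x 1 + q x) / (2 * cof f x 0)) *
        (y - (-cof f x 1 - q x) / (2 * cof f x 0)) := by
    intro x hx hdx y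
    have := hqq x hdx
    simp only [hd] at this
    field_simp
    linear_combination this
  have hga : ∀ c : ℂ, AnalyticAt ℂ (fun x => (-cof f x 1 + c * q x) / (2 * cof f x 0)) x₀ :=
    fun c => ((analyticAt_cof f 1 x₀).neg.add (analyticAt_const.mul hqa)).div
      (analyticAt_const.mul (analyticAt_cof f 0 x₀)) (mul_ne_zero two_ne_zero h0)
  refine ⟨fun x => (-cof f x 1 + q x) / (2 * cof f x 0), by simpa using hga 1, ?_, ?_, ?_⟩
  · simp only [hqx, he, h1]
    field_simp
    ring
  · filter_upwards [hev] with x hx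
    rw [Inc, hfac x hx.1 hx.2, sub_self, mul_zero, zero_mul]
  -- The other root is near `y₁ ≠ y₀`, so close to `(x₀, y₀)` only the factor belonging to the
  -- branch can vanish.
  · have h3 : ContinuousAt (fun p : ℂ × ℂ =>
        p.2 - (-cof f p.1 1 + (-1) * q p.1) / (2 * cof f p.1 0)) (x₀, y₀) :=
      continuousAt_snd.sub
        (ContinuousAt.comp (f := Prod.fst) (x := (x₀, y₀)) (hga (-1)).continuousAt continuousAt_fst)
    have h4 : y₀ - (-cof f x₀ 1 + (-1) * q x₀) / (2 * cof f x₀ 0) ≠ 0 := by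
      have : y₀ - (-cof f x₀ 1 + (-1) * q x₀) / (2 * cof f x₀ 0) = y₀ - y₁ := by
        rw [hqx, he, h1]
        field_simp
        ring
      rwa [this]
    filter_upwards [h3.eventually_ne h4, continuousAt_fst.eventually hev] with p hp hp' hi
    rw [Inc, hfac p.1 hp'.1 hp'.2] at hi
    rcases mul_eq_zero.1 hi with hi | hi
    · rcases mul_eq_zero.1 hi with hi | hi
      · exact absurd hi hp'.1
      · exact sub_eq_zero.1 hi
    · exact absurd (by rw [← hi]; ring) hp

/-- A germ of a one-parameter family of affine chains through the chain `x`, with the parameter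
recovered from the first two terms by `σ`. -/
structure ChainGerm (f : ℤ → Matrix (Fin 3) (Fin 3) ℂ) (x : ℤ → ℂ) (Z : ℕ → ℂ → ℂ)
    (σ : ℂ × ℂ → ℂ) : Prop where
  analytic : ∀ k, AnalyticAt ℂ (Z k) 0
  zero : ∀ k : ℕ, Z k 0 = x k
  step : ∀ (k : ℕ) s, Z (k + 2) s =
    -cof (f (k + 1)) (Z (k + 1) s) 1 / cof (f (k + 1)) (Z (k + 1) s) 0 - Z k s
  inc : ∀ᶠ s in 𝓝 0, Inc (f 0) (Z 0 s) (Z 1 s)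
  -- By Vieta the factor after `ρ` is the derivative of the incidence polynomial in its second
  -- variable, a square root of the discriminant. That one `ρ` serves all `k` says that the
  -- correspondence preserves the differential `dx / √disc`.
  deriv : ∃ ρ ≠ 0, ∀ k : ℕ,
    HasDerivAt (Z k) (ρ * (cof (f k) (x k) 0 * (x (k + 1) - x (k - 1)))) 0
  analytic_σ : ∀ p, AnalyticAt ℂ σ p
  σ_zero : σ (x 0, x 1) = 0
  σ_Z : ∀ s, σ (Z 0 s, Z 1 s) = s
  capture : ∀ᶠ p : ℂ × ℂ in 𝓝 (x 0, x 1), Inc (f 0) p.1 p.2 →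
    Z 0 (σ p) = p.1 ∧ Z 1 (σ p) = p.2

/-- The sequence of functions generated from the first two by the chain recursion. -/
noncomputable def chainExtend (f : ℤ → Matrix (Fin 3) (Fin 3) ℂ) (Z₀ Z₁ : ℂ → ℂ) : ℕ → ℂ → ℂ
  | 0 => Z₀
  | 1 => Z₁
  | k + 2 => fun s => -cof (f (k + 1)) (chainExtend f Z₀ Z₁ (k + 1) s) 1 /
      cof (f (k + 1)) (chainExtend f Z₀ Z₁ (k + 1) s) 0 - chainExtend f Z₀ Z₁ k s

section germ

variable {f : ℤ → Matrix (Fin 3) (Fin 3) ℂ} {x : ℤ → ℂ}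

theorem hasDerivAt_cof (f : Matrix (Fin 3) (Fin 3) ℂ) (j : Fin 3) (x : ℂ) :
    HasDerivAt (fun x => cof f x j) (2 * f 0 j * x + f 1 j) x := by
  simp only [cof_apply]
  have := (((hasDerivAt_pow 2 x).const_mul (f 0 j)).add
    ((hasDerivAt_id x).const_mul (f 1 j))).add_const (f 2 j)
  refine this.congr_deriv ?_
  push_cast
  ring

/-- Differentiate the incidence equation along the family. Vieta's formulas turn the two partial
derivatives into leading coefficient times difference of roots. -/
theorem IsAffineChain.deriv_relation (hf : ∀ k, f (k + 1) = (f k)ᵀ) (hx : IsAffineChain f x)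
    {Z₀ Z₁ : ℂ → ℂ} {a b : ℂ} (h0 : Z₀ 0 = x 0) (h1 : Z₁ 0 = x 1) (ha : HasDerivAt Z₀ a 0)
    (hb : HasDerivAt Z₁ b 0) (hi : ∀ᶠ s in 𝓝 0, Inc (f 0) (Z₀ s) (Z₁ s)) :
    cof (f 0) (x 0) 0 * (x 1 - x (-1)) * b = cof (f 1) (x 1) 0 * (x 2 - x 0) * a := by
  have hc : ∀ j, HasDerivAt (fun s => cof (f 0) (Z₀ s) j)
      ((2 * f 0 0 j * x 0 + f 0 1 j) * a) 0 := by
    intro j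
    have := hasDerivAt_cof (f 0) j (Z₀ 0)
    rw [h0] at this
    exact HasDerivAt.comp (h₂ := fun x => cof (f 0) x j) 0 (h0 ▸ this) ha
  have hF := (((hc 0).mul (hb.pow 2)).add ((hc 1).mul hb)).add (hc 2)
  have hz : HasDerivAt (fun _ : ℂ => (0 : ℂ)) 0 0 := hasDerivAt_const _ _
  have heq := hF.unique (hz.congr_of_eventuallyEq (by
    filter_upwards [hi] with s hs
    simpa [Inc] using hs))
  obtain ⟨_, e1, _⟩ := hx 0
  obtain ⟨_, e1', _⟩ := hx 1
  have hf1 : f 1 = (f 0)ᵀ := by simpa using hf 0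
  simp only [Pi.pow_apply, h0, h1] at heq
  simp only [zero_sub, zero_add, sub_self, one_add_one_eq_two] at e1 e1'
  have e1'' := e1'
  rw [hf1] at e1'' ⊢
  simp only [cof_apply, Matrix.transpose_apply] at *
  push_cast at heq
  linear_combination heq - b * e1 - a * e1''

theorem IsAffineChain.exists_chainGerm_of_base (hf : ∀ k, f (k + 1) = (f k)ᵀ) (hx : IsAffineChain f x)
    {Z₀ Z₁ : ℂ → ℂ} {σ : ℂ × ℂ → ℂ} (a0 : AnalyticAt ℂ Z₀ 0) (a1 : AnalyticAt ℂ Z₁ 0)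
    (h0 : Z₀ 0 = x 0) (h1 : Z₁ 0 = x 1) {ρ : ℂ} (hρ : ρ ≠ 0)
    (d0 : HasDerivAt Z₀ (ρ * (cof (f 0) (x 0) 0 * (x 1 - x (-1)))) 0)
    (d1 : HasDerivAt Z₁ (ρ * (cof (f 1) (x 1) 0 * (x 2 - x 0))) 0)
    (hi : ∀ᶠ s in 𝓝 0, Inc (f 0) (Z₀ s) (Z₁ s)) (hσ : ∀ p, AnalyticAt ℂ σ p)
    (hσ0 : σ (x 0, x 1) = 0) (hσZ : ∀ s, σ (Z₀ s, Z₁ s) = s)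
    (hcap : ∀ᶠ p : ℂ × ℂ in 𝓝 (x 0, x 1), Inc (f 0) p.1 p.2 →
      Z₀ (σ p) = p.1 ∧ Z₁ (σ p) = p.2) :
    ChainGerm f x (chainExtend f Z₀ Z₁) σ := by
  have key : ∀ k : ℕ, AnalyticAt ℂ (chainExtend f Z₀ Z₁ k) 0 ∧ chainExtend f Z₀ Z₁ k 0 = x k ∧
      HasDerivAt (chainExtend f Z₀ Z₁ k)
        (ρ * (cof (f k) (x k) 0 * (x (k + 1) - x (k - 1)))) 0 := by
    intro k
    induction k using Nat.twoStepInduction with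
    | zero => exact ⟨a0, by simpa [chainExtend] using h0, by simpa [chainExtend] using d0⟩
    | one => exact ⟨a1, by simpa [chainExtend] using h1, by
        simpa [chainExtend, one_add_one_eq_two] using d1⟩
    | more k ih0 ih1 =>
      obtain ⟨ak, ek, dk⟩ := ih0
      obtain ⟨ak1, ek1, dk1⟩ := ih1
      push_cast at ek1 dk1 ⊢
      obtain ⟨n0, r1, r2⟩ := hx (k + 1)
      obtain ⟨-, p1, -⟩ := hx k
      obtain ⟨-, q1, -⟩ := hx (k + 2)
      rw [add_sub_cancel_right] at r1 r2 dk1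
      rw [show (k : ℤ) + 1 + 1 = k + 2 by ring] at r1 r2 dk1
      rw [show (k : ℤ) + 2 - 1 = k + 1 by ring] at q1 ⊢
      have hfk : f ((k : ℤ) + 1) = (f k)ᵀ := hf k
      have hfk2 : f ((k : ℤ) + 2) = f k := by
        have := hf ((k : ℤ) + 1)
        rw [hfk, Matrix.transpose_transpose] at this
        rw [← this]; ring_nf
      have n0' : cof (f (k + 1)) (chainExtend f Z₀ Z₁ (k + 1) 0) 0 ≠ 0 := by rw [ek1]; exact n0
      refine ⟨?_, ?_, ?_⟩
      · have hc : ∀ j, AnalyticAt ℂ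
            (fun s => cof (f (k + 1)) (chainExtend f Z₀ Z₁ (k + 1) s) j) 0 := fun j =>
          (analyticAt_cof (f (k + 1)) j _).comp ak1
        exact ((hc 1).neg.div (hc 0) n0').sub ak
      · simp only [chainExtend]
        rw [ek, ek1, r1]
        field_simp
        ring
      · have hc : ∀ j, HasDerivAt (fun s => cof (f (k + 1)) (chainExtend f Z₀ Z₁ (k + 1) s) j)
            ((2 * f (k + 1) 0 j * x (k + 1) + f (k + 1) 1 j) *
              (ρ * (cof (f (k + 1)) (x (k + 1)) 0 * (x (k + 2) - x k)))) 0 := by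
          intro j
          have := hasDerivAt_cof (f (k + 1)) j (x (k + 1))
          rw [← ek1] at this
          have h := HasDerivAt.comp (h₂ := fun x => cof (f (k + 1)) x j) 0 this dk1
          rw [ek1] at h
          exact h
        have := ((hc 1).neg.div (hc 0) n0').sub dk
        refine this.congr_deriv ?_
        simp only [ek1, Pi.neg_apply]
        rw [r1]
        rw [hfk2] at q1 ⊢
        rw [sub_eq_iff_eq_add, div_eq_iff (pow_ne_zero 2 n0), hfk]
        -- The difference of the Vieta relations at `k + 2` and `k`, which share the matrix `f k`;
        -- it carries the same `ρ` over to the next term.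
        have e : (2 * (f k)ᵀ 0 1 * x (k + 1) + (f k)ᵀ 1 1) * (x (k + 2) - x k)
            + (2 * (f k)ᵀ 0 0 * x (k + 1) + (f k)ᵀ 1 0) * (x (k + 2) ^ 2 - x k ^ 2) =
            -(cof (f k) (x k) 0 * (x (k + 1) - x (k - 1))
              + cof (f k) (x (k + 2)) 0 * (x (k + 2 + 1) - x (k + 1))) := by
          simp only [cof_apply, Matrix.transpose_apply] at *
          linear_combination q1 - p1
        linear_combination -ρ * cof (f k)ᵀ (x (k + 1)) 0 ^ 2 * e
  exact {
    analytic := fun k => (key k).1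
    zero := fun k => (key k).2.1
    step := fun k s => rfl
    inc := hi
    deriv := ⟨ρ, hρ, fun k => (key k).2.2⟩
    analytic_σ := hσ
    σ_zero := hσ0
    σ_Z := hσZ
    capture := hcap }

/-- The germ parametrized by the first term of the chain. -/
theorem IsAffineChain.exists_chainGerm_fst (hf : ∀ k, f (k + 1) = (f k)ᵀ)
    (hx : IsAffineChain f x) (h : x 1 ≠ x (-1)) :
    ∃ Z σ, ChainGerm f x Z σ ∧ ∀ p, σ p = p.1 - x 0 := by
  obtain ⟨n0, e1, e2⟩ := hx 0
  simp only [zero_sub, zero_add] at e1 e2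
  obtain ⟨g, ga, g0, gi, gu⟩ := exists_root_branch (f 0) (y₀ := x 1) (y₁ := x (-1)) n0
    (by rw [e1]; ring) (by rw [e2]; ring) h
  have hs : Tendsto (fun s : ℂ => x 0 + s) (𝓝 0) (𝓝 (x 0)) := by
    have : Continuous fun s : ℂ => x 0 + s := by fun_prop
    simpa using this.tendsto 0
  have hs' : AnalyticAt ℂ (fun s : ℂ => x 0 + s) 0 := by fun_prop
  have d0 : HasDerivAt (fun s : ℂ => x 0 + s) 1 0 := (hasDerivAt_id (0 : ℂ)).const_add (x 0)
  have ga' : AnalyticAt ℂ (fun s => g (x 0 + s)) 0 :=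
    AnalyticAt.comp (g := g) (by simpa using ga) hs'
  have hA : cof (f 0) (x 0) 0 * (x 1 - x (-1)) ≠ 0 := mul_ne_zero n0 (sub_ne_zero.2 h)
  have d1 := ga'.differentiableAt.hasDerivAt
  have hi : ∀ᶠ s in 𝓝 0, Inc (f 0) (x 0 + s) (g (x 0 + s)) := hs.eventually gi
  have hrel := hx.deriv_relation hf (by simp) (by simpa using g0) d0 d1 hi
  refine ⟨_, fun p => p.1 - x 0, hx.exists_chainGerm_of_base hf hs' ga' (by simp)
    (by simpa using g0) (inv_ne_zero hA) (by rw [inv_mul_cancel₀ hA]; exact d0)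
    (d1.congr_deriv ?_) hi (fun p => analyticAt_fst.sub analyticAt_const) (by simp) (by simp) ?_, fun p => rfl⟩
  · rw [eq_inv_mul_iff_mul_eq₀ hA, hrel, mul_one]
  · filter_upwards [gu] with p hp hi
    refine ⟨by ring, ?_⟩
    rw [hp hi]
    ring_nf

/-- The germ parametrized by the second term of the chain. -/
theorem IsAffineChain.exists_chainGerm_snd (hf : ∀ k, f (k + 1) = (f k)ᵀ)
    (hx : IsAffineChain f x) (h : x 2 ≠ x 0) :
    ∃ Z σ, ChainGerm f x Z σ ∧ ∀ p, σ p = p.2 - x 1 := by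
  obtain ⟨n0, e1, e2⟩ := hx 1
  simp only [sub_self, one_add_one_eq_two] at e1 e2
  obtain ⟨g, ga, g0, gi, gu⟩ := exists_root_branch (f 1) (y₀ := x 0) (y₁ := x 2) n0
    e1 e2 h.symm
  have hf1 : f 1 = (f 0)ᵀ := by simpa using hf 0
  simp only [hf1, inc_transpose] at gi gu
  have hs : Tendsto (fun s : ℂ => x 1 + s) (𝓝 0) (𝓝 (x 1)) := by
    have : Continuous fun s : ℂ => x 1 + s := by fun_prop
    simpa using this.tendsto 0
  have hs' : AnalyticAt ℂ (fun s : ℂ => x 1 + s) 0 := by fun_prop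
  have d1 : HasDerivAt (fun s : ℂ => x 1 + s) 1 0 := (hasDerivAt_id (0 : ℂ)).const_add (x 1)
  have ga' : AnalyticAt ℂ (fun s => g (x 1 + s)) 0 :=
    AnalyticAt.comp (g := g) (by simpa using ga) hs'
  have hA : cof (f 1) (x 1) 0 * (x 2 - x 0) ≠ 0 := mul_ne_zero n0 (sub_ne_zero.2 h)
  have d0 := ga'.differentiableAt.hasDerivAt
  have hi : ∀ᶠ s in 𝓝 0, Inc (f 0) (g (x 1 + s)) (x 1 + s) := hs.eventually gi
  have hrel := hx.deriv_relation hf (by simpa using g0) (by simp) d0 d1 hi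
  refine ⟨_, fun p => p.2 - x 1, hx.exists_chainGerm_of_base hf ga' hs' (by simpa using g0)
    (by simp) (inv_ne_zero hA) (d0.congr_deriv ?_) (by rw [inv_mul_cancel₀ hA]; exact d1)
    hi (fun p => analyticAt_snd.sub analyticAt_const) (by simp) (by simp) ?_, fun p => rfl⟩
  · rw [eq_inv_mul_iff_mul_eq₀ hA, ← hrel, mul_one]
  · have hsw : Tendsto (Prod.swap : ℂ × ℂ → ℂ × ℂ) (𝓝 (x 0, x 1)) (𝓝 (x 1, x 0)) :=
      continuous_swap.tendsto (x 0, x 1)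
    filter_upwards [hsw.eventually gu] with p hp hi
    refine ⟨?_, by ring⟩
    have := hp (by simpa using hi)
    simp only [Prod.fst_swap, Prod.snd_swap] at this
    rw [this]
    ring_nf

end germ

/-! ### Closing families: chains near a given chain and their translates. -/

theorem HasStrictDerivAt.eventually_injective {L : ℂ → ℂ} {a c : ℂ} (h : HasStrictDerivAt L a c)
    (ha : a ≠ 0) : ∀ᶠ p : ℂ × ℂ in 𝓝 (c, c), L p.1 = L p.2 → p.1 = p.2 := by
  have ho := h.isLittleO
  have hpos : (0 : ℝ) < ‖a‖ / 2 := by positivity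
  filter_upwards [ho.bound hpos] with p hp heq
  simp only [heq, sub_self, zero_sub, norm_neg] at hp
  have e : ‖(ContinuousLinearMap.toSpanSingleton ℂ a) (p.1 - p.2)‖ = ‖p.1 - p.2‖ * ‖a‖ := by
    simp
  rw [e] at hp
  have : ‖p.1 - p.2‖ * (‖a‖ / 2) ≤ 0 := by linarith
  have h0 : ‖p.1 - p.2‖ ≤ 0 := by
    by_contra hc
    push Not at hc
    have := mul_pos hc hpos
    linarith
  exact sub_eq_zero.1 (norm_le_zero_iff.1 h0)

/-- Through every point of `C` there is a chain, and all chains have the period `2 * N`. -/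
structure Closing (C D : SmoothConic) (N : ℕ) : Prop where
  exists_chain : ∀ p ∈ C.points, ∃ z, IsDualChain C D z ∧ z 0 = p
  periodic : ∀ z, IsDualChain C D z → ∀ k, z (k + 2 * N) = z k

theorem Closing.periodic_mul {C D : SmoothConic} {N : ℕ} (hc : Closing C D N) {z : ℤ → CP2}
    (h : IsDualChain C D z) (k : ℤ) (m : ℕ) : z (k + 2 * (m * N)) = z k := by
  induction m with
  | zero => simp
  | succ m ih =>
    rw [← ih, ← hc.periodic z h (k + 2 * (m * N))]
    push_cast
    ring_nf

namespace ChainGerm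

variable {C D : SmoothConic} {P : ParamPair C D} {x : ℤ → ℂ} {Z : ℕ → ℂ → ℂ} {σ : ℂ × ℂ → ℂ}

theorem tendsto (G : ChainGerm P.inc x Z σ) (k : ℕ) : Tendsto (Z k) (𝓝 0) (𝓝 (x k)) := by
  rw [← G.zero k]
  exact (G.analytic k).continuousAt

/-- While the leading coefficients stay nonzero, the recursion of the germ is Vieta's formula for
the actual chain. Only `M` steps are followed, so one neighbourhood serves them all. -/
theorem follow (G : ChainGerm P.inc x Z σ) (hx : IsAffineChain P.inc x) (M : ℕ) :
    ∀ᶠ s in 𝓝 0, ∀ z, IsDualChain C D z → IsLift (z 0) (par (P.mat 0) (Z 0 s)) →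
      IsLift (z 1) (par (P.mat 1) (Z 1 s)) →
        ∀ k : ℕ, k ≤ M → IsLift (z k) (par (P.mat k) (Z k s)) := by
  have hev : ∀ᶠ s in 𝓝 0, ∀ k ∈ Finset.range (M + 1), cof (P.inc k) (Z k s) 0 ≠ 0 := by
    rw [Filter.eventually_all_finset]
    intro k _
    have : Tendsto (fun s => cof (P.inc k) (Z k s) 0) (𝓝 0) (𝓝 (cof (P.inc k) (x k) 0)) :=
      ((continuous_cof (P.inc k) 0).tendsto _).comp (G.tendsto k)
    exact this.eventually_ne (hx k).1
  filter_upwards [hev] with s hs z hz h0 h1 k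
  induction k using Nat.twoStepInduction with
  | zero => exact fun _ => by simpa using h0
  | one => exact fun _ => by simpa using h1
  | more k ih0 ih1 =>
    intro hk
    have i0 := ih0 (by omega)
    have i1 := ih1 (by omega)
    have n0 := hs (k + 1) (Finset.mem_range.2 (by omega))
    push_cast at i1 n0 ⊢
    obtain ⟨y, y', hy, hy', e1, e2⟩ := hz.neighbours P i1 n0
    have em : P.mat ((k : ℤ) + 1 + 1) = P.mat k := by
      rw [show (k : ℤ) + 1 + 1 = k + 2 * 1 by ring, P.mat_add_two_mul]
    rw [add_sub_cancel_right, em] at hy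
    have ey : y = Z k s := (P.isParam k).isLift_par_inj hy i0
    have : Z (k + 2) s = y' := by
      rw [G.step, e1, ← ey]
      field_simp
      ring
    rw [this, show (k : ℤ) + 2 = k + 1 + 1 by ring]
    exact hy'

theorem exists_chain (G : ChainGerm P.inc x Z σ) (hx : IsAffineChain P.inc x) {N : ℕ}
    (hc : Closing C D N) (M : ℕ) : ∀ᶠ s in 𝓝 0, ∃ z, IsDualChain C D z ∧
      ∀ k : ℕ, k ≤ M → IsLift (z k) (par (P.mat k) (Z k s)) := by
  filter_upwards [G.follow hx M, G.inc] with s hs hi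
  obtain ⟨p, hp⟩ := IsLift.of_ne_zero ((P.isParam 0).par_ne_zero (Z 0 s))
  obtain ⟨q, hq⟩ := IsLift.of_ne_zero ((P.isParam 1).par_ne_zero (Z 1 s))
  obtain ⟨z, hz, rfl⟩ := hc.exists_chain p ((P.isParam 0).par_mem_points hp)
  have hmem : q ∈ ({z (0 - 1), z (0 + 1)} : Set CP2) := by
    rw [← hz 0]
    refine ⟨(P.isParam 1).par_mem_points hq, ?_⟩
    have e := P.cof_inc 0 (Z 0 s)
    rw [hq.orthogonal_iff hp, par_dot]
    rw [zero_add] at e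
    rw [e]
    exact hi
  rcases hmem with h | h
  · refine ⟨_, hz.reverse, hs _ hz.reverse (by simpa using hp) ?_⟩
    rw [h] at hq
    simpa using hq
  · refine ⟨_, hz, hs _ hz hp ?_⟩
    have h' : q = z 1 := by simpa using h
    rwa [h'] at hq

/-- The product of the distances from the two neighbours to `x 1` is the size of the incidence
polynomial at `x 1` over its leading coefficient, and tends to 0 as `u` approaches `x 0`. Below `δ ^
2` it forces one neighbour within `δ`; which one is unknown, whence the alternative of a reversed
chain. -/
theorem eventually_capture (G : ChainGerm P.inc x Z σ) (hx : IsAffineChain P.inc x) (M : ℕ)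
    {q : ℂ → Prop} (hq : ∀ᶠ s in 𝓝 0, q s) :
    ∀ᶠ u in 𝓝 (x 0), ∀ z, IsDualChain C D z → IsLift (z 0) (par (P.mat 0) u) →
      ∃ s, q s ∧ Z 0 s = u ∧ ((∀ k : ℕ, k ≤ M → IsLift (z k) (par (P.mat k) (Z k s))) ∨
        (∀ k : ℕ, k ≤ M → IsLift (z (-k)) (par (P.mat k) (Z k s)))) := by
  have hσ : Tendsto σ (𝓝 (x 0, x 1)) (𝓝 0) := by
    rw [← G.σ_zero]
    exact (G.analytic_σ _).continuousAt
  have hU := (hσ.eventually (hq.and (G.follow hx M))).and G.capture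
  rw [nhds_prod_eq] at hU
  obtain ⟨pa, ha, pb, hb, hab⟩ := Filter.eventually_prod_iff.1 hU
  obtain ⟨δ, hδ, hball⟩ := Metric.eventually_nhds_iff.1 hb
  obtain ⟨n0, r1, r2⟩ := hx 0
  simp only [zero_sub, zero_add] at r1 r2
  have hcont : Tendsto (fun u => (cof (P.inc 0) u 0 * x 1 ^ 2 + cof (P.inc 0) u 1 * x 1
      + cof (P.inc 0) u 2) / cof (P.inc 0) u 0) (𝓝 (x 0)) (𝓝 0) := by
    have h1 : ContinuousAt (fun u => (cof (P.inc 0) u 0 * x 1 ^ 2 + cof (P.inc 0) u 1 * x 1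
      + cof (P.inc 0) u 2) / cof (P.inc 0) u 0) (x 0) := by
      refine ContinuousAt.div ?_ (continuous_cof _ _).continuousAt n0
      have h0 := continuous_cof (P.inc 0) 0
      have h1 := continuous_cof (P.inc 0) 1
      have h2 := continuous_cof (P.inc 0) 2
      fun_prop
    have h2 := h1.tendsto
    have e : cof (P.inc 0) (x 0) 0 * x 1 ^ 2 + cof (P.inc 0) (x 0) 1 * x 1
        + cof (P.inc 0) (x 0) 2 = 0 := by rw [r1, r2]; ring
    rwa [e, zero_div] at h2
  have hsmall := Metric.tendsto_nhds.1 hcont (δ ^ 2) (by positivity)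
  filter_upwards [ha, hsmall, (continuous_cof (P.inc 0) 0).continuousAt.eventually_ne n0]
    with u hu hu' hn z hz hl
  obtain ⟨y, y', hy, hy', e1, e2⟩ := hz.neighbours P hl hn
  simp only [zero_sub, zero_add] at hy hy'
  have hprod : ‖y - x 1‖ * ‖y' - x 1‖ < δ ^ 2 := by
    rw [← norm_mul]
    rw [dist_zero_right, e1, e2] at hu'
    have e : (y - x 1) * (y' - x 1) = (cof (P.inc 0) u 0 * x 1 ^ 2 +
        -(cof (P.inc 0) u 0 * (y + y')) * x 1 + cof (P.inc 0) u 0 * (y * y')) /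
          cof (P.inc 0) u 0 := by
      rw [eq_div_iff hn]
      ring
    rwa [e]
  have hclose : ‖y - x 1‖ < δ ∨ ‖y' - x 1‖ < δ := by
    by_contra! hcon
    have := mul_le_mul hcon.1 hcon.2 hδ.le (norm_nonneg _)
    nlinarith
  have fin : ∀ w y, IsDualChain C D w → IsLift (w 0) (par (P.mat 0) u) →
      IsLift (w 1) (par (P.mat 1) y) → Inc (P.inc 0) u y → ‖y - x 1‖ < δ →
      ∃ s, q s ∧ Z 0 s = u ∧ ∀ k : ℕ, k ≤ M → IsLift (w k) (par (P.mat k) (Z k s)) := by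
    intro w y hw hw0 hw1 hi hyd
    obtain ⟨⟨hqs, hf⟩, hcap⟩ := hab hu (hball (by rwa [dist_eq_norm]))
    obtain ⟨c0, c1⟩ := hcap hi
    exact ⟨σ (u, y), hqs, c0, hf w hw (by rw [c0]; exact hw0) (by rw [c1]; exact hw1)⟩
  rcases hclose with h | h
  · obtain ⟨s, h1, h2, h3⟩ := fin _ y hz.reverse (by simpa using hl) (by simpa using hy)
      (by rw [Inc, e1, e2]; ring) h
    exact ⟨s, h1, h2, Or.inr h3⟩
  · obtain ⟨s, h1, h2, h3⟩ := fin _ y' hz hl hy' (by rw [Inc, e1, e2]; ring) h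
    exact ⟨s, h1, h2, Or.inl h3⟩

theorem step_congr (G : ChainGerm P.inc x Z σ) {j : ℕ} {s t : ℂ} (h0 : Z 0 t = Z (2 * j) s)
    (h1 : Z 1 t = Z (2 * j + 1) s) (k : ℕ) : Z k t = Z (2 * j + k) s := by
  induction k using Nat.twoStepInduction with
  | zero => exact h0
  | one => exact h1
  | more k ih0 ih1 =>
    rw [← add_assoc, G.step, G.step, ih0, ih1]
    have : P.inc (((2 * j + k : ℕ) : ℤ) + 1) = P.inc (k + 1) := by
      rw [← P.inc_add_two_mul (k + 1) j]
      push_cast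
      ring_nf
    rw [this, add_assoc]

/-- If the central chain of a germ is fixed by a translation, then so are its neighbours. -/
theorem eventually_fixed (G : ChainGerm P.inc x Z σ) (hx : IsAffineChain P.inc x) {N : ℕ}
    (hN : 0 < N) (hc : Closing C D N) {j : ℕ} (hj : ∀ k, x (k + 2 * j) = x k) :
    ∀ᶠ s in 𝓝 0, ∀ k, Z (2 * j + k) s = Z k s := by
  have hjm : ∀ (m : ℕ) (k : ℤ), x (k + (2 * j * m : ℕ)) = x k := by
    intro m k
    induction m with
    | zero => simp
    | succ m ih =>
      rw [← ih, ← hj (k + (2 * j * m : ℕ))]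
      push_cast
      ring_nf
  have hincm : ∀ m : ℕ, P.inc ((2 * j * m : ℕ) : ℤ) = P.inc 0 := by
    intro m
    rw [← P.inc_add_two_mul 0 (j * m)]
    push_cast
    ring_nf
  have hincm1 : ∀ m : ℕ, P.inc (((2 * j * m : ℕ) : ℤ) + 1) = P.inc 1 := by
    intro m
    rw [← P.inc_add_two_mul 1 (j * m)]
    push_cast
    ring_nf
  -- The parameter of the `s`-th chain after translation by `2 * j * m`.
  set T : ℕ → ℂ → ℂ := fun m s => σ (Z (2 * j * m) s, Z (2 * j * m + 1) s) with hT
  have hTa : ∀ m, AnalyticAt ℂ (T m) 0 := fun m =>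
    (G.analytic_σ _).comp₂ (G.analytic _) (G.analytic _)
  -- The central chain is invariant, so the formula for the derivatives gives the same values at `2
  -- * j * m` as at 0. Hence `T m` has the derivative of `T 0`, which is the identity.
  have hTd : ∀ m, HasDerivAt (T m) 1 0 := by
    obtain ⟨ρ, _, hd⟩ := G.deriv
    obtain ⟨S, hS⟩ : ∃ S, HasFDerivAt σ S (x 0, x 1) :=
      ⟨_, (G.analytic_σ _).differentiableAt.hasFDerivAt⟩
    have hz0 : ∀ m, Z (2 * j * m) 0 = x 0 := by
      intro m
      rw [G.zero, ← hjm m 0, zero_add]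
    have hz1 : ∀ m, Z (2 * j * m + 1) 0 = x 1 := by
      intro m
      rw [G.zero, ← hjm m 1]
      push_cast
      ring_nf
    have hder : ∀ m, HasDerivAt (T m) (S (ρ * (cof (P.inc 0) (x 0) 0 * (x 1 - x (-1))),
        ρ * (cof (P.inc 1) (x 1) 0 * (x 2 - x 0)))) 0 := by
      intro m
      have d0 : HasDerivAt (Z (2 * j * m)) (ρ * (cof (P.inc 0) (x 0) 0 * (x 1 - x (-1)))) 0 := by
        refine (hd (2 * j * m)).congr_deriv ?_
        rw [hincm]
        have e0 := hjm m 0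
        have e1 := hjm m 1
        have e2 := hjm m (-1)
        rw [zero_add] at e0
        rw [add_comm] at e1 e2
        rw [e0, e1, sub_eq_add_neg (_ : ℤ) 1, e2]
      have d1 : HasDerivAt (Z (2 * j * m + 1)) (ρ * (cof (P.inc 1) (x 1) 0 * (x 2 - x 0))) 0 := by
        refine (hd (2 * j * m + 1)).congr_deriv ?_
        push_cast
        have e0 := hjm m 0
        have e1 := hjm m 1
        have e2 := hjm m 2
        have e3 := hincm1 m
        push_cast at e0 e1 e2 e3
        rw [zero_add] at e0
        rw [add_comm] at e1 e2
        rw [e3, add_sub_cancel_right, e0, e1, add_assoc _ (1 : ℤ) 1, one_add_one_eq_two, e2]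
      have hp := d0.prodMk d1
      have hS' : HasFDerivAt σ S (Z (2 * j * m) 0, Z (2 * j * m + 1) 0) := by
        rwa [hz0, hz1]
      exact hS'.comp_hasDerivAt 0 hp
    have h1 : HasDerivAt (T 0) 1 0 := by
      refine (hasDerivAt_id (0 : ℂ)).congr_of_eventuallyEq (Eventually.of_forall fun s => ?_)
      simp [hT, G.σ_Z]
    intro m
    have := h1.unique (hder 0)
    rw [this]
    exact hder m
  -- Linearization by averaging: closing gives `T N = T 0` near 0, hence `L (T 1 s) = L s`, and `L`
  -- is injective near 0 because its derivative there is `N ≠ 0`. So `T 1` is the identity near 0.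
  set L : ℂ → ℂ := fun s => ∑ m ∈ Finset.range N, T m s with hL
  have hLa : AnalyticAt ℂ L 0 := by
    have := Finset.analyticAt_fun_sum (𝕜 := ℂ) (f := T) (c := 0) (Finset.range N)
      (fun m _ => hTa m)
    exact this
  have hLd : HasDerivAt L N 0 := by
    have := HasDerivAt.fun_sum (u := Finset.range N) (A := T) (A' := fun _ => 1) (x := 0)
      (fun m _ => hTd m)
    simpa using this
  have hLs : HasStrictDerivAt L N 0 := by
    have := hLa.hasStrictDerivAt
    rwa [hLd.deriv] at this
  have hinj := hLs.eventually_injective (Nat.cast_ne_zero.2 hN.ne')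
  have hT1 : Tendsto (T 1) (𝓝 0) (𝓝 0) := by
    have : T 1 0 = 0 := by
      have e0 := hjm 1 0
      have e1 := hjm 1 1
      rw [zero_add] at e0
      rw [add_comm] at e1
      simp only [hT, G.zero]
      rw [e0, Nat.cast_add, Nat.cast_one, e1, G.σ_zero]
    have h := (hTa 1).continuousAt.tendsto
    rwa [this] at h
  have hpt : Tendsto (fun s => (Z (2 * j) s, Z (2 * j + 1) s)) (𝓝 0) (𝓝 (x 0, x 1)) := by
    refine Tendsto.prodMk_nhds ?_ ?_
    · convert G.tendsto (2 * j) using 2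
      rw [← hj 0]; push_cast; ring_nf
    · convert G.tendsto (2 * j + 1) using 2
      rw [← hj 1]; push_cast; ring_nf
  filter_upwards [G.exists_chain hx hc (2 * j * N + 2 * j + 1), hpt.eventually G.capture,
    (hT1.prodMk_nhds tendsto_id).eventually hinj] with s ⟨z, hz, hzl⟩ hcap hin
  have hi : Inc (P.inc 0) (Z (2 * j) s) (Z (2 * j + 1) s) := by
    have l0 := hzl (2 * j) (by omega)
    have l1 := hzl (2 * j + 1) (by omega)
    have ho := hz.orthogonal_succ (2 * j)
    push_cast at l0 l1
    rw [l1.orthogonal_iff l0, par_dot, P.cof_inc] at ho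
    have : P.inc (2 * j) = P.inc 0 := by rw [← P.inc_add_two_mul 0 j, zero_add]
    rw [this] at ho
    exact ho
  obtain ⟨c0, c1⟩ := hcap hi
  have hT1s : T 1 s = σ (Z (2 * j) s, Z (2 * j + 1) s) := by simp [hT]
  rw [← hT1s] at c0 c1
  have hshift := G.step_congr c0 c1
  have hLL : L (T 1 s) = L s := by
    have e1 : L (T 1 s) = ∑ m ∈ Finset.range N, T (m + 1) s := by
      refine Finset.sum_congr rfl fun m _ => ?_
      simp only [hT]
      simp only [hT] at hshift
      rw [hshift, hshift]
      ring_nf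
    have e2 : T N s = T 0 s := by
      have lN := hzl (2 * j * N) (by omega)
      have lN1 := hzl (2 * j * N + 1) (by omega)
      have l0 := hzl 0 (by omega)
      have l1 := hzl 1 (by omega)
      have p0 := hc.periodic_mul hz 0 j
      have p1 := hc.periodic_mul hz 1 j
      have m0 := P.mat_add_two_mul 0 (j * N)
      have m1 := P.mat_add_two_mul 1 (j * N)
      rw [zero_add] at p0 m0
      push_cast at lN lN1 l0 l1
      rw [show (2 : ℤ) * j * N = 2 * (j * N) by ring] at lN
      rw [show (2 : ℤ) * j * N + 1 = 1 + 2 * (j * N) by ring] at lN1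
      rw [p0, m0] at lN
      rw [p1, m1] at lN1
      have q0 := (P.isParam 0).isLift_par_inj lN l0
      have q1 := (P.isParam 1).isLift_par_inj lN1 l1
      simp only [hT, q0, q1, mul_zero, zero_add]
    have e3 := Finset.sum_range_succ (fun m => T m s) N
    rw [Finset.sum_range_succ'] at e3
    rw [e1]
    simp only [hL]
    linear_combination e3 + e2
  have hfix : T 1 s = s := hin hLL
  intro k
  rw [← hshift k, hfix]

end ChainGerm

/-! ### Special elements and constant chains. -/

namespace IsDualChain

variable {C D : SmoothConic} {z z' : ℤ → CP2}

theorem eq_or_eq_reflect (h : IsDualChain C D z) (h' : IsDualChain C D z') (k : ℤ)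
    (h0 : z k = z' k) : z' = z ∨ z' = fun m => z (2 * k - m) := by
  have e := h k
  have hm := h' k
  rw [← h0, e] at hm
  have h1 : z' (k + 1) ∈ ({z (k - 1), z (k + 1)} : Set CP2) := hm ▸ (by simp)
  rcases h1 with h1 | h1
  · refine Or.inr (h'.ext_of_eq (h.reflect k) k ?_ ?_)
    · rw [← h0]; ring_nf
    · rw [h1]; ring_nf
  · exact Or.inl (h'.ext_of_eq h k h0.symm h1)

/-- A chain with two special elements is invariant under a translation. -/
theorem fixed_of_special (h : IsDualChain C D z) {k l : ℤ} (hk : z (k - 1) = z (k + 1))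
    (hl : z (l - 1) = z (l + 1)) (m : ℤ) : z (m + 2 * (l - k)) = z m := by
  rw [← h.symmetric_of_special hk m, ← h.symmetric_of_special hl (2 * k - m)]
  ring_nf

/-- Reflections about adjacent indices compose to the translation by 2. Geometrically, the conics
touch each other at the vertex. -/
theorem const_of_special (h : IsDualChain C D z) {k : ℤ} (hk : z (k - 1) = z (k + 1))
    (hl : z k = z (k + 2)) (m : ℤ) : z (m + 2) = z m := by
  have := h.fixed_of_special hk (l := k + 1) (by rw [add_sub_cancel_right, hl]; ring_nf) m
  rw [← this]
  ring_nf

theorem exists_ne (h : IsDualChain C D z) (hz : ¬ ∀ m, z (m + 2) = z m) (k : ℤ) :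
    z (k + 1) ≠ z (k - 1) ∨ z (k + 2) ≠ z k := by
  by_contra! hc
  exact hz (h.const_of_special hc.1.symm hc.2.symm)

theorem fixed_mul (hf : ∀ k, z (k + 2) = z k) (j : ℕ) (k : ℤ) : z (k + 2 * j) = z k := by
  induction j with
  | zero => simp
  | succ j ih =>
    rw [← ih, ← hf (k + 2 * j)]
    push_cast
    ring_nf

end IsDualChain

theorem IsLift.ne_of_ne {C : SmoothConic} {B : Matrix (Fin 3) (Fin 3) ℂ} (hB : IsParam C B)
    {p q : CP2} {x y : ℂ} (hp : IsLift p (par B x)) (hq : IsLift q (par B y)) :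
    p = q ↔ x = y := by
  constructor
  · rintro rfl
    exact hB.isLift_par_inj hp hq
  · rintro rfl
    exact hp.unique hq

theorem Closing.add_emod {C D : SmoothConic} {N : ℕ} (hc : Closing C D N) {z : ℤ → CP2}
    (hz : IsDualChain C D z) (m k : ℤ) : z (m + k % (2 * N)) = z (m + k) := by
  have hp : Function.Periodic z (2 * N : ℤ) := fun k => hc.periodic z hz k
  have := hp.int_mul (k / (2 * N)) (m + k % (2 * N))
  rw [← this, Int.cast_id, add_assoc, mul_comm (k / (2 * N : ℤ)), Int.emod_add_mul_ediv]

/-- A pair of coordinate systems for which a given pair of chains is finite. -/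
theorem exists_paramPair_avoid {C D : SmoothConic} {N : ℕ} (hN : 0 < N) (hc : Closing C D N)
    {z w : ℤ → CP2} (hz : IsDualChain C D z) (hw : IsDualChain C D w) :
    ∃ P : ParamPair C D, (∀ k, ¬ IsLift (z k) (infPar (P.mat k))) ∧
      ∀ k, ¬ IsLift (w k) (infPar (P.mat k)) := by
  have hfin : ∀ z, IsDualChain C D z → (Set.range z).Finite := by
    intro z hz
    have : Set.range z ⊆ z '' (Set.Ico (0 : ℤ) (2 * N)) := by
      rintro _ ⟨k, rfl⟩
      refine ⟨k % (2 * N), ⟨Int.emod_nonneg _ (by omega), Int.emod_lt_of_pos _ (by omega)⟩, ?_⟩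
      simpa using hc.add_emod hz 0 k
    exact ((Set.finite_Ico _ _).image _).subset this
  have hF := (hfin z hz).union (hfin w hw)
  obtain ⟨B, hB, hBa⟩ := exists_isParam_avoid C ⟨_, hz.mem_points 0⟩ hF
  obtain ⟨B', hB', hBa'⟩ := exists_isParam_avoid D ⟨_, hz.mem_points 1⟩ hF
  refine ⟨⟨B, B', hB, hB'⟩, fun k => ?_, fun k => ?_⟩
  · unfold ParamPair.mat alt
    split_ifs
    · exact hBa _ (Or.inl ⟨k, rfl⟩)
    · exact hBa' _ (Or.inl ⟨k, rfl⟩)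
  · unfold ParamPair.mat alt
    split_ifs
    · exact hBa _ (Or.inr ⟨k, rfl⟩)
    · exact hBa' _ (Or.inr ⟨k, rfl⟩)

/-! ### The minimal period and the finite exceptional set. -/

/-- `2 * N` is the smallest period of all chains. -/
structure MinClosing (C D : SmoothConic) (N : ℕ) : Prop extends Closing C D N where
  three_le : 3 ≤ N
  minimal : ∀ j, 0 < j → j < N → ∃ z, IsDualChain C D z ∧ ¬ ∀ k, z (k + 2 * j) = z k

theorem quartic_zeros_finite {p q r : Fin 3 → ℂ} {d : ℂ → ℂ}
    (hd : ∀ x, d x = (q 0 * x ^ 2 + q 1 * x + q 2) ^ 2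
      - 4 * (p 0 * x ^ 2 + p 1 * x + p 2) * (r 0 * x ^ 2 + r 1 * x + r 2))
    {a : ℂ} (ha : d a ≠ 0) : {x | d x = 0}.Finite := by
  set c : (Fin 3 → ℂ) → Polynomial ℂ := fun s =>
    Polynomial.C (s 0) * Polynomial.X ^ 2 + Polynomial.C (s 1) * Polynomial.X
      + Polynomial.C (s 2) with hcdef
  have he : ∀ x, (c q ^ 2 - 4 * c p * c r).eval x = d x := by
    intro x
    rw [hd]
    simp [hcdef]
  have hne : c q ^ 2 - 4 * c p * c r ≠ 0 := by
    intro h0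
    apply ha
    rw [← he, h0, Polynomial.eval_zero]
  refine ((c q ^ 2 - 4 * c p * c r).roots.toFinset.finite_toSet).subset fun x hx => ?_
  simp only [Finset.mem_coe, Multiset.mem_toFinset, Polynomial.mem_roots hne, Polynomial.IsRoot, he]
  exact hx

namespace ParamPair

variable {C D : SmoothConic} (P : ParamPair C D)

theorem dual_form_par (k : ℤ) (x : ℂ) :
    par (P.mat k) x ⬝ᵥ (alt C D (k + 1)).M⁻¹ *ᵥ par (P.mat k) x =
      -(1 / 2) * (cof (P.inc k) x 1 ^ 2 - 4 * cof (P.inc k) x 0 * cof (P.inc k) x 2) := by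
  rw [(P.isParam (k + 1)).dual_form, P.cof_inc]

theorem dual_form_infPar (k : ℤ) :
    infPar (P.mat k) ⬝ᵥ (alt C D (k + 1)).M⁻¹ *ᵥ infPar (P.mat k) =
      -(1 / 2) * (P.inc k 0 1 ^ 2 - 4 * P.inc k 0 0 * P.inc k 0 2) := by
  rw [(P.isParam (k + 1)).dual_form]
  have : ∀ j, ((P.mat (k + 1))ᵀ *ᵥ infPar (P.mat k)) j = P.inc k 0 j := by
    intro j
    have e : (P.mat (k + 1))ᵀ * P.mat k = (P.inc k)ᵀ := by
      rw [inc, Matrix.transpose_mul, Matrix.transpose_transpose]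
    rw [infPar, Matrix.mulVec_mulVec, e]
    simp [Matrix.mulVec, dotProduct, Fin.sum_univ_three]
  simp only [this]

/-- The form is a quartic polynomial in `x`. Were it identically zero, all elements of this parity
would be special, and the reflections about two consecutive ones would give every chain the period
4, against `3 ≤ N` and minimality. -/
theorem special_finite {N : ℕ} (hc : MinClosing C D N) (k : ℤ) :
    {x | par (P.mat k) x ⬝ᵥ (alt C D (k + 1)).M⁻¹ *ᵥ par (P.mat k) x = 0}.Finite := by
  by_cases hall : ∀ x, cof (P.inc k) x 1 ^ 2 - 4 * cof (P.inc k) x 0 * cof (P.inc k) x 2 = 0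
  · exfalso
    -- The point at infinity corresponds to the leading coefficient of the quartic, which a fourth
    -- difference extracts.
    have hinf : P.inc k 0 1 ^ 2 - 4 * P.inc k 0 0 * P.inc k 0 2 = 0 := by
      have h0 := hall 0
      have h1 := hall 1
      have h2 := hall (-1)
      have h3 := hall 2
      have h4 := hall (-2)
      simp only [cof_apply] at h0 h1 h2 h3 h4
      linear_combination (1 / 24) * (h3 + h4 - 4 * h1 - 4 * h2 + 6 * h0)
    obtain ⟨z, hz, hz'⟩ := hc.minimal 2 (by norm_num) (by have := hc.three_le; omega)
    have hpt : ∀ p ∈ (alt C D k).points, ∃ v, IsLift p v ∧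
        v ⬝ᵥ (alt C D (k + 1)).M⁻¹ *ᵥ v = 0 := by
      intro p hp
      by_cases hi : IsLift p (infPar (P.mat k))
      · exact ⟨_, hi, by rw [P.dual_form_infPar, hinf, mul_zero]⟩
      · obtain ⟨x, hx⟩ := (P.isParam k).exists_isLift_par hp hi
        exact ⟨_, hx, by rw [P.dual_form_par, hall, mul_zero]⟩
    have hsp : ∀ j : ℤ, z (k + 2 * j - 1) = z (k + 2 * j + 1) := by
      intro j
      have hm := hz.mem_points (k + 2 * j)
      rw [alt_add_two_mul] at hm
      obtain ⟨v, hv, hv'⟩ := hpt _ hm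
      rw [hz.special_iff hv, show k + 2 * j + 1 = k + 1 + 2 * j by ring, alt_add_two_mul]
      exact hv'
    apply hz'
    intro m
    have := hz.fixed_of_special (hsp 0) (hsp 1) m
    rw [← this]
    push_cast
    ring_nf
  · push Not at hall
    obtain ⟨a, ha⟩ := hall
    simp only [P.dual_form_par, mul_eq_zero, neg_eq_zero, one_div, inv_eq_zero,
      OfNat.ofNat_ne_zero, false_or]
    exact quartic_zeros_finite (p := fun i => P.inc k i 0) (q := fun i => P.inc k i 1)
      (r := fun i => P.inc k i 2) (fun x => by simp only [cof_apply]) ha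

/-- The initial coordinates of the chains which are special or infinite somewhere. -/
def bad (P : ParamPair C D) : Set ℂ :=
  {u | ∃ z, IsDualChain C D z ∧ IsLift (z 0) (par (P.mat 0) u) ∧
    ∃ k, IsLift (z k) (infPar (P.mat k)) ∨ z (k - 1) = z (k + 1)}

/-- Periodicity leaves `2 * N` indices. At each, finitely many values of `z k` are bad, and a value
of `z k` fixes the chain up to reflection about `k`, leaving two choices for `z 0`. -/
theorem bad_finite {N : ℕ} (hc : MinClosing C D N) : P.bad.Finite := by
  have hN : 0 < N := by have := hc.three_le; omega
  obtain ⟨q, hq⟩ : ∃ q : ℤ → ℂ → CP2, ∀ k x, IsLift (q k x) (par (P.mat k) x) :=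
    ⟨fun k x => _, fun k x => (IsLift.of_ne_zero ((P.isParam k).par_ne_zero x)).choose_spec⟩
  set Bd : ℤ → Set CP2 := fun k => {p | IsLift p (infPar (P.mat k))} ∪
    q k '' {x | par (P.mat k) x ⬝ᵥ (alt C D (k + 1)).M⁻¹ *ᵥ par (P.mat k) x = 0} with hBd
  have hBdf : ∀ k, (Bd k).Finite := by
    intro k
    refine Set.Finite.union ?_ ((P.special_finite hc k).image _)
    refine Set.Subsingleton.finite fun p hp p' hp' => hp.unique hp'
  have hpts : ∀ (k : ℤ) (b : CP2), {p | ∃ z, IsDualChain C D z ∧ z k = b ∧ z 0 = p}.Finite := by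
    intro k b
    by_cases hex : ∃ z, IsDualChain C D z ∧ z k = b
    · obtain ⟨z, hz, rfl⟩ := hex
      refine Set.Finite.subset (Set.toFinite {z 0, z (2 * k)}) ?_
      rintro _ ⟨z', hz', e, rfl⟩
      rcases hz.eq_or_eq_reflect hz' k e.symm with h | h <;> rw [h] <;> simp
    · refine Set.Finite.subset Set.finite_empty ?_
      rintro _ ⟨z', hz', e, rfl⟩
      exact hex ⟨z', hz', e⟩
  have hfin : (⋃ k ∈ Set.Ico (0 : ℤ) (2 * N), ⋃ b ∈ Bd k,
      {p | ∃ z, IsDualChain C D z ∧ z k = b ∧ z 0 = p}).Finite :=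
    (Set.finite_Ico _ _).biUnion fun k _ => (hBdf k).biUnion fun b _ => hpts k b
  have himg : (q 0 '' P.bad) ⊆ ⋃ k ∈ Set.Ico (0 : ℤ) (2 * N), ⋃ b ∈ Bd k,
      {p | ∃ z, IsDualChain C D z ∧ z k = b ∧ z 0 = p} := by
    rintro _ ⟨u, ⟨z, hz, h0, k, hk⟩, rfl⟩
    have hmod := fun m => hc.add_emod hz m k
    have hmat : P.mat (k % (2 * N)) = P.mat k := by
      conv_rhs => rw [← Int.emod_add_mul_ediv k (2 * N), mul_assoc, P.mat_add_two_mul]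
    set l := k % (2 * N) with hl
    have hk' : IsLift (z l) (infPar (P.mat l)) ∨ z (l - 1) = z (l + 1) := by
      have h0 := hmod 0
      have h1 := hmod 1
      have h2 := hmod (-1)
      rw [zero_add, zero_add] at h0
      rw [add_comm, add_comm 1] at h1
      rw [add_comm, add_comm (-1), ← sub_eq_add_neg, ← sub_eq_add_neg] at h2
      rwa [hmat, h0, h1, h2]
    simp only [Set.mem_iUnion]
    refine ⟨l, ⟨Int.emod_nonneg _ (by omega), Int.emod_lt_of_pos _ (by omega)⟩, z l, ?_,
      z, hz, rfl, h0.unique (hq 0 u)⟩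
    by_cases hi : IsLift (z l) (infPar (P.mat l))
    · exact Or.inl hi
    · obtain ⟨x, hx⟩ := (P.isParam l).exists_isLift_par (hz.mem_points l) hi
      refine Or.inr ⟨x, ?_, (hq l x).unique hx⟩
      rcases hk' with h | h
      · exact absurd h hi
      · exact (hz.special_iff hx).1 h
  refine Set.Finite.of_finite_image (hfin.subset himg) ?_
  intro u _ v _ huv
  exact (P.isParam 0).isLift_par_inj (hq 0 u) (huv ▸ hq 0 v)

/-- Near a coordinate outside the bad set, the chains are given by analytic functions. -/
theorem exists_analytic_chain {N : ℕ} (hc : Closing C D N) (M : ℕ) {u₀ : ℂ} (hu : u₀ ∉ P.bad) :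
    ∃ Z : ℕ → ℂ → ℂ, (∀ k, AnalyticAt ℂ (Z k) u₀) ∧
      ∀ᶠ u in 𝓝 u₀, ∀ z, IsDualChain C D z → IsLift (z 0) (par (P.mat 0) u) →
        ((∀ k : ℕ, k ≤ M → IsLift (z k) (par (P.mat k) (Z k u))) ∨
          (∀ k : ℕ, k ≤ M → IsLift (z (-k)) (par (P.mat k) (Z k u)))) := by
  obtain ⟨p, hp⟩ := IsLift.of_ne_zero ((P.isParam 0).par_ne_zero u₀)
  obtain ⟨z, hz, rfl⟩ := hc.exists_chain p ((P.isParam 0).par_mem_points hp)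
  obtain ⟨x, hx, hxa⟩ := hz.exists_isAffineChain P
    (fun k hk => hu ⟨z, hz, hp, k, Or.inl hk⟩)
  have h0 : x 0 = u₀ := (P.isParam 0).isLift_par_inj (hx 0) hp
  have hne : x 1 ≠ x (-1) := by
    intro e
    refine hu ⟨z, hz, hp, 0, Or.inr ?_⟩
    have h1 := hx 1
    have h2 := hx (-1)
    rw [e] at h1
    rw [zero_sub, zero_add]
    have em : P.mat (-1) = P.mat 1 := P.mat_add_two_mul (-1) 1 |>.symm
    rw [em] at h2
    exact h2.unique h1
  obtain ⟨Z, σ, G, hσ⟩ := hxa.exists_chainGerm_fst P.inc_succ hne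
  refine ⟨fun k u => Z k (u - u₀), fun k => ?_, ?_⟩
  · refine AnalyticAt.comp (g := Z k) ?_ (by fun_prop)
    rw [sub_self]
    exact G.analytic k
  · have := G.eventually_capture hxa M (q := fun _ => True) (by simp)
    rw [h0] at this
    filter_upwards [this] with u hu' z' hz' hl
    obtain ⟨s, -, hs, hh⟩ := hu' z' hz' hl
    have hs' : s = u - u₀ := by
      rw [← h0, ← hs, ← hσ (Z 0 s, Z 1 s), G.σ_Z]
    rw [← hs']
    exact hh

theorem eventually_notMem_bad {N : ℕ} (hc : MinClosing C D N) (u : ℂ) :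
    ∀ᶠ v in 𝓝[≠] u, v ∉ P.bad := by
  have := ((P.bad_finite hc).subset (Set.sdiff_subset (s := P.bad) (t := {u}))).isClosed
  have h2 : (P.bad \ {u})ᶜ ∈ 𝓝 u := this.isOpen_compl.mem_nhds (by simp)
  filter_upwards [mem_nhdsWithin_of_mem_nhds h2, self_mem_nhdsWithin] with v hv hv'
  intro hb
  exact hv ⟨hb, hv'⟩

end ParamPair

/-! ### Germs at special elements. -/

namespace ChainGerm

variable {C D : SmoothConic} {P : ParamPair C D} {x : ℤ → ℂ} {Z : ℕ → ℂ → ℂ} {σ : ℂ × ℂ → ℂ}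
  {z : ℤ → CP2}

theorem norm_sub_ge_of_ne (G : ChainGerm P.inc x Z σ) {k : ℕ} (h : x (k + 2) ≠ x k) :
    ∃ c > 0, ∀ᶠ s in 𝓝 0, c ≤ ‖Z (k + 2) s - Z k s‖ := by
  have h1 := ((G.tendsto (k + 2)).sub (G.tendsto k)).norm
  have hpos : 0 < ‖x ((k + 2 : ℕ) : ℤ) - x k‖ := by
    push_cast
    exact norm_pos_iff.2 (sub_ne_zero.2 h)
  exact ⟨_, half_pos hpos, (h1.eventually (lt_mem_nhds (half_lt_self hpos))).mono fun s hs => hs.le⟩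

/-- At a special place of a nonconstant chain, the two neighbours separate linearly. -/
theorem norm_sub_ge (G : ChainGerm P.inc x Z σ) (hx : IsAffineChain P.inc x)
    (hz : IsDualChain C D z) (hl : ∀ k, IsLift (z k) (par (P.mat k) (x k)))
    (hnc : ¬ ∀ m, z (m + 2) = z m) (k : ℕ) :
    ∃ c > 0, ∀ᶠ s in 𝓝 0, c * ‖s‖ ≤ ‖Z (k + 2) s - Z k s‖ := by
  by_cases hk : x (k + 2) = x k
  · obtain ⟨ρ, hρ, hd⟩ := G.deriv
    have hsp : z ((k + 1 : ℤ) - 1) = z ((k + 1 : ℤ) + 1) := by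
      have h1 := hl k
      have h2 := hl (k + 2)
      have em : P.mat ((k : ℤ) + 2) = P.mat k := P.mat_add_two_mul k 1
      rw [hk, em] at h2
      rw [add_sub_cancel_right, show (k : ℤ) + 1 + 1 = k + 2 by ring]
      exact h1.unique h2
    have hsym := hz.symmetric_of_special hsp (k - 1)
    have e3 : x (k + 3) = x (k - 1) := by
      have h1 := hl (k + 3)
      have h2 := hl (k - 1)
      have em : P.mat ((k : ℤ) + 3) = P.mat (k - 1) := by
        rw [← P.mat_add_two_mul (k - 1) 2]; ring_nf
      rw [em] at h1
      rw [← hsym, show 2 * ((k : ℤ) + 1) - (k - 1) = k + 3 by ring] at h2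
      exact (P.isParam _).isLift_par_inj h1 h2
    have hne : x (k + 1) ≠ x (k - 1) := by
      intro e
      have h1 := hl (k + 1)
      have h2 := hl (k - 1)
      rw [e, ← P.mat_sub_one] at h1
      rcases hz.exists_ne hnc k with h | h
      · exact h (h1.unique h2)
      · apply h
        rw [add_sub_cancel_right, show (k : ℤ) + 1 + 1 = k + 2 by ring] at hsp
        exact hsp.symm
    have hD := (hd (k + 2)).sub (hd k)
    set a := ρ * (cof (P.inc (k + 2 : ℕ)) (x (k + 2 : ℕ)) 0
      * (x ((k + 2 : ℕ) + 1) - x ((k + 2 : ℕ) - 1)))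
      - ρ * (cof (P.inc k) (x k) 0 * (x (k + 1) - x (k - 1))) with ha
    -- Symmetry about `k + 1` makes the derivatives of `Z (k + 2)` and `Z k` opposite; they are
    -- nonzero because index `k`, adjacent to a special one, is not special.
    have ha0 : a ≠ 0 := by
      have ei : P.inc ((k + 2 : ℕ) : ℤ) = P.inc k := by
        push_cast
        exact P.inc_add_two_mul k 1
      have : a = -2 * ρ * cof (P.inc k) (x k) 0 * (x (k + 1) - x (k - 1)) := by
        rw [ha, ei]
        push_cast
        rw [hk, show (k : ℤ) + 2 + 1 = k + 3 by ring, e3, show (k : ℤ) + 2 - 1 = k + 1 by ring]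
        ring
      rw [this]
      exact mul_ne_zero (mul_ne_zero (mul_ne_zero (by norm_num) hρ) (hx k).1) (sub_ne_zero.2 hne)
    have h0 : (Z (k + 2) - Z k) 0 = 0 := by
      simp only [Pi.sub_apply, G.zero]
      push_cast
      rw [hk, sub_self]
    have hpos : 0 < ‖a‖ / 2 := by positivity
    refine ⟨‖a‖ / 2, hpos, ?_⟩
    filter_upwards [hD.isLittleO.bound hpos] with s hs
    rw [h0] at hs
    simp only [sub_zero, smul_eq_mul, Pi.sub_apply] at hs
    have e : ‖s * a‖ ≤ ‖Z (k + 2) s - Z k s‖ + ‖Z (k + 2) s - Z k s - s * a‖ := by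
      have := norm_sub_le (Z (k + 2) s - Z k s) (Z (k + 2) s - Z k s - s * a)
      rwa [sub_sub_cancel] at this
    rw [norm_mul] at e
    have : ‖a‖ / 2 * ‖s‖ = ‖s‖ * ‖a‖ - ‖a‖ / 2 * ‖s‖ := by ring
    linarith
  · obtain ⟨c, hc, h⟩ := G.norm_sub_ge_of_ne hk
    refine ⟨c, hc, ?_⟩
    have h1 : ∀ᶠ s : ℂ in 𝓝 0, ‖s‖ < 1 := by
      have := Metric.ball_mem_nhds (0 : ℂ) one_pos
      filter_upwards [this] with s hs
      simpa using hs
    filter_upwards [h, h1] with s hs hs1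
    nlinarith

end ChainGerm

/-- The affine coordinate of a point with respect to a parametrization. -/
noncomputable def coord (B : Matrix (Fin 3) (Fin 3) ℂ) (p : CP2) : ℂ :=
  (B⁻¹ *ᵥ p.rep) 1 / (B⁻¹ *ᵥ p.rep) 2

theorem IsLift.coord_eq {p : CP2} {v : Fin 3 → ℂ} (h : IsLift p v)
    (B : Matrix (Fin 3) (Fin 3) ℂ) : coord B p = (B⁻¹ *ᵥ v) 1 / (B⁻¹ *ᵥ v) 2 := by
  obtain ⟨a, ha, e⟩ := h.exists_smul (IsLift.rep p)
  rw [coord, e, Matrix.mulVec_smul, Pi.smul_apply, Pi.smul_apply, smul_eq_mul, smul_eq_mul,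
    mul_div_mul_left _ _ ha]

theorem IsParam.coord_par {C : SmoothConic} {B : Matrix (Fin 3) (Fin 3) ℂ} (hB : IsParam C B)
    {p : CP2} {x : ℂ} (h : IsLift p (par B x)) : coord B p = x := by
  rw [h.coord_eq, hB.inv_mulVec_par]
  simp

/-- Of two adjacent elements of a nonconstant chain one is not special, and its coordinate serves as
the parameter. -/
theorem exists_chainGerm {C D : SmoothConic} {P : ParamPair C D} {z : ℤ → CP2} {x : ℤ → ℂ}
    (hz : IsDualChain C D z) (hnc : ¬ ∀ m, z (m + 2) = z m)
    (hl : ∀ k, IsLift (z k) (par (P.mat k) (x k))) (hx : IsAffineChain P.inc x) :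
    ∃ Z σ, ChainGerm P.inc x Z σ := by
  rcases hz.exists_ne hnc 0 with h | h
  · have : x 1 ≠ x (-1) := by
      intro e
      apply h
      have h1 := hl 1
      have h2 := hl (-1)
      rw [e, show (1 : ℤ) = -1 + 2 * 1 by ring, P.mat_add_two_mul] at h1
      exact h1.unique h2
    obtain ⟨Z, σ, G, -⟩ := hx.exists_chainGerm_fst P.inc_succ this
    exact ⟨Z, σ, G⟩
  · have : x 2 ≠ x 0 := by
      intro e
      apply h
      have h1 := hl 2
      have h2 := hl 0
      rw [e, show (2 : ℤ) = 0 + 2 * 1 by ring, P.mat_add_two_mul] at h1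
      exact h1.unique h2
    obtain ⟨Z, σ, G, -⟩ := hx.exists_chainGerm_snd P.inc_succ this
    exact ⟨Z, σ, G⟩

/-! ### All nonconstant chains have the same translations. -/

namespace MinClosing

variable {C D : SmoothConic} {N : ℕ} {z w : ℤ → CP2}

theorem pos (hc : MinClosing C D N) : 0 < N := by have := hc.three_le; omega

theorem fixed_or_special (hw : IsDualChain C D w) (j : ℤ) (h : w (2 * j) = w 0) :
    (∀ k, w (k + 2 * j) = w k) ∨ w (j - 1) = w (j + 1) := by
  rcases hw.eq_or_eq_reverse (hw.shift j) (by simpa using h.symm) with e | e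
  · exact Or.inl fun k => congrFun e k
  · right
    have := congrFun e (-j + 1)
    rw [show -j + 1 + 2 * j = j + 1 by ring, show -(-j + 1) = j - 1 by ring] at this
    exact this.symm

/-- If a nonconstant chain is fixed by a translation, then so are all nonspecial chains. -/
theorem fixed_of_nonspecial (hc : MinClosing C D N) (hz : IsDualChain C D z)
    (hnc : ¬ ∀ m, z (m + 2) = z m) {j : ℕ} (hjN : j ≤ N) (hj : ∀ k, z (k + 2 * j) = z k)
    (hw : IsDualChain C D w) (hns : ∀ k, w (k - 1) ≠ w (k + 1)) (k : ℤ) :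
    w (k + 2 * j) = w k := by
  obtain ⟨P, hPz, hPw⟩ := exists_paramPair_avoid hc.pos hc.toClosing hz hw
  obtain ⟨x, hl, hx⟩ := hz.exists_isAffineChain P hPz
  obtain ⟨y, hly, -⟩ := hw.exists_isAffineChain P hPw
  obtain ⟨Z, σ, G⟩ := exists_chainGerm hz hnc hl hx
  have hxj : ∀ k, x (k + 2 * j) = x k := by
    intro k
    have h1 := hl (k + 2 * j)
    rw [hj, P.mat_add_two_mul] at h1
    exact (P.isParam k).isLift_par_inj h1 (hl k)
  have hfix := G.eventually_fixed hx hc.pos hc.toClosing hxj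
  have hcap := G.eventually_capture hx (2 * j + 1) hfix
  have key : ∀ᶠ u in 𝓝 (x 0), ∀ z, IsDualChain C D z → IsLift (z 0) (par (P.mat 0) u) →
      ∀ k, z (k + 2 * j) = z k := by
    have haux : ∀ z, IsDualChain C D z → ∀ s, (∀ k, Z (2 * j + k) s = Z k s) →
        (∀ k : ℕ, k ≤ 2 * j + 1 → IsLift (z k) (par (P.mat k) (Z k s))) →
        ∀ k, z (k + 2 * j) = z k := by
      intro z hz s hs hk
      rw [hz.fixed_iff]
      have k0 := hk 0 (by omega)
      have k1 := hk 1 (by omega)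
      have k2 := hk (2 * j) (by omega)
      have k3 := hk (2 * j + 1) (by omega)
      rw [hs 1] at k3
      have e := hs 0
      rw [add_zero] at e
      rw [e] at k2
      push_cast at k0 k1 k2 k3
      have m0 := P.mat_add_two_mul 0 j
      have m1 := P.mat_add_two_mul 1 j
      rw [zero_add] at m0
      rw [add_comm] at m1
      rw [m0] at k2
      rw [m1] at k3
      exact ⟨k2.unique k0, k3.unique k1⟩
    filter_upwards [hcap] with u hu z hz hlz
    obtain ⟨s, hs, -, h | h⟩ := hu z hz hlz
    · exact haux z hz s hs h
    · have h1 := haux _ hz.reverse s hs h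
      intro k
      have := h1 (-k - 2 * j)
      rw [show -(-k - 2 * (j : ℤ) + 2 * j) = k by ring,
        show -(-k - 2 * (j : ℤ)) = k + 2 * j by ring] at this
      exact this.symm
  choose q hq using fun u => IsLift.of_ne_zero ((P.isParam 0).par_ne_zero u)
  choose ζ hζ hζq using fun u => hc.exists_chain (q u) ((P.isParam 0).par_mem_points (hq u))
  have hζl : ∀ u, IsLift (ζ u 0) (par (P.mat 0) u) := fun u => by rw [hζq]; exact hq u
  -- The direction of `ζ u` is an arbitrary choice that need not vary continuously; multiplying the
  -- conditions for both directions of translation removes it.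
  set g : ℂ → ℂ := fun u => (coord (P.mat 0) (ζ u 0) - coord (P.mat 0) (ζ u (2 * j))) *
    (coord (P.mat 0) (ζ u 0) - coord (P.mat 0) (ζ u (-(2 * j)))) with hg
  have hcl : IsClosed P.bad := (P.bad_finite hc).isClosed
  have hga : AnalyticOnNhd ℂ g P.badᶜ := by
    intro u₀ hu₀
    obtain ⟨Z', hZa, hZ⟩ := P.exists_analytic_chain hc.toClosing (2 * N) hu₀
    -- By periodicity, translation by `-(2 * j)` is translation by `2 * (N - j)`, a natural index.
    have ha : AnalyticAt ℂ (fun u => (Z' 0 u - Z' (2 * j) u) * (Z' 0 u - Z' (2 * (N - j)) u)) u₀ :=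
      ((hZa _).sub (hZa _)).mul ((hZa _).sub (hZa _))
    refine ha.congr ?_
    filter_upwards [hZ] with u hu
    have haux : ∀ z, IsDualChain C D z → (∀ k : ℕ, k ≤ 2 * N → IsLift (z k)
        (par (P.mat k) (Z' k u))) → Z' 0 u = coord (P.mat 0) (z 0) ∧
        Z' (2 * j) u = coord (P.mat 0) (z (2 * j)) ∧
        Z' (2 * (N - j)) u = coord (P.mat 0) (z (-(2 * j))) := by
      intro z hz hk
      have k0 := hk 0 (by omega)
      have k2 := hk (2 * j) (by omega)
      have k3 := hk (2 * (N - j)) (by omega)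
      have hcast : ((2 * (N - j) : ℕ) : ℤ) = -(2 * j) + 2 * N := by
        push_cast [hjN]; ring
      have m0 := P.mat_add_two_mul 0 j
      have m1 := P.mat_add_two_mul 0 (-j)
      rw [zero_add] at m0 m1
      rw [hcast, hc.periodic z hz, P.mat_add_two_mul, show -(2 * (j : ℤ)) = 2 * (-j) by ring,
        m1] at k3
      push_cast at k0 k2
      rw [m0] at k2
      refine ⟨((P.isParam 0).coord_par k0).symm, ((P.isParam 0).coord_par k2).symm, ?_⟩
      rw [show -(2 * (j : ℤ)) = 2 * (-j) by ring]
      exact ((P.isParam 0).coord_par k3).symm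
    rcases hu (ζ u) (hζ u) (hζl u) with h | h
    · obtain ⟨e0, e1, e2⟩ := haux _ (hζ u) h
      simp only [hg]
      rw [e0, e1, e2]
    · obtain ⟨e0, e1, e2⟩ := haux _ (hζ u).reverse h
      simp only [hg]
      rw [e0, e1, e2, neg_neg, neg_zero]
      ring
  -- The complement of a finite set in the plane is connected, so the identity theorem carries the
  -- vanishing of `g` from near `x 0` to the coordinate of `w`.
  have hconn : IsPreconnected P.badᶜ :=
    ((P.bad_finite hc).countable.isConnected_compl_of_one_lt_rank (by simp)).isPreconnected
  have hwu : ∀ k, IsLift (w k) (par (P.mat k) (y k)) := hly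
  have hwb : y 0 ∉ P.bad := by
    rintro ⟨z', hz', h0, k, hk⟩
    have e := h0.unique (hly 0)
    have hgood : ∀ k, ¬ (IsLift (w k) (infPar (P.mat k)) ∨ w (k - 1) = w (k + 1)) := by
      intro k hk
      rcases hk with hk | hk
      exacts [hPw k hk, hns k hk]
    rcases hw.eq_or_eq_reverse hz' e.symm with rfl | rfl
    · exact hgood k hk
    · apply hgood (-k)
      have em : P.mat (-k) = P.mat k := by simpa using P.mat_two_mul_sub k 0
      rw [em]
      rcases hk with hk | hk
      · exact Or.inl hk
      · right
        rw [show -k - 1 = -(k + 1) by ring, show -k + 1 = -(k - 1) by ring]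
        exact hk.symm
  obtain ⟨u₁, hu₁, hfix₁⟩ : ∃ u₁ ∉ P.bad, ∀ᶠ u in 𝓝 u₁, ∀ z, IsDualChain C D z →
      IsLift (z 0) (par (P.mat 0) u) → ∀ k, z (k + 2 * j) = z k := by
    have h1 := (eventually_eventually_nhds.2 key).filter_mono
      (nhdsWithin_le_nhds (s := {x 0}ᶜ))
    obtain ⟨u, h2, h3⟩ := ((P.eventually_notMem_bad hc (x 0)).and h1).exists
    exact ⟨u, h2, h3⟩
  have hg0 : g =ᶠ[𝓝 u₁] 0 := by
    filter_upwards [hfix₁] with u hu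
    have := hu _ (hζ u) (hζl u) 0
    simp only [zero_add] at this
    simp only [hg, this, sub_self, zero_mul, Pi.zero_apply]
  have hzero := hga.eqOn_zero_of_preconnected_of_eventuallyEq_zero hconn hu₁ hg0 hwb
  simp only [hg, Pi.zero_apply, mul_eq_zero, sub_eq_zero] at hzero
  have hfin : ∀ z, IsDualChain C D z → (∀ k, ¬ IsLift (z k) (infPar (P.mat k))) →
      ∀ i : ℤ, coord (P.mat 0) (z 0) = coord (P.mat 0) (z (2 * i)) → z (2 * i) = z 0 := by
    intro z hz hzi i he
    have em := P.mat_add_two_mul 0 i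
    rw [zero_add] at em
    have hm := hz.mem_points (2 * i)
    obtain ⟨a, ha⟩ := (P.isParam 0).exists_isLift_par (hz.mem_points 0) (hzi 0)
    obtain ⟨b, hb⟩ := (P.isParam (2 * i)).exists_isLift_par hm (hzi _)
    rw [em] at hb
    rw [(P.isParam 0).coord_par ha, (P.isParam 0).coord_par hb] at he
    rw [he] at ha
    exact hb.unique ha
  have hfixw : ∀ i : ℤ, w (2 * i) = w 0 → ∀ k, w (k + 2 * i) = w k := by
    intro i hi
    rcases fixed_or_special hw i hi with h | h
    · exact h
    · exact absurd h (hns i)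
  have hends : w (2 * j) = w 0 ∨ w (2 * (-j : ℤ)) = w 0 := by
    have e := (hζl (y 0)).unique (hly 0)
    rcases hw.eq_or_eq_reverse (hζ (y 0)) e.symm with h | h
    · rw [h] at hzero
      refine hzero.imp (fun h => hfin w hw hPw j h) fun h => hfin w hw hPw (-j) ?_
      rw [h]; ring_nf
    · rw [h] at hzero
      simp only [neg_zero, neg_neg] at hzero
      refine hzero.symm.imp (fun h => hfin w hw hPw j h) fun h => hfin w hw hPw (-j) ?_
      rw [h]; ring_nf
  rcases hends with h | h
  · exact hfixw j h k
  · have := hfixw (-j) h (k + 2 * j)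
    rw [← this]
    ring_nf

/-- At each of the `2 * N` places of a period the neighbours separate at least linearly in `s`, so
specialness disappears for small `s ≠ 0`. -/
theorem eventually_nonspecial {P : ParamPair C D} {x : ℤ → ℂ} {Z : ℕ → ℂ → ℂ} {σ : ℂ × ℂ → ℂ}
    (hc : MinClosing C D N) (G : ChainGerm P.inc x Z σ) (hx : IsAffineChain P.inc x)
    (hz : IsDualChain C D z) (hl : ∀ k, IsLift (z k) (par (P.mat k) (x k)))
    (hnc : ¬ ∀ m, z (m + 2) = z m) (M : ℕ) :
    ∀ᶠ s in 𝓝[≠] 0, ∃ w, IsDualChain C D w ∧ (∀ k, w (k - 1) ≠ w (k + 1)) ∧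
      ∀ k : ℕ, k ≤ M → IsLift (w k) (par (P.mat k) (Z k s)) := by
  have hsep : ∀ᶠ s in 𝓝[≠] 0, ∀ k ∈ Finset.range (2 * N), Z (k + 2) s ≠ Z k s := by
    rw [Filter.eventually_all_finset]
    intro k _
    obtain ⟨c, hc0, hs⟩ := G.norm_sub_ge hx hz hl hnc k
    filter_upwards [hs.filter_mono nhdsWithin_le_nhds, self_mem_nhdsWithin] with s h1 h2 e
    rw [e, sub_self, norm_zero] at h1
    have : 0 < c * ‖s‖ := mul_pos hc0 (norm_pos_iff.2 h2)
    linarith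
  filter_upwards [hsep, (G.exists_chain hx hc.toClosing (M + 2 * N + 2)).filter_mono
    nhdsWithin_le_nhds] with s hs ⟨w, hw, hwl⟩
  refine ⟨w, hw, fun k hk => ?_, fun k hk => hwl k (by omega)⟩
  have h0 : 0 ≤ (k - 1) % (2 * N : ℤ) := Int.emod_nonneg _ (by have := hc.pos; omega)
  have h1 : (k - 1) % (2 * N : ℤ) < 2 * N := Int.emod_lt_of_pos _ (by have := hc.pos; omega)
  obtain ⟨l, hl'⟩ := Int.eq_ofNat_of_zero_le h0
  have e0 := hc.add_emod hw 0 (k - 1)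
  have e2 := hc.add_emod hw 2 (k - 1)
  rw [hl'] at e0 e2 h1
  rw [zero_add, zero_add] at e0
  rw [show (2 : ℤ) + (k - 1) = k + 1 by ring, ← hk, ← e0, add_comm] at e2
  have l0 := hwl l (by omega)
  have l2 := hwl (l + 2) (by omega)
  have em := P.mat_add_two_mul l 1
  push_cast at l2
  rw [mul_one] at em
  rw [e2, em] at l2
  exact hs l (Finset.mem_range.2 (by omega)) ((P.isParam l).isLift_par_inj l2 l0)

/-- All chains are fixed by a translation which fixes a nonconstant one. -/
theorem fixed_of_fixed (hc : MinClosing C D N) (hz : IsDualChain C D z)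
    (hnc : ¬ ∀ m, z (m + 2) = z m) {j : ℕ} (hjN : j ≤ N) (hj : ∀ k, z (k + 2 * j) = z k)
    (hw : IsDualChain C D w) (k : ℤ) : w (k + 2 * j) = w k := by
  by_cases hwc : ∀ m, w (m + 2) = w m
  · exact IsDualChain.fixed_mul hwc j k
  · obtain ⟨P, hPw, -⟩ := exists_paramPair_avoid hc.pos hc.toClosing hw hw
    obtain ⟨x, hl, hx⟩ := hw.exists_isAffineChain P hPw
    obtain ⟨Z, σ, G⟩ := exists_chainGerm hw hwc hl hx
    -- A special chain is a limit of nonspecial ones along its germ; these are fixed by the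
    -- translation, and equality of coordinates passes to the limit.
    have hev := hc.eventually_nonspecial G hx hw hl hwc (2 * j + 1)
    have hlim : ∀ i : ℕ, i ≤ 1 → x (i + 2 * j) = x i := by
      intro i hi
      have h1 := (G.tendsto (i + 2 * j)).mono_left (nhdsWithin_le_nhds (s := {0}ᶜ))
      have h2 := (G.tendsto i).mono_left (nhdsWithin_le_nhds (s := {0}ᶜ))
      push_cast at h1
      refine tendsto_nhds_unique (h1.congr' ?_) h2
      filter_upwards [hev] with s ⟨v, hv, hvn, hvl⟩
      have h3 := hvl i (by omega)
      have h4 := hvl (i + 2 * j) (by omega)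
      push_cast at h4
      rw [hc.fixed_of_nonspecial hz hnc hjN hj hv hvn, P.mat_add_two_mul] at h4
      exact (P.isParam i).isLift_par_inj h4 h3
    refine (hw.fixed_iff j).2 ⟨?_, ?_⟩ k
    · have e := hlim 0 (by omega)
      have h1 := hl (2 * j)
      have em := P.mat_add_two_mul 0 j
      rw [zero_add] at em
      push_cast at e
      rw [zero_add] at e
      rw [e, em] at h1
      exact h1.unique (hl 0)
    · have e := hlim 1 (by omega)
      have h1 := hl (2 * j + 1)
      have em := P.mat_add_two_mul 1 j
      rw [add_comm] at em
      push_cast at e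
      rw [add_comm] at e
      rw [e, em] at h1
      exact h1.unique (hl 1)

/-- Translation by the remainder of `j` modulo `N` also fixes `z`; if the remainder were nonzero it
would give a smaller common period. -/
theorem dvd_of_fixed (hc : MinClosing C D N) (hz : IsDualChain C D z)
    (hnc : ¬ ∀ m, z (m + 2) = z m) {j : ℕ} (hj : ∀ k, z (k + 2 * j) = z k) : N ∣ j := by
  by_contra hnd
  have hpos : 0 < j % N := Nat.pos_of_ne_zero fun h => hnd (Nat.dvd_of_mod_eq_zero h)
  have hlt : j % N < N := Nat.mod_lt _ hc.pos
  obtain ⟨w, hw, hw'⟩ := hc.minimal _ hpos hlt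
  refine hw' (hc.fixed_of_fixed hz hnc hlt.le (fun k => ?_) hw)
  have h1 := hc.periodic_mul hz (k + 2 * (j % N : ℕ)) (j / N)
  rw [← h1, ← hj k]
  congr 1
  have : (j : ℤ) = (j % N : ℕ) + (j / N : ℕ) * N := by
    exact_mod_cast (Nat.mod_add_div' j N).symm
  conv_rhs => rw [this]
  ring

end MinClosing

/-! ### Odd cyclic functions and local models. -/

/-- A function of a closed polygon (given by vectors) which does not depend on the choice of the
first vertex and changes its sign when the orientation is reversed. -/
structure IsOddCyclic {N : ℕ} (Φ : (ZMod N → Fin 3 → ℂ) → ℂ) : Prop where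
  cyclic : ∀ y, Φ (fun i => y (i + 1)) = Φ y
  odd : ∀ y, Φ (fun i => y (-i)) = -Φ y

namespace IsOddCyclic

variable {N : ℕ} {Φ : (ZMod N → Fin 3 → ℂ) → ℂ}

theorem shift (h : IsOddCyclic Φ) (y : ZMod N → Fin 3 → ℂ) (a : ℕ) :
    Φ (fun i => y (i + a)) = Φ y := by
  induction a generalizing y with
  | zero => simp
  | succ a ih =>
    rw [← ih y, ← h.cyclic (fun i => y (i + a))]
    push_cast
    congr 1
    funext i
    ring_nf

/-- A symmetric polygon is a cyclic shift of its own reversal, so the value equals its negative. -/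
theorem eq_zero_of_symmetric [NeZero N] (h : IsOddCyclic Φ) {y : ZMod N → Fin 3 → ℂ} (c : ZMod N)
    (hy : ∀ i, y (c - i) = y i) : Φ y = 0 := by
  have h1 := h.odd (fun i => y (i + c))
  have h2 := h.shift y c.val
  rw [ZMod.natCast_zmod_val] at h2
  have h3 : (fun i => y (-i + c)) = y := by
    funext i
    rw [neg_add_eq_sub, hy]
  rw [h2, h3] at h1
  have : (2 : ℂ) * Φ y = 0 := by linear_combination h1
  simpa using this

end IsOddCyclic

/-- The product whose vanishing characterizes the special chains. -/
noncomputable def specialProduct (C D : SmoothConic) {N : ℕ} [NeZero N]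
    (v : ZMod N → Fin 3 → ℂ) : ℂ :=
  ∏ i, (v (i + 1) ⬝ᵥ D.M⁻¹ *ᵥ v (i + 1)) * (v i ⬝ᵥ C.M *ᵥ v (i + 1))

/-- An analytic one-parameter family which contains, up to reversal, all chains near `z`, with
control of the special product and of the odd cyclic functions. -/
structure LocalModel (C D : SmoothConic) {N : ℕ} [NeZero N] (z : ℤ → CP2) (m : ℕ)
    (v : ZMod N → ℂ → Fin 3 → ℂ) : Prop where
  analytic : ∀ i, AnalyticAt ℂ (v i) 0
  lift : ∀ i, IsLift (z (2 * i.val)) (v i 0)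
  capture : ∀ v₀, IsLift (z 0) v₀ → ∀ q : ℂ → Prop, (∀ᶠ s in 𝓝 0, q s) → ∀ᶠ u in 𝓝 v₀,
    ∀ w, IsDualChain C D w → IsLift (w 0) u → ∃ s, q s ∧
      ((∀ i : ZMod N, IsLift (w (2 * i.val)) (v i s)) ∨
        ∀ i : ZMod N, IsLift (w (-(2 * i.val))) (v i s))
  -- The exponents `4 * m` and `m` are matched: the fourth power of an odd cyclic function is
  -- bounded by a multiple of the special product.
  lower : ∃ c > 0, ∀ᶠ s in 𝓝 0, c * ‖s‖ ^ (4 * m) ≤ ‖specialProduct C D fun i => v i s‖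
  upper : ∀ Φ : (ZMod N → Fin 3 → ℂ) → ℂ, IsOddCyclic Φ → AnalyticAt ℂ Φ (fun i => v i 0) →
    ∃ φ : ℂ → ℂ, AnalyticAt ℂ φ 0 ∧ ∀ᶠ s in 𝓝 0, Φ (fun i => v i s) = s ^ m * φ s

theorem prod_zmod_val {M : Type*} [CommMonoid M] {N : ℕ} [NeZero N] (g : ℕ → M) :
    ∏ i : ZMod N, g i.val = ∏ i ∈ Finset.range N, g i := by
  obtain ⟨n, rfl⟩ := Nat.exists_eq_succ_of_ne_zero (NeZero.ne N)
  exact Fin.prod_univ_eq_prod_range g (n + 1)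

theorem prod_range_two_mul {M : Type*} [CommMonoid M] (g : ℕ → M) (N : ℕ) :
    ∏ k ∈ Finset.range (2 * N), g k = ∏ i ∈ Finset.range N, g (2 * i) * g (2 * i + 1) := by
  induction N with
  | zero => simp
  | succ N ih =>
    rw [Finset.prod_range_succ, ← ih, mul_add, mul_one, Finset.prod_range_succ,
      Finset.prod_range_succ, mul_assoc]

theorem par_apply (B : Matrix (Fin 3) (Fin 3) ℂ) (x : ℂ) (i : Fin 3) :
    par B x i = B i 0 * x ^ 2 + B i 1 * x + B i 2 := by
  simp [par, Matrix.mulVec, dotProduct, Fin.sum_univ_three]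

theorem analyticAt_par {B : Matrix (Fin 3) (Fin 3) ℂ} {g : ℂ → ℂ} {s : ℂ}
    (hg : AnalyticAt ℂ g s) : AnalyticAt ℂ (fun s => par B (g s)) s := by
  rw [analyticAt_pi_iff]
  intro i
  simp only [par_apply]
  fun_prop

theorem val_succ_cases {N : ℕ} [NeZero N] (hN : 2 ≤ N) (i : ZMod N) :
    (i + 1).val = i.val + 1 ∨ i.val + 1 = N ∧ (i + 1).val = 0 := by
  have h1 : (1 : ZMod N).val = 1 := by
    rw [ZMod.val_one'' (by omega)]
  have hlt := ZMod.val_lt i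
  rw [ZMod.val_add, h1]
  rcases Nat.lt_or_ge (i.val + 1) N with h | h
  · exact Or.inl (Nat.mod_eq_of_lt h)
  · have : i.val + 1 = N := by omega
    exact Or.inr ⟨this, by rw [this, Nat.mod_self]⟩

theorem analyticAt_pow_smul_of_zero {φ : ℂ → ℂ} (h : AnalyticAt ℂ φ 0) (h0 : φ 0 = 0) :
    ∃ ψ : ℂ → ℂ, AnalyticAt ℂ ψ 0 ∧ ∀ᶠ s in 𝓝 0, φ s = s ^ 1 * ψ s := by
  have : (1 : ℕ) ≤ analyticOrderAt φ 0 := by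
    rw [Nat.cast_one, Order.one_le_iff_ne_zero, h.analyticOrderAt_ne_zero]
    exact h0
  obtain ⟨g, hg, hev⟩ := (natCast_le_analyticOrderAt h).1 this
  exact ⟨g, hg, by simpa using hev⟩

/-! ### The local model at a nonconstant chain. -/

section smooth

variable {C D : SmoothConic} {P : ParamPair C D} {x : ℤ → ℂ} {Z : ℕ → ℂ → ℂ} {σ : ℂ × ℂ → ℂ}
  {z : ℤ → CP2} {N : ℕ}

theorem ChainGerm.eventually_periodic (G : ChainGerm P.inc x Z σ) (hx : IsAffineChain P.inc x)
    (hc : Closing C D N) : ∀ᶠ s in 𝓝 0, Z (2 * N) s = Z 0 s := by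
  filter_upwards [G.exists_chain hx hc (2 * N)] with s ⟨w, hw, hwl⟩
  have l0 := hwl 0 (by omega)
  have l1 := hwl (2 * N) le_rfl
  have e := hc.periodic w hw 0
  have em := P.mat_add_two_mul 0 N
  rw [zero_add] at e em
  push_cast at l1
  rw [e, em] at l1
  exact (P.isParam 0).isLift_par_inj l1 l0

theorem ChainGerm.eventually_dual_form (G : ChainGerm P.inc x Z σ) (hx : IsAffineChain P.inc x)
    (hc : Closing C D N) (k : ℕ) : ∀ᶠ s in 𝓝 0,
      par (P.mat (k + 1)) (Z (k + 1) s) ⬝ᵥ (alt C D (k + 2)).M⁻¹ *ᵥ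
        par (P.mat (k + 1)) (Z (k + 1) s) =
      -(1 / 2) * (cof (P.inc (k + 1)) (Z (k + 1) s) 0 * (Z (k + 2) s - Z k s)) ^ 2 := by
  have hne : ∀ᶠ s in 𝓝 0, cof (P.inc (k + 1)) (Z (k + 1) s) 0 ≠ 0 := by
    have h1 := G.tendsto (k + 1)
    push_cast at h1
    exact (((continuous_cof (P.inc (k + 1)) 0).tendsto _).comp h1).eventually_ne (hx (k + 1)).1
  filter_upwards [G.exists_chain hx hc (k + 1), hne] with s ⟨w, hw, hwl⟩ hn
  have l0 := hwl k (by omega)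
  have l1 := hwl (k + 1) le_rfl
  push_cast at l1
  have ho := hw.orthogonal_succ k
  rw [Projectivization.orthogonal_comm, l0.orthogonal_iff l1] at ho
  have em : P.mat ((k : ℤ) + 1 + 1) = P.mat k := by
    rw [show (k : ℤ) + 1 + 1 = k + 2 * 1 by ring, P.mat_add_two_mul]
  have hc' := P.cof_inc (k + 1) (Z (k + 1) s)
  rw [em] at hc'
  rw [par_dot, hc'] at ho
  have hd := P.dual_form_par (k + 1) (Z (k + 1) s)
  rw [show (k : ℤ) + 1 + 1 = k + 2 by ring] at hd
  rw [hd, G.step]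
  field_simp
  linear_combination 4 * cof (P.inc (k + 1)) (Z (k + 1) s) 0 * ho

theorem card_special_le (hN : 0 < N) {A : Finset ℕ} (hA : ∀ k ∈ A, k < 2 * N)
    (hd : ∀ k ∈ A, ∀ l ∈ A, k ≤ l → N ∣ l - k) : A.card ≤ 2 := by
  have hmaps : Set.MapsTo (fun k => k / N) (A : Set ℕ) (Finset.range 2 : Finset ℕ) := by
    intro k hk
    have := hA k hk
    simp only [Finset.coe_range, Set.mem_Iio]
    exact (Nat.div_lt_iff_lt_mul hN).2 this
  have hinj : Set.InjOn (fun k => k / N) (A : Set ℕ) := by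
    have key : ∀ k ∈ A, ∀ l ∈ A, k ≤ l → k / N = l / N → k = l := by
      intro k hk l hl hkl e
      obtain ⟨c, hc⟩ := hd k hk l hl hkl
      have hl' : l = k + N * c := by omega
      rw [hl', Nat.add_mul_div_left _ _ hN] at e
      have : c = 0 := by omega
      rw [hl', this]
      simp
    intro k hk l hl e
    rcases le_total k l with h | h
    · exact key k hk l hl h e
    · exact (key l hl k hk h e.symm).symm
  have := Finset.card_le_card_of_injOn _ hmaps hinj
  simpa using this

/-- Here `m` is 1 if there is a special element and 0 otherwise. A period has at most two special
indices, and each contributes the square of a linear separation, so the special product is bounded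
below by a multiple of `‖s‖ ^ 4`. Odd functions vanish at `s = 0` because the central polygon is
symmetric. -/
theorem exists_localModel_of_nonconst [NeZero N] (hc : MinClosing C D N)
    (hz : IsDualChain C D z) (hnc : ¬ ∀ m, z (m + 2) = z m) :
    ∃ m, ∃ v : ZMod N → ℂ → Fin 3 → ℂ, LocalModel C D z m v := by
  classical
  obtain ⟨P, hPz, -⟩ := exists_paramPair_avoid hc.pos hc.toClosing hz hz
  obtain ⟨x, hl, hx⟩ := hz.exists_isAffineChain P hPz
  obtain ⟨Z, σ, G⟩ := exists_chainGerm hz hnc hl hx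
  have hm0 : ∀ j : ℤ, P.mat (2 * j) = P.mat 0 := fun j => by
    rw [← P.mat_add_two_mul 0 j, zero_add]
  have hzx : ∀ k, z k = z (k + 2) ↔ x k = x (k + 2) := by
    intro k
    have h2 := hl (k + 2)
    rw [show P.mat (k + 2) = P.mat k from P.mat_add_two_mul k 1] at h2
    exact IsLift.ne_of_ne (P.isParam k) (hl k) h2
  -- Membership of `k` means that the index `k + 1` is special.
  set A : Finset ℕ := (Finset.range (2 * N)).filter fun k => x (k + 2) = x k with hA
  set m : ℕ := if A = ∅ then 0 else 1 with hm
  have hAcard : A.card ≤ 2 * m := by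
    by_cases hAe : A = ∅
    · simp [hAe]
    · rw [hm, if_neg hAe]
      refine card_special_le hc.pos (fun k hk => ?_) fun k hk l hl' hkl => ?_
      · exact Finset.mem_range.1 (Finset.mem_filter.1 hk).1
      · have hk' := (hzx k).2 (Finset.mem_filter.1 hk).2.symm
        have hl'' := (hzx l).2 (Finset.mem_filter.1 hl').2.symm
        refine hc.dvd_of_fixed hz hnc fun i => ?_
        have := hz.fixed_of_special (k := k + 1) (l := l + 1)
          (by rw [add_sub_cancel_right, hk']; ring_nf) (by rw [add_sub_cancel_right, hl'']; ring_nf) i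
        rw [← this]
        push_cast [hkl]
        ring_nf
  have hx2N : ∀ k, x (k + 2 * N) = x k := by
    intro k
    have h2 := hl (k + 2 * N)
    rw [hc.periodic z hz, P.mat_add_two_mul] at h2
    exact (P.isParam k).isLift_par_inj h2 (hl k)
  set v : ZMod N → ℂ → Fin 3 → ℂ := fun i s => par (P.mat 0) (Z (2 * i.val) s) with hv
  have hva : ∀ i, AnalyticAt ℂ (v i) 0 := fun i => analyticAt_par (G.analytic _)
  have hvall : AnalyticAt ℂ (fun s i => v i s) 0 := analyticAt_pi_iff.2 hva
  refine ⟨m, v, hva, ?_, ?_, ?_, ?_⟩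
  · intro i
    have := hl (2 * i.val)
    simp only [hv, G.zero]
    push_cast
    rwa [hm0] at this
  · intro v₀ hv₀ q hq
    obtain ⟨a, ha, e⟩ := (hl 0).exists_smul hv₀
    have hev := G.eventually_capture hx (2 * N) hq
    have hcont : ∀ j, Continuous fun u : Fin 3 → ℂ => ((P.mat 0)⁻¹ *ᵥ u) j := by
      intro j
      exact (continuous_apply j).comp (Continuous.matrix_mulVec continuous_const continuous_id)
    have hB := P.isParam 0
    have h2 : ((P.mat 0)⁻¹ *ᵥ v₀) 2 = a := by
      rw [e, Matrix.mulVec_smul, hB.inv_mulVec_par]; simp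
    have h1 : ((P.mat 0)⁻¹ *ᵥ v₀) 1 = a * x 0 := by
      rw [e, Matrix.mulVec_smul, hB.inv_mulVec_par]; simp
    have htend : Tendsto (fun u : Fin 3 → ℂ =>
        ((P.mat 0)⁻¹ *ᵥ u) 1 / ((P.mat 0)⁻¹ *ᵥ u) 2) (𝓝 v₀) (𝓝 (x 0)) := by
      have := ((hcont 1).continuousAt (x := v₀)).div ((hcont 2).continuousAt (x := v₀))
        (by rw [h2]; exact ha)
      have h3 := this.tendsto
      simp only [Pi.div_apply] at h3
      rw [h1, h2, mul_div_cancel_left₀ _ ha] at h3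
      exact h3
    filter_upwards [htend.eventually hev, (hcont 2).continuousAt.eventually_ne
      (by rw [h2]; exact ha)] with u hu hu2 w hw hwu
    have hiso := (hwu.mem_points_iff C).1 hw.zero_mem
    obtain ⟨s, hs, -, hh⟩ := hu w hw (hwu.of_eq_smul (IsParam.eq_smul_par hB hiso hu2))
    refine ⟨s, hs, hh.imp (fun h i => ?_) fun h i => ?_⟩
    · have := h (2 * i.val) (by have := ZMod.val_lt i; omega)
      push_cast at this
      rwa [hm0] at this
    · have := h (2 * i.val) (by have := ZMod.val_lt i; omega)
      push_cast at this
      rwa [hm0] at this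
  · have hsep : ∀ k : ℕ, ∃ c > 0, ∀ᶠ s in 𝓝 0,
        c * ‖s‖ ^ (if x (k + 2) = x k then 1 else 0) ≤ ‖Z (k + 2) s - Z k s‖ := by
      intro k
      split_ifs with h
      · simpa using G.norm_sub_ge hx hz hl hnc k
      · simpa using G.norm_sub_ge_of_ne h
    choose c hc0 hcs using hsep
    have hlead : ∀ k : ℕ, ∃ d > 0, ∀ᶠ s in 𝓝 0, d ≤ ‖cof (P.inc k) (Z k s) 0‖ := by
      intro k
      have h1 : Tendsto (fun s => ‖cof (P.inc k) (Z k s) 0‖) (𝓝 0)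
          (𝓝 ‖cof (P.inc k) (x k) 0‖) :=
        (((continuous_cof (P.inc k) 0).tendsto _).comp (G.tendsto k)).norm
      have hpos : 0 < ‖cof (P.inc k) (x k) 0‖ := norm_pos_iff.2 (hx k).1
      exact ⟨_, half_pos hpos, (h1.eventually (lt_mem_nhds (half_lt_self hpos))).mono
        fun s hs => hs.le⟩
    choose d hd0 hds using hlead
    set e : ℕ → ℕ := fun k => if x (k + 2) = x k then 1 else 0 with he
    -- The `i`-th factor combines the squared separations `Z (2 * i + 2) - Z (2 * i)` and `Z (2 * i
    -- + 3) - Z (2 * i + 1)`; over all `i` each `k < 2 * N` occurs once.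
    have hfac : ∀ i : ZMod N, ∀ᶠ s in 𝓝 0,
        1 / 2 * (d (2 * i.val + 2) * (c (2 * i.val + 1) * c (2 * i.val))) ^ 2
          * (‖s‖ ^ e (2 * i.val) * ‖s‖ ^ e (2 * i.val + 1)) ^ 2 ≤
        ‖(v (i + 1) s ⬝ᵥ D.M⁻¹ *ᵥ v (i + 1) s) * (v i s ⬝ᵥ C.M *ᵥ v (i + 1) s)‖ := by
      intro i
      filter_upwards [G.eventually_periodic hx hc.toClosing,
        G.eventually_dual_form hx hc.toClosing (2 * i.val + 1), hcs (2 * i.val),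
        hcs (2 * i.val + 1), hds (2 * i.val + 2)] with s hper hdf h0 h1 h2
      have hv1 : v (i + 1) s = par (P.mat 0) (Z (2 * i.val + 2) s) := by
        simp only [hv]
        rcases val_succ_cases (by have := hc.three_le; omega) i with h | ⟨h, h'⟩
        · rw [h, mul_add]
        · rw [h', mul_zero, ← hper, show 2 * N = 2 * i.val + 2 by omega]
      have ealt : alt C D (((2 * i.val + 1 : ℕ) : ℤ) + 2) = D :=
        alt_of_odd _ _ ⟨i.val + 1, by push_cast; ring⟩
      have emat : P.mat (((2 * i.val + 1 : ℕ) : ℤ) + 1) = P.mat 0 := by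
        rw [← hm0 (i.val + 1)]; push_cast; ring_nf
      rw [ealt, emat] at hdf
      have hsq := (P.isParam 0).par_dot_par (Z (2 * i.val) s) (Z (2 * i.val + 2) s)
      have ealt0 : alt C D 0 = C := alt_of_even _ _ (by simp)
      rw [ealt0] at hsq
      rw [hv1, hdf]
      simp only [hv]
      rw [hsq]
      have einc : P.inc (((2 * i.val + 1 : ℕ) : ℤ) + 1) = P.inc ((2 * i.val + 2 : ℕ) : ℤ) := by
        push_cast; ring_nf
      rw [einc, norm_mul, norm_mul, norm_pow, norm_pow, norm_mul]
      have hn : ‖(-(1 / 2) : ℂ)‖ = 1 / 2 := by norm_num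
      rw [hn, norm_sub_rev (Z (2 * i.val) s)]
      have hs0 : 0 ≤ ‖s‖ := norm_nonneg s
      have key : d (2 * i.val + 2) * (c (2 * i.val + 1) * ‖s‖ ^ e (2 * i.val + 1))
          * (c (2 * i.val) * ‖s‖ ^ e (2 * i.val)) ≤
          ‖cof (P.inc ((2 * i.val + 2 : ℕ) : ℤ)) (Z (2 * i.val + 1 + 1) s) 0‖
            * ‖Z (2 * i.val + 1 + 2) s - Z (2 * i.val + 1) s‖
            * ‖Z (2 * i.val + 2) s - Z (2 * i.val) s‖ := by
        have a1 := hc0 (2 * i.val)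
        have a2 := hc0 (2 * i.val + 1)
        have a3 := hd0 (2 * i.val + 2)
        gcongr
      have hpos : 0 ≤ d (2 * i.val + 2) * (c (2 * i.val + 1) * ‖s‖ ^ e (2 * i.val + 1))
          * (c (2 * i.val) * ‖s‖ ^ e (2 * i.val)) := by
        have a1 := hc0 (2 * i.val)
        have a2 := hc0 (2 * i.val + 1)
        have a3 := hd0 (2 * i.val + 2)
        positivity
      have key2 := pow_le_pow_left₀ hpos key 2
      calc _ = 1 / 2 * (d (2 * i.val + 2) * (c (2 * i.val + 1) * ‖s‖ ^ e (2 * i.val + 1))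
          * (c (2 * i.val) * ‖s‖ ^ e (2 * i.val))) ^ 2 := by ring
        _ ≤ 1 / 2 * (‖cof (P.inc ((2 * i.val + 2 : ℕ) : ℤ)) (Z (2 * i.val + 1 + 1) s) 0‖
            * ‖Z (2 * i.val + 1 + 2) s - Z (2 * i.val + 1) s‖
            * ‖Z (2 * i.val + 2) s - Z (2 * i.val) s‖) ^ 2 := by gcongr
        _ = _ := by ring
    set κ : ZMod N → ℝ := fun i =>
      1 / 2 * (d (2 * i.val + 2) * (c (2 * i.val + 1) * c (2 * i.val))) ^ 2 with hκ
    have hκ0 : ∀ i, 0 < κ i := by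
      intro i
      have a1 := hc0 (2 * i.val)
      have a2 := hc0 (2 * i.val + 1)
      have a3 := hd0 (2 * i.val + 2)
      positivity
    have hsum : ∀ r : ℝ, ∏ i : ZMod N, (r ^ e (2 * i.val) * r ^ e (2 * i.val + 1)) =
        r ^ A.card := by
      intro r
      rw [prod_zmod_val (fun k => r ^ e (2 * k) * r ^ e (2 * k + 1)),
        ← prod_range_two_mul (fun k => r ^ e k), Finset.prod_pow_eq_pow_sum]
      congr 1
      rw [hA, Finset.card_filter]
    refine ⟨∏ i, κ i, Finset.prod_pos fun i _ => hκ0 i, ?_⟩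
    have h1 : ∀ᶠ s : ℂ in 𝓝 0, ‖s‖ < 1 := by
      filter_upwards [Metric.ball_mem_nhds (0 : ℂ) one_pos] with s hs
      simpa using hs
    filter_upwards [eventually_all.2 hfac, h1] with s hs hs1
    have hprod : (∏ i, κ i) * (‖s‖ ^ A.card) ^ 2 ≤ ‖specialProduct C D fun i => v i s‖ := by
      rw [specialProduct, norm_prod, ← hsum, ← Finset.prod_pow, ← Finset.prod_mul_distrib]
      refine Finset.prod_le_prod (fun i _ => ?_) fun i _ => hs i
      have := hκ0 i
      positivity
    refine le_trans ?_ hprod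
    rw [← pow_mul]
    refine mul_le_mul_of_nonneg_left ?_ (Finset.prod_pos fun i _ => hκ0 i).le
    exact pow_le_pow_of_le_one (norm_nonneg s) hs1.le (by omega)
  · intro Φ hΦ hΦa
    have hcomp : AnalyticAt ℂ (fun s => Φ (fun i => v i s)) 0 :=
      AnalyticAt.comp (g := Φ) (f := fun s i => v i s) hΦa hvall
    by_cases hAe : A = ∅
    · exact ⟨_, hcomp, by simp [hm, hAe]⟩
    · rw [hm, if_neg hAe]
      refine analyticAt_pow_smul_of_zero hcomp ?_
      obtain ⟨k, hk⟩ := Finset.nonempty_of_ne_empty hAe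
      have hk' := (hzx k).2 (Finset.mem_filter.1 hk).2.symm
      have hsym := hz.symmetric_of_special (k := k + 1)
        (by rw [add_sub_cancel_right, hk']; ring_nf)
      have hxsym : ∀ j : ℤ, x (2 * (k + 1) - j) = x j := by
        intro j
        have h1 := hl (2 * (k + 1) - j)
        rw [hsym, P.mat_two_mul_sub] at h1
        exact (P.isParam j).isLift_par_inj h1 (hl j)
      have hv0 : ∀ j : ℤ, v (j : ZMod N) 0 = par (P.mat 0) (x (2 * j)) := by
        intro j
        simp only [hv, G.zero]
        congr 1
        have hp : Function.Periodic x (2 * N : ℤ) := hx2N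
        have h1 := hp.int_mul (j / N) (2 * (j % N))
        push_cast
        rw [ZMod.val_intCast, ← h1, Int.cast_id]
        congr 1
        have := Int.emod_add_mul_ediv j N
        linear_combination 2 * this
      refine hΦ.eq_zero_of_symmetric (((k + 1 : ℤ) : ZMod N)) fun i => ?_
      have hi : ((i.val : ℤ) : ZMod N) = i := by
        rw [Int.cast_natCast, ZMod.natCast_zmod_val]
      conv_lhs => rw [← hi, ← Int.cast_sub, hv0]
      conv_rhs => rw [← hi, hv0]
      rw [← hxsym (2 * (i.val : ℤ))]
      ring_nf

end smooth

/-! ### The local model at a constant chain. -/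

/-- Comparing leading terms at `t` and `η * t`, the order `m` of a nonzero germ satisfies `η ^ m =
1`, so `N` divides it; it is positive because `φ 0 = 0`. -/
theorem exists_analytic_of_rotation_invariant {N : ℕ} {η : ℂ} (hη : IsPrimitiveRoot η N)
    {φ : ℂ → ℂ} (hφ : AnalyticAt ℂ φ 0) (hinv : ∀ t, φ (η * t) = φ t) (h0 : φ 0 = 0) :
    ∃ ψ : ℂ → ℂ, AnalyticAt ℂ ψ 0 ∧ ∀ᶠ s in 𝓝 0, φ s = s ^ N * ψ s := by
  have hle : (N : ℕ∞) ≤ analyticOrderAt φ 0 := by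
    by_cases htop : analyticOrderAt φ 0 = ⊤
    · rw [htop]; exact le_top
    · obtain ⟨g, hg, hg0, hev⟩ := hφ.analyticOrderAt_ne_top.1 htop
      set m := analyticOrderNatAt φ 0 with hm
      have hmul : Tendsto (fun t : ℂ => η * t) (𝓝 0) (𝓝 0) := by
        have : Continuous fun t : ℂ => η * t := by fun_prop
        simpa using this.tendsto 0
      have h1 : ∀ᶠ t in 𝓝[≠] (0 : ℂ), g t = η ^ m * g (η * t) := by
        filter_upwards [hev.filter_mono nhdsWithin_le_nhds,
          (hmul.eventually hev).filter_mono nhdsWithin_le_nhds, self_mem_nhdsWithin] with t e1 e2 ht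
        rw [hinv, e1] at e2
        simp only [sub_zero, smul_eq_mul, mul_pow] at e2
        have : t ^ m ≠ 0 := pow_ne_zero m ht
        apply mul_left_cancel₀ this
        linear_combination e2
      have h2 : Tendsto g (𝓝[≠] 0) (𝓝 (g 0)) := hg.continuousAt.tendsto.mono_left
        nhdsWithin_le_nhds
      have h3 : Tendsto (fun t => η ^ m * g (η * t)) (𝓝[≠] 0) (𝓝 (η ^ m * g 0)) :=
        ((hg.continuousAt.tendsto.comp hmul).const_mul _).mono_left nhdsWithin_le_nhds
      have h4 := tendsto_nhds_unique (h2.congr' h1) h3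
      have h5 : η ^ m = 1 := by
        have : (η ^ m - 1) * g 0 = 0 := by linear_combination -h4
        rcases mul_eq_zero.1 this with h | h
        · exact sub_eq_zero.1 h
        · exact absurd h hg0
      have hdvd : N ∣ m := (hη.pow_eq_one_iff_dvd m).1 h5
      have hm0 : m ≠ 0 := by
        intro h
        have := hev.self_of_nhds
        rw [h, h0] at this
        simp at this
        exact hg0 this.symm
      have : N ≤ m := Nat.le_of_dvd (Nat.pos_of_ne_zero hm0) hdvd
      rw [← Nat.cast_analyticOrderNatAt htop]
      exact_mod_cast this
  obtain ⟨ψ, hψ, hev⟩ := (natCast_le_analyticOrderAt hφ).1 hle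
  exact ⟨ψ, hψ, by simpa using hev⟩

/-- A periodic sequence with constant second differences is constant. -/
theorem eq_of_second_difference {x : ℕ → ℂ} {d : ℂ} (h : ∀ i, x (i + 2) + x i = 2 * x (i + 1) + d)
    {N : ℕ} (hN : 0 < N) (hp : ∀ i, x (i + N) = x i) : x 1 = x 0 := by
  have hform : ∀ i : ℕ, x i = x 0 + i * (x 1 - x 0) + i * (i - 1) / 2 * d := by
    intro i
    induction i using Nat.twoStepInduction with
    | zero => simp
    | one => simp
    | more i ih0 ih1 =>
      have := h i
      push_cast at ih1 ⊢
      linear_combination this + 2 * ih1 - ih0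
  have hN' : (N : ℂ) ≠ 0 := Nat.cast_ne_zero.2 hN.ne'
  have e0 := hp 0
  have e1 := hp 1
  rw [zero_add, hform N] at e0
  rw [hform (1 + N)] at e1
  push_cast at e1
  have hd : d = 0 := by
    apply mul_left_cancel₀ hN'
    linear_combination e1 - e0
  rw [hd] at e0
  have : (N : ℂ) * (x 1 - x 0) = 0 := by linear_combination e0
  rcases mul_eq_zero.1 this with h | h
  · exact absurd h hN'
  · exact sub_eq_zero.1 h

section constant

variable {C D : SmoothConic} {z : ℤ → CP2} {N : ℕ}

/-- All intersection is at infinity, so the restricted quadratic has no finite root and must be a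
nonzero constant. -/
theorem coefficients_of_section_inf {E : SmoothConic} {B B' : Matrix (Fin 3) (Fin 3) ℂ} {p q : CP2}
    (hB : IsParam E B) (hq : IsLift q (infPar B')) (hp : IsLift p (infPar B))
    (h : {r | r ∈ E.points ∧ Projectivization.orthogonal r q} = {p}) :
    (Bᵀ *ᵥ infPar B') 0 = 0 ∧ (Bᵀ *ᵥ infPar B') 1 = 0 ∧ (Bᵀ *ᵥ infPar B') 2 ≠ 0 := by
  have hmem : p ∈ ({p} : Set CP2) := rfl
  rw [← h] at hmem
  have h0 : (Bᵀ *ᵥ infPar B') 0 = 0 := by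
    rw [← infPar_dot, ← hp.orthogonal_iff hq]
    exact hmem.2
  have hno : ∀ y, (Bᵀ *ᵥ infPar B') 1 * y + (Bᵀ *ᵥ infPar B') 2 ≠ 0 := by
    intro y hy
    obtain ⟨r, hr⟩ := IsLift.of_ne_zero (hB.par_ne_zero y)
    have : r ∈ ({p} : Set CP2) := by
      rw [← h]
      refine ⟨hB.par_mem_points hr, ?_⟩
      rw [hr.orthogonal_iff hq, par_dot, h0]
      linear_combination hy
    rw [Set.mem_singleton_iff] at this
    exact hB.not_isLift_infPar hr (this ▸ hp)
  refine ⟨h0, ?_, by simpa using hno 0⟩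
  by_contra h1
  apply hno (-(Bᵀ *ᵥ infPar B') 2 / (Bᵀ *ᵥ infPar B') 1)
  field_simp
  ring

theorem ParamPair.transpose_mulVec_infPar (P : ParamPair C D) (k : ℤ) (j : Fin 3) :
    ((P.mat (k + 1))ᵀ *ᵥ infPar (P.mat k)) j = P.inc k 0 j := by
  have e : (P.mat (k + 1))ᵀ * P.mat k = (P.inc k)ᵀ := by
    rw [ParamPair.inc, Matrix.transpose_mul, Matrix.transpose_transpose]
  rw [infPar, Matrix.mulVec_mulVec, e]
  simp [Matrix.mulVec, dotProduct, Fin.sum_univ_three]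

/-- Coordinates with a given constant chain at infinity. -/
theorem exists_paramPair_const (hz : IsDualChain C D z) (hcz : ∀ m, z (m + 2) = z m) :
    ∃ P : ParamPair C D, (∀ k, IsLift (z k) (infPar (P.mat k))) ∧
      P.inc 0 0 0 = 0 ∧ P.inc 0 0 1 = 0 ∧ P.inc 0 1 0 = 0 ∧ P.inc 0 0 2 ≠ 0 ∧
        P.inc 0 2 0 ≠ 0 := by
  obtain ⟨B, hB, hi⟩ := exists_isParam_infPar C (hz.mem_points 0)
  obtain ⟨B', hB', hi'⟩ := exists_isParam_infPar D (hz.mem_points 1)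
  set P : ParamPair C D := ⟨B, B', hB, hB'⟩ with hP
  have hz' : ∀ k : ℤ, ∀ j : ℤ, z (k + 2 * j) = z k := by
    intro k j
    have hp : Function.Periodic z 2 := hcz
    have := hp.int_mul j k
    rwa [Int.cast_id, mul_comm] at this
  have hinf : ∀ k, IsLift (z k) (infPar (P.mat k)) := by
    intro k
    rcases Int.even_or_odd' k with ⟨j, rfl | rfl⟩
    · rw [← zero_add (2 * j), hz', P.mat_add_two_mul]
      exact hi
    · rw [add_comm, hz', P.mat_add_two_mul]
      exact hi'
  have hsec : ∀ k, {r | r ∈ (alt C D (k + 1)).points ∧ Projectivization.orthogonal r (z k)}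
      = {z (k + 1)} := by
    intro k
    have e : z (k + 1) = z (k - 1) := by rw [← hz' (k - 1) 1]; ring_nf
    rw [hz k, e, Set.pair_eq_singleton]
  have h0 := coefficients_of_section_inf (P.isParam (0 + 1)) (hinf 0) (hinf (0 + 1)) (hsec 0)
  have h1 := coefficients_of_section_inf (P.isParam (1 + 1)) (hinf 1) (hinf (1 + 1)) (hsec 1)
  simp only [P.transpose_mulVec_infPar] at h0 h1
  have ht := P.inc_succ 0
  rw [zero_add] at ht
  rw [ht] at h1
  simp only [Matrix.transpose_apply] at h1
  exact ⟨P, hinf, h0.1, h0.2.1, h1.2.1, h0.2.2, h1.2.2⟩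

theorem ne_of_ne_const (hz : IsDualChain C D z) (hcz : ∀ m, z (m + 2) = z m) {w : ℤ → CP2}
    (hw : IsDualChain C D w) (hne : w ≠ z) (k : ℤ) : w k ≠ z k := by
  intro e
  rcases hz.eq_or_eq_reflect hw k e.symm with h | h
  · exact hne h
  · apply hne
    rw [h]
    funext m
    have hp : Function.Periodic z 2 := hcz
    have := hp.int_mul (k - m) m
    rw [← this, Int.cast_id]
    ring_nf

end constant

/-- The affine coordinates of the chains which differ from a constant chain, put at infinity. -/
structure IsNodeChain (a b c p q r : ℂ) (x : ℤ → ℂ) : Prop where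
  even : ∀ i : ℤ, a * (x (2 * i - 1) + x (2 * i + 1)) = -(b * x (2 * i) + p)
  odd : ∀ i : ℤ, c * (x (2 * i) + x (2 * i + 2)) = -(b * x (2 * i + 1) + q)
  prod : ∀ i : ℤ, c * (x (2 * i) * x (2 * i + 2)) = a * x (2 * i + 1) ^ 2 + p * x (2 * i + 1) + r

namespace IsNodeChain

variable {a b c p q r : ℂ} {x : ℤ → ℂ}

theorem recurrence (h : IsNodeChain a b c p q r x) (ha : a ≠ 0) (hc : c ≠ 0) (i : ℤ) :
    x (2 * i + 4) + x (2 * i) =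
      (b ^ 2 / (a * c) - 2) * x (2 * i + 2) + (b * p - 2 * a * q) / (a * c) := by
  have h1 := h.odd i
  have h2 := h.odd (i + 1)
  have h3 := h.even (i + 1)
  rw [show 2 * (i + 1) + 2 = 2 * i + 4 by ring, show 2 * (i + 1) + 1 = 2 * i + 3 by ring,
    show 2 * (i + 1) = 2 * i + 2 by ring] at h2
  rw [show 2 * (i + 1) - 1 = 2 * i + 1 by ring, show 2 * (i + 1) + 1 = 2 * i + 3 by ring,
    show 2 * (i + 1) = 2 * i + 2 by ring] at h3
  field_simp
  linear_combination a * h1 + a * h2 - b * h3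

/-- This case and the next would give every chain the period 4, which `3 ≤ N` excludes; they
correspond to the characteristic roots `-1` and `1` of the recurrence. -/
theorem four_periodic_of_zero (h : IsNodeChain a b c p q r x) (ha : a ≠ 0) (hc : c ≠ 0)
    (hb : b = 0) (k : ℤ) : x (k + 4) = x k := by
  subst hb
  rcases Int.even_or_odd' k with ⟨i, rfl | rfl⟩
  · have h1 := h.odd i
    have h2 := h.odd (i + 1)
    rw [show 2 * (i + 1) + 2 = 2 * i + 4 by ring, show 2 * (i + 1) = 2 * i + 2 by ring] at h2
    apply mul_left_cancel₀ hc
    linear_combination h2 - h1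
  · have h1 := h.even (i + 1)
    have h2 := h.even (i + 2)
    rw [show 2 * (i + 1) - 1 = 2 * i + 1 by ring, show 2 * (i + 1) + 1 = 2 * i + 3 by ring] at h1
    rw [show 2 * (i + 2) - 1 = 2 * i + 3 by ring, show 2 * (i + 2) + 1 = 2 * i + 1 + 4 by ring]
      at h2
    apply mul_left_cancel₀ ha
    linear_combination h2 - h1

/-- With the double characteristic root 1, the even terms have constant second differences; being
periodic they are constant. -/
theorem four_periodic_of_parabolic (h : IsNodeChain a b c p q r x) (ha : a ≠ 0) (hc : c ≠ 0)
    (hb : b ^ 2 = 4 * a * c) {N : ℕ} (hN : 0 < N) (hper : ∀ k, x (k + 2 * N) = x k) (k : ℤ) :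
    x (k + 4) = x k := by
  have h2 : ∀ j : ℤ, x (2 * j + 2) = x (2 * j) := by
    intro j
    have := eq_of_second_difference (x := fun i : ℕ => x (2 * j + 2 * i))
      (d := (b * p - 2 * a * q) / (a * c)) (fun i => ?_) hN (fun i => ?_)
    · simpa using this
    · have e := h.recurrence ha hc (j + i)
      have hk : b ^ 2 / (a * c) - 2 = 2 := by rw [hb]; field_simp; norm_num
      rw [hk] at e
      push_cast
      rw [show 2 * j + 2 * ((i : ℤ) + 2) = 2 * (j + i) + 4 by ring,
        show 2 * j + 2 * ((i : ℤ) + 1) = 2 * (j + i) + 2 by ring,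
        show 2 * j + 2 * (i : ℤ) = 2 * (j + i) by ring]
      exact e
    · have e := hper (2 * j + 2 * i)
      push_cast
      rw [← e]
      ring_nf
  rcases Int.even_or_odd' k with ⟨i, rfl | rfl⟩
  · have e := h2 (i + 1)
    rw [mul_add, mul_one, h2 i] at e
    rw [← e]
    ring_nf
  · have h1 := h.even (i + 1)
    have h3 := h.even (i + 2)
    have e := h2 (i + 1)
    rw [show 2 * (i + 1) - 1 = 2 * i + 1 by ring, show 2 * (i + 1) + 1 = 2 * i + 3 by ring] at h1
    rw [show 2 * (i + 2) - 1 = 2 * i + 3 by ring, show 2 * (i + 2) + 1 = 2 * i + 1 + 4 by ring,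
      show 2 * (i + 2) = 2 * (i + 1) + 2 by ring, e] at h3
    apply mul_left_cancel₀ ha
    linear_combination h3 - h1

/-- The explicit form of the even terms. -/
theorem exists_form (h : IsNodeChain a b c p q r x) (ha : a ≠ 0) (hc : c ≠ 0) {η C₀ e : ℂ}
    (hη0 : η ≠ 0) (hη : η ^ 2 - (b ^ 2 / (a * c) - 2) * η + 1 = 0) (hη1 : η ^ 2 ≠ 1)
    (hC : (4 * a * c - b ^ 2) * C₀ = b * p - 2 * a * q)
    (he : (η⁻¹ - η) ^ 2 * e =
      -((q / c + 2 * C₀) ^ 2 - b ^ 2 / (a * c) * (r / c + C₀ * q / c + C₀ ^ 2))) :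
    ∃ A A' : ℂ, (∀ i : ℕ, x (2 * i) = C₀ + A * η⁻¹ ^ i + A' * η ^ i) ∧
      (∀ i : ℕ, x (-(2 * i)) = C₀ + A' * η⁻¹ ^ i + A * η ^ i) ∧ A * A' = e := by
  have hτ : η⁻¹ - η ≠ 0 := by
    intro h0
    apply hη1
    field_simp at h0
    linear_combination -h0
  have hκ : b ^ 2 / (a * c) - 2 = η⁻¹ + η := by
    field_simp
    field_simp at hη
    linear_combination -hη
  have hrec : ∀ i : ℤ, x (2 * i + 4) - C₀ + (x (2 * i) - C₀) = (η⁻¹ + η) * (x (2 * i + 2) - C₀) := by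
    intro i
    have := h.recurrence ha hc i
    have hac : (b * p - 2 * a * q) / (a * c) = (2 - (b ^ 2 / (a * c) - 2)) * C₀ := by
      field_simp
      linear_combination -hC
    rw [← hκ]
    linear_combination this + hac
  have hωη : η⁻¹ * η = 1 := inv_mul_cancel₀ hη0
  generalize η⁻¹ = ω at *
  set A := (x 2 - C₀ - η * (x 0 - C₀)) / (ω - η) with hA
  set A' := (ω * (x 0 - C₀) - (x 2 - C₀)) / (ω - η) with hA'
  have e0 : x 0 - C₀ = A + A' := by rw [hA, hA']; field_simp; ring
  have e1 : x 2 - C₀ = A * ω + A' * η := by rw [hA, hA']; field_simp; ring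
  clear_value A A'
  refine ⟨A, A', ?_, ?_, ?_⟩
  · intro i
    induction i using Nat.twoStepInduction with
    | zero => simp; linear_combination e0
    | one => simp; linear_combination e1
    | more i ih0 ih1 =>
      have := hrec i
      push_cast at ih0 ih1 ⊢
      rw [show 2 * ((i : ℤ) + 1) = 2 * i + 2 by ring] at ih1
      rw [show 2 * ((i : ℤ) + 2) = 2 * i + 4 by ring]
      rw [ih0, ih1] at this
      linear_combination this + (A * ω ^ i + A' * η ^ i) * hωη
  · intro i
    induction i using Nat.twoStepInduction with
    | zero => simp; linear_combination e0
    | one =>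
      have := hrec (-1)
      norm_num at this
      simp
      linear_combination this + (ω + η) * e0 - e1
    | more i ih0 ih1 =>
      have := hrec (-(i + 2))
      push_cast at ih0 ih1 ⊢
      rw [show 2 * -((i : ℤ) + 2) + 4 = -(2 * i) by ring,
        show 2 * -((i : ℤ) + 2) + 2 = -(2 * (i + 1)) by ring,
        show 2 * -((i : ℤ) + 2) = -(2 * (i + 2)) by ring] at this
      rw [ih0, ih1] at this
      linear_combination this + (A' * ω ^ i + A * η ^ i) * hωη
  -- `A * A'` is a first integral of the recurrence, and the relation `prod` gives it the same value
  -- `e` for all chains. They therefore form a one-parameter family, with `A` and `A'` exchanged by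
  -- reversal.
  · apply mul_left_cancel₀ (pow_ne_zero 2 hτ)
    rw [he]
    have h1 := h.odd 0
    have h2 := h.prod 0
    norm_num at h1 h2
    have s1 : x 0 + x 2 = -(b * x 1 + q) / c := by field_simp; linear_combination h1
    have s2 : x 0 * x 2 = (a * x 1 ^ 2 + p * x 1 + r) / c := by field_simp; linear_combination h2
    have e3 : (ω - η) ^ 2 * (A * A') = (ω + η) * ((x 0 - C₀) * (x 2 - C₀))
        - (x 0 - C₀) ^ 2 - (x 2 - C₀) ^ 2 := by
      rw [e0, e1]
      linear_combination -(A + A') ^ 2 * hωη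
    have e4 : (ω + η) * ((x 0 - C₀) * (x 2 - C₀)) - (x 0 - C₀) ^ 2 - (x 2 - C₀) ^ 2
        = -((x 0 + x 2 - 2 * C₀) ^ 2
          - b ^ 2 / (a * c) * (x 0 * x 2 - C₀ * (x 0 + x 2) + C₀ ^ 2)) := by
      rw [← hκ]; ring
    rw [e3, e4, s1, s2]
    field_simp
    linear_combination (-b * x 1) * hC

end IsNodeChain

/-- With these coefficients zero, the incidence polynomial `c x² + b x y + a y² + q x + p y + r` has
total degree two. The leading coefficients in `x` and in `y` are constants, so the sum relations are
linear. -/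
theorem IsAffineChain.isNodeChain {f : ℤ → Matrix (Fin 3) (Fin 3) ℂ} {g : Matrix (Fin 3) (Fin 3) ℂ}
    {x : ℤ → ℂ} (hx : IsAffineChain f x) (he : ∀ i, f (2 * i) = g) (ho : ∀ i, f (2 * i + 1) = gᵀ)
    (h00 : g 0 0 = 0) (h01 : g 0 1 = 0) (h10 : g 1 0 = 0) :
    IsNodeChain (g 2 0) (g 1 1) (g 0 2) (g 2 1) (g 1 2) (g 2 2) x := by
  refine ⟨fun i => ?_, fun i => ?_, fun i => ?_⟩
  · have := (hx (2 * i)).2.1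
    rw [he] at this
    simp only [cof_apply, h00, h01, h10] at this
    linear_combination this
  · have := (hx (2 * i + 1)).2.1
    rw [ho, add_sub_cancel_right, show 2 * i + 1 + 1 = 2 * i + 2 by ring] at this
    simp only [cof_apply, Matrix.transpose_apply, h00, h01, h10] at this
    linear_combination this
  · have := (hx (2 * i + 1)).2.2
    rw [ho, add_sub_cancel_right, show 2 * i + 1 + 1 = 2 * i + 2 by ring] at this
    simp only [cof_apply, Matrix.transpose_apply, h00, h01] at this
    linear_combination -this

/-- The homogeneous coordinates of the even terms of the chains near a constant one. -/
def nodeVec (C₀ e y : ℂ) : Fin 3 → ℂ :=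
  ![(1 + C₀ * y + e * y ^ 2) ^ 2, (1 + C₀ * y + e * y ^ 2) * y, y ^ 2]

theorem analyticAt_nodeVec (C₀ e : ℂ) (y : ℂ) : AnalyticAt ℂ (nodeVec C₀ e) y := by
  rw [analyticAt_pi_iff]
  intro i
  fin_cases i <;> simp [nodeVec] <;> fun_prop

/-- Here `y` stands for `η ^ i / A`, so that `e * y = A' * η ^ i`. The factor `y ^ 2` clears the
pole, and `y = 0` becomes the point at infinity. -/
theorem nodeVec_eq_smul {C₀ e y u : ℂ} (hy : y ≠ 0)
    (hu : u = C₀ + y⁻¹ + e * y) : nodeVec C₀ e y = y ^ 2 • ![u ^ 2, u, 1] := by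
  have hu' : u * y = 1 + C₀ * y + e * y ^ 2 := by rw [hu]; field_simp; ring
  ext i
  fin_cases i
  · simp [nodeVec, ← hu']; ring
  · simp [nodeVec, ← hu']; ring
  · simp [nodeVec]

theorem nodeVec_dot_model (C₀ e η y : ℂ) :
    nodeVec C₀ e y ⬝ᵥ conicModel *ᵥ nodeVec C₀ e (η * y) =
      y ^ 2 * ((η - 1) * (1 - e * η * y ^ 2)) ^ 2 := by
  simp [nodeVec, conicModel, Matrix.mulVec, dotProduct, Fin.sum_univ_three]
  ring

theorem ParamPair.dual_form_mulVec {C D : SmoothConic} (P : ParamPair C D) (g : Fin 3 → ℂ) :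
    (P.mat 0 *ᵥ g) ⬝ᵥ D.M⁻¹ *ᵥ (P.mat 0 *ᵥ g) =
      -(1 / 2) * (((P.inc 0)ᵀ *ᵥ g) 1 ^ 2 -
        4 * ((P.inc 0)ᵀ *ᵥ g) 0 * ((P.inc 0)ᵀ *ᵥ g) 2) := by
  have h := (P.isParam 1).dual_form (P.mat 0 *ᵥ g)
  rw [alt_of_odd _ _ (by decide : Odd (1 : ℤ))] at h
  rw [h, ParamPair.inc, Matrix.transpose_mul, Matrix.transpose_transpose, Matrix.mulVec_mulVec,
    zero_add]

theorem exists_pow_mul_le {m : ℕ} {F : ℂ → ℂ} {G : ℂ → ℂ} (hG : ContinuousAt G 0)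
    (hG0 : G 0 ≠ 0) (h : ∀ s, F s = s ^ m * G s) :
    ∃ c > 0, ∀ᶠ s in 𝓝 0, c * ‖s‖ ^ m ≤ ‖F s‖ := by
  have hpos : 0 < ‖G 0‖ := norm_pos_iff.2 hG0
  refine ⟨‖G 0‖ / 2, half_pos hpos, ?_⟩
  filter_upwards [hG.norm.tendsto.eventually (lt_mem_nhds (half_lt_self hpos))] with s hs
  rw [h, norm_mul, norm_pow, mul_comm]
  gcongr

section constant

variable {C D : SmoothConic} {z : ℤ → CP2} {N : ℕ}

/-- The parameter is `t = A⁻¹`. Passing to the next vertex multiplies it by the primitive root `η`,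
so a cyclic function is invariant under this rotation and, being zero at `t = 0`, is divisible by `t
^ N`. Each of the `N` factors of the special product is `t ^ 4` times a nonvanishing germ. -/
theorem exists_localModel_of_const [NeZero N] (hc : MinClosing C D N)
    (hz : IsDualChain C D z) (hcz : ∀ m, z (m + 2) = z m) :
    ∃ m, ∃ v : ZMod N → ℂ → Fin 3 → ℂ, LocalModel C D z m v := by
  obtain ⟨P, hinf, h00, h01, h10, hc0, ha0⟩ := exists_paramPair_const hz hcz
  set g := P.inc 0 with hg
  have hm0 : ∀ j : ℤ, P.mat (2 * j) = P.mat 0 := fun j => by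
    rw [← P.mat_add_two_mul 0 j, zero_add]
  have he : ∀ i, P.inc (2 * i) = g := fun i => by
    rw [hg, ← P.inc_add_two_mul 0 i, zero_add]
  have ho : ∀ i, P.inc (2 * i + 1) = gᵀ := fun i => by rw [P.inc_succ, he]
  set a := g 2 0
  set b := g 1 1
  set c := g 0 2
  set p := g 2 1
  set q := g 1 2
  set r := g 2 2
  have haff : ∀ w, IsDualChain C D w → w ≠ z → ∃ x : ℤ → ℂ,
      (∀ k, IsLift (w k) (par (P.mat k) (x k))) ∧ IsNodeChain a b c p q r x := by
    intro w hw hne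
    obtain ⟨x, hl, hx⟩ := hw.exists_isAffineChain P fun k h =>
      ne_of_ne_const hz hcz hw hne k (h.unique (hinf k))
    exact ⟨x, hl, hx.isNodeChain he ho h00 h01 h10⟩
  have hlift : ∀ {w : ℤ → CP2} {x : ℤ → ℂ}, (∀ k, IsLift (w k) (par (P.mat k) (x k))) → ∀ k j : ℤ,
      (w (k + 2 * j) = w k ↔ x (k + 2 * j) = x k) := by
    intro w x hl k j
    have h2 := hl (k + 2 * j)
    rw [P.mat_add_two_mul] at h2
    exact IsLift.ne_of_ne (P.isParam k) h2 (hl k)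
  have hmin : ∀ j : ℕ, 0 < j → j < N → ∃ x, IsNodeChain a b c p q r x ∧
      (∀ k, x (k + 2 * N) = x k) ∧ ¬ ∀ k, x (k + 2 * j) = x k := by
    intro j h0 hj
    obtain ⟨w, hw, hw'⟩ := hc.minimal j h0 hj
    have hne : w ≠ z := by
      rintro rfl
      exact hw' (IsDualChain.fixed_mul hcz j)
    obtain ⟨x, hl, hx⟩ := haff w hw hne
    refine ⟨x, hx, fun k => (hlift hl k N).1 (hc.periodic w hw k), fun h => hw' fun k => ?_⟩
    exact (hlift hl k j).2 (h k)
  obtain ⟨x, hx, hxN, hx4⟩ := hmin 2 two_pos hc.three_le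
  have hb0 : b ≠ 0 := fun h => hx4 fun k => by
    simpa using hx.four_periodic_of_zero ha0 hc0 h k
  have hdisc : 4 * a * c - b ^ 2 ≠ 0 := fun h => hx4 fun k => by
    simpa using hx.four_periodic_of_parabolic ha0 hc0 (by linear_combination -h) hc.pos hxN k
  obtain ⟨d, hd⟩ := IsAlgClosed.exists_pow_nat_eq ((b ^ 2 / (a * c) - 2) ^ 2 - 4) two_pos
  set η := (b ^ 2 / (a * c) - 2 + d) / 2 with hη
  have hηq : η ^ 2 - (b ^ 2 / (a * c) - 2) * η + 1 = 0 := by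
    rw [hη]; linear_combination (1 / 4) * hd
  have hη0 : η ≠ 0 := by
    intro h
    rw [h] at hηq
    norm_num at hηq
  -- The roots `1` and `-1` are the parabolic case and `b = 0`, both excluded above.
  have hη1 : η ^ 2 ≠ 1 := by
    intro h
    have h' : (η - 1) * (η + 1) = 0 := by linear_combination h
    rcases mul_eq_zero.1 h' with h' | h'
    · rw [sub_eq_zero.1 h'] at hηq
      apply hdisc
      field_simp at hηq
      linear_combination hηq
    · rw [eq_neg_of_add_eq_zero_left h'] at hηq
      apply pow_ne_zero 2 hb0
      field_simp at hηq
      linear_combination hηq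
  have hτ : η⁻¹ - η ≠ 0 := by
    intro h0
    apply hη1
    field_simp at h0
    linear_combination -h0
  obtain ⟨C₀, hC⟩ : ∃ C₀, (4 * a * c - b ^ 2) * C₀ = b * p - 2 * a * q :=
    ⟨(b * p - 2 * a * q) / (4 * a * c - b ^ 2), by field_simp⟩
  obtain ⟨e, he'⟩ : ∃ e, (η⁻¹ - η) ^ 2 * e =
      -((q / c + 2 * C₀) ^ 2 - b ^ 2 / (a * c) * (r / c + C₀ * q / c + C₀ ^ 2)) :=
    ⟨_ / (η⁻¹ - η) ^ 2, mul_div_cancel₀ _ (pow_ne_zero 2 hτ)⟩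
  have hform := fun {x} (hx : IsNodeChain a b c p q r x) =>
    hx.exists_form ha0 hc0 hη0 hηq hη1 hC he'
  have hchain : ∀ u : ℂ, ∃ w, IsDualChain C D w ∧ w ≠ z ∧ IsLift (w 0) (par (P.mat 0) u) := by
    intro u
    obtain ⟨p, hp⟩ := IsLift.of_ne_zero ((P.isParam 0).par_ne_zero u)
    obtain ⟨w, hw, rfl⟩ := hc.exists_chain p ((P.isParam 0).par_mem_points hp)
    refine ⟨w, hw, ?_, hp⟩
    rintro rfl
    exact (P.isParam 0).not_isLift_infPar hp (hinf 0)
  have hηN : η ^ N = 1 := by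
    -- Starting at `C₀ + 1` gives `A + A' = 1`, so `A` and `A'` are not both zero and periodicity
    -- can be read off `η`, on the reversed chain if `A = 0`.
    obtain ⟨w, hw, hne, hw0⟩ := hchain (C₀ + 1)
    obtain ⟨x, hl, hx⟩ := haff w hw hne
    have hx0 : x 0 = C₀ + 1 := (P.isParam 0).isLift_par_inj (hl 0) hw0
    obtain ⟨A, A', h1, h2, -⟩ := hform hx
    have hper : ∀ k : ℤ, x (k + 2 * N) = x k := fun k => (hlift hl k N).1 (hc.periodic w hw k)
    have hAA : A + A' = 1 := by
      have := h1 0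
      simp [hx0] at this
      rw [← sub_eq_zero]
      linear_combination -this
    have key : ∀ {A A' : ℂ} {y : ℕ → ℂ}, (∀ i, y i = C₀ + A * η⁻¹ ^ i + A' * η ^ i) →
        y N = y 0 → y (1 + N) = y 1 → A ≠ 0 → η ^ N = 1 := by
      intro A A' y hy e0 e1 hA
      rw [hy, hy] at e0 e1
      have h3 : A * (η⁻¹ - η) * (η⁻¹ ^ N - 1) = 0 := by
        simp only [pow_add, pow_one] at e1
        linear_combination e1 - η * e0
      have h4 : η⁻¹ ^ N = 1 := by
        rcases mul_eq_zero.1 h3 with h | h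
        · exact absurd h (mul_ne_zero hA hτ)
        · exact sub_eq_zero.1 h
      rw [inv_pow] at h4
      exact inv_eq_one.1 h4
    by_cases hA : A = 0
    · refine key (y := fun i => x (-(2 * i))) h2 ?_ ?_ (by rw [hA] at hAA; intro h; simp [h] at hAA)
      · have := hper (-(2 * N))
        simpa using this.symm
      · have := hper (-(2 * (1 + N)))
        push_cast
        rw [← this]
        ring_nf
    · refine key (y := fun i => x (2 * i)) h1 ?_ ?_ hA
      · simpa using hper 0
      · have := hper 2
        push_cast
        rw [mul_add, mul_one, this]
  have hprim : IsPrimitiveRoot η N := by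
    rw [IsPrimitiveRoot.iff hc.pos]
    refine ⟨hηN, fun j hj0 hj h => ?_⟩
    obtain ⟨x, hx, hxN, hxj⟩ := hmin j hj0 hj
    apply hxj
    have hinv : η⁻¹ ^ j = 1 := by rw [inv_pow, h, inv_one]
    have heven : ∀ i : ℤ, x (2 * i + 2 * j) = x (2 * i) := by
      obtain ⟨A, A', h1, h2, -⟩ := hform hx
      have hp : Function.Periodic x (2 * N : ℤ) := hxN
      intro i
      obtain ⟨n, hn⟩ := Int.eq_ofNat_of_zero_le (Int.emod_nonneg i
        (by have := hc.pos; omega : (N : ℤ) ≠ 0))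
      have hi : ∀ k : ℤ, x (2 * i + k) = x (2 * n + k) := by
        intro k
        have := hp.int_mul (i / N) (2 * n + k)
        rw [← this, Int.cast_id]
        congr 1
        have := Int.emod_add_mul_ediv i N
        rw [hn] at this
        linear_combination -2 * this
      have h3 := hi 0
      rw [add_zero, add_zero] at h3
      rw [hi, h3, h1, ← mul_add]
      have h4 := h1 (n + j)
      push_cast at h4
      rw [h4, pow_add, pow_add, h, hinv, mul_one, mul_one]
    intro k
    rcases Int.even_or_odd' k with ⟨i, rfl | rfl⟩
    · exact heven i
    · have h1 := hx.odd i
      have h2 := hx.odd (i + j)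
      rw [show 2 * (i + (j : ℤ)) = 2 * i + 2 * j by ring, heven,
        show 2 * i + 2 * (j : ℤ) + 2 = 2 * (i + 1) + 2 * j by ring, heven,
        show 2 * (i + 1) = 2 * i + 2 by ring] at h2
      apply mul_left_cancel₀ hb0
      rw [show 2 * i + 1 + 2 * (j : ℤ) = 2 * i + 2 * j + 1 by ring]
      linear_combination h2 - h1
  set v : ZMod N → ℂ → Fin 3 → ℂ := fun i t => P.mat 0 *ᵥ nodeVec C₀ e (η ^ i.val * t) with hv
  have hsucc : ∀ (i : ZMod N), η ^ (i + 1).val = η * η ^ i.val := by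
    intro i
    rcases val_succ_cases (by have := hc.three_le; omega) i with h | ⟨h, h'⟩
    · rw [h, pow_succ']
    · rw [h', pow_zero, ← pow_succ', h, hηN]
  have hva : ∀ i, AnalyticAt ℂ (v i) 0 := by
    intro i
    have h1 : AnalyticAt ℂ (fun t => nodeVec C₀ e (η ^ i.val * t)) 0 :=
      (analyticAt_nodeVec C₀ e _).comp (f := fun t => η ^ i.val * t) (by fun_prop)
    rw [analyticAt_pi_iff] at h1 ⊢
    intro j
    have h0 := h1 0
    have h2 := h1 1
    have h3 := h1 2
    simp only [Matrix.mulVec, dotProduct, Fin.sum_univ_three]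
    fun_prop
  have hv0 : ∀ i, v i 0 = infPar (P.mat 0) := by
    intro i
    simp only [hv, infPar]
    congr 1
    ext j
    fin_cases j <;> simp [nodeVec]
  have hvall : AnalyticAt ℂ (fun s i => v i s) 0 := analyticAt_pi_iff.2 hva
  have hzc : ∀ j : ℤ, z (2 * j) = z 0 := by
    intro j
    have hp : Function.Periodic z 2 := hcz
    have := hp.int_mul j 0
    rw [zero_add, Int.cast_id] at this
    rw [← this, mul_comm]
  refine ⟨N, v, hva, fun i => ?_, ?_, ?_, ?_⟩
  · rw [hv0, hzc]; exact hinf 0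
  · intro v₀ hv₀ Q hQ
    obtain ⟨α, hα, ev₀⟩ := (hinf 0).exists_smul hv₀
    obtain ⟨δ, hδ, hball⟩ := Metric.eventually_nhds_iff.1 hQ
    have hcont : ∀ j, Continuous fun u : Fin 3 → ℂ => ((P.mat 0)⁻¹ *ᵥ u) j := by
      intro j
      exact (continuous_apply j).comp (Continuous.matrix_mulVec continuous_const continuous_id)
    have hB := P.isParam 0
    have c0 : ((P.mat 0)⁻¹ *ᵥ v₀) 0 = α := by
      rw [ev₀, Matrix.mulVec_smul, infPar, hB.inv_mulVec]; simp
    have c1 : ((P.mat 0)⁻¹ *ᵥ v₀) 1 = 0 := by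
      rw [ev₀, Matrix.mulVec_smul, infPar, hB.inv_mulVec]; simp
    have htend : Tendsto (fun u : Fin 3 → ℂ =>
        ‖((P.mat 0)⁻¹ *ᵥ u) 1 / ((P.mat 0)⁻¹ *ᵥ u) 0‖) (𝓝 v₀) (𝓝 0) := by
      have := ((hcont 1).continuousAt (x := v₀)).div ((hcont 0).continuousAt (x := v₀))
        (by rw [c0]; exact hα)
      have h3 := this.norm.tendsto
      simp only [Pi.div_apply] at h3
      rwa [c1, zero_div, norm_zero] at h3
    -- If `‖x 0‖` exceeds `‖C₀‖ + 2 / δ`, then `A` or `A'` exceeds `1 / δ` in norm, and its inverse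
    -- is a parameter within `δ` for the chain or for its reversal.
    have hR : 0 < (‖C₀‖ + 2 / δ)⁻¹ := by positivity
    filter_upwards [htend.eventually (gt_mem_nhds hR), (hcont 0).continuousAt.eventually_ne
      (by rw [c0]; exact hα)] with u hu hu0 w hw hwu
    by_cases hwz : w = z
    · refine ⟨0, hQ.self_of_nhds, Or.inl fun i => ?_⟩
      rw [hv0, hwz, hzc]
      exact hinf 0
    · obtain ⟨x, hl, hx⟩ := haff w hw hwz
      obtain ⟨l, hl0, eu⟩ := (hl 0).exists_smul hwu
      rw [eu, Matrix.mulVec_smul, hB.inv_mulVec_par] at hu hu0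
      simp at hu0
      have hx0 : x 0 ≠ 0 := hu0.2
      have hbig : ‖C₀‖ + 2 / δ < ‖x 0‖ := by
        have e1 : (l • ![x 0 ^ 2, x 0, 1]) 1 / (l • ![x 0 ^ 2, x 0, 1]) 0 = (x 0)⁻¹ := by
          simp; field_simp
        rw [e1, norm_inv] at hu
        exact (inv_lt_inv₀ (norm_pos_iff.2 hx0) (by positivity)).1 hu
      have main : ∀ {w : ℤ → CP2} {x : ℤ → ℂ} {A A' : ℂ}, (∀ k, IsLift (w k) (par (P.mat k) (x k))) →
          (∀ i : ℕ, x (2 * i) = C₀ + A * η⁻¹ ^ i + A' * η ^ i) → A * A' = e → 1 / δ < ‖A‖ →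
          Q A⁻¹ ∧ ∀ i : ZMod N, IsLift (w (2 * i.val)) (v i A⁻¹) := by
        intro w x A A' hl h1 hAA hA
        have hA0 : A ≠ 0 := norm_pos_iff.1 (lt_trans (by positivity) hA)
        refine ⟨hball ?_, fun i => ?_⟩
        · rw [dist_zero_right, norm_inv]
          rw [one_div] at hA
          exact inv_lt_of_inv_lt₀ hδ hA
        · have hy : η ^ i.val * A⁻¹ ≠ 0 := mul_ne_zero (pow_ne_zero _ hη0) (inv_ne_zero hA0)
          have h3 := hl (2 * i.val)
          rw [hm0] at h3
          simp only [hv]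
          rw [nodeVec_eq_smul hy (u := x (2 * i.val)) ?_,
            Matrix.mulVec_smul]
          · exact h3.smul (pow_ne_zero 2 hy)
          · rw [h1, ← hAA, mul_inv, inv_inv, inv_pow]
            field_simp
      obtain ⟨A, A', h1, h2, hAA⟩ := hform hx
      have hsum : x 0 = C₀ + A + A' := by simpa using h1 0
      have hor : 1 / δ < ‖A‖ ∨ 1 / δ < ‖A'‖ := by
        by_contra! hcon
        have h3 : ‖x 0‖ ≤ ‖C₀‖ + ‖A‖ + ‖A'‖ := by rw [hsum]; exact norm_add₃_le
        have h4 : 2 / δ = 1 / δ + 1 / δ := by ring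
        linarith [hcon.1, hcon.2]
      rcases hor with hA | hA
      · obtain ⟨h3, h4⟩ := main hl h1 hAA hA
        exact ⟨_, h3, Or.inl h4⟩
      · obtain ⟨h3, h4⟩ := main (w := fun k => w (-k)) (x := fun k => x (-k))
          (fun k => by
            have := hl (-k)
            rwa [show P.mat (-k) = P.mat k by simpa using P.mat_two_mul_sub k 0] at this)
          h2 (by rw [mul_comm, hAA]) hA
        exact ⟨_, h3, Or.inr h4⟩
  -- The `i`-th factor of the special product divided by `s ^ 4`; at `s = 0` it is nonzero because
  -- `4 * a * c - b ^ 2` and `η - 1` are.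
  · set G : ZMod N → ℂ → ℂ := fun i s =>
      (-(1 / 2) * (η * η ^ i.val) ^ 2 * ((b * (1 + C₀ * (η * η ^ i.val * s)
        + e * (η * η ^ i.val * s) ^ 2) + p * (η * η ^ i.val * s)) ^ 2
        - 4 * a * (c * (1 + C₀ * (η * η ^ i.val * s) + e * (η * η ^ i.val * s) ^ 2) ^ 2
          + q * (1 + C₀ * (η * η ^ i.val * s) + e * (η * η ^ i.val * s) ^ 2) * (η * η ^ i.val * s)
          + r * (η * η ^ i.val * s) ^ 2))) *
        ((η ^ i.val) ^ 2 * ((η - 1) * (1 - e * η * (η ^ i.val * s) ^ 2)) ^ 2) with hG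
    have hGc : ∀ i, Continuous (G i) := fun i => by simp only [hG]; fun_prop
    have hη1' : η - 1 ≠ 0 := fun h => hη1 (by rw [sub_eq_zero.1 h, one_pow])
    have hG0 : ∀ i, G i 0 ≠ 0 := by
      intro i
      have : G i 0 = (1 / 2) * (η * η ^ i.val) ^ 2 * (4 * a * c - b ^ 2)
          * ((η ^ i.val) ^ 2 * (η - 1) ^ 2) := by
        simp only [hG]; ring
      rw [this]
      have := pow_ne_zero i.val hη0
      refine mul_ne_zero (mul_ne_zero (mul_ne_zero (by norm_num) ?_) hdisc) (mul_ne_zero ?_ ?_)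
      · exact pow_ne_zero 2 (mul_ne_zero hη0 this)
      · exact pow_ne_zero 2 this
      · exact pow_ne_zero 2 hη1'
    refine exists_pow_mul_le (G := fun s => ∏ i, G i s)
      (continuous_finsetProd _ fun i _ => hGc i).continuousAt
      (Finset.prod_ne_zero_iff.2 fun i _ => hG0 i) fun s => ?_
    have hcard : s ^ (4 * N) = ∏ _i : ZMod N, s ^ 4 := by
      rw [Finset.prod_const, Finset.card_univ, ZMod.card, pow_mul]
    rw [hcard, ← Finset.prod_mul_distrib, specialProduct]
    refine Finset.prod_congr rfl fun i _ => ?_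
    have hpc := (P.isParam 0).dotProduct_mulVec (nodeVec C₀ e (η ^ i.val * s))
      (nodeVec C₀ e (η * (η ^ i.val * s)))
    rw [alt_of_even _ _ (by decide : Even (0 : ℤ)), nodeVec_dot_model] at hpc
    have e2 : v (i + 1) s = P.mat 0 *ᵥ nodeVec C₀ e (η * (η ^ i.val * s)) := by
      simp only [hv]; rw [hsucc, mul_assoc]
    rw [e2, show v i s = P.mat 0 *ᵥ nodeVec C₀ e (η ^ i.val * s) from rfl, hpc,
      P.dual_form_mulVec, ← hg]
    simp only [nodeVec, Matrix.mulVec, dotProduct, Fin.sum_univ_three, Matrix.transpose_apply,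
      Matrix.cons_val_zero, Matrix.cons_val_one, Matrix.cons_val, h00, h01, h10, hG]
    ring
  · intro Φ hΦ hΦa
    have hcomp : AnalyticAt ℂ (fun s => Φ (fun i => v i s)) 0 :=
      AnalyticAt.comp (g := Φ) (f := fun s i => v i s) hΦa hvall
    refine exists_analytic_of_rotation_invariant hprim hcomp (fun t => ?_) ?_
    · have e3 : (fun i => v i (η * t)) = fun i => v (i + 1) t := by
        funext i
        simp only [hv]
        rw [hsucc]
        congr 2
        ring
      rw [e3]
      exact hΦ.cyclic fun i => v i t
    · exact hΦ.eq_zero_of_symmetric 0 fun i => by simp only [hv0]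

theorem exists_localModel [NeZero N] (hc : MinClosing C D N) (hz : IsDualChain C D z) :
    ∃ m, ∃ v : ZMod N → ℂ → Fin 3 → ℂ, LocalModel C D z m v := by
  by_cases h : ∀ m, z (m + 2) = z m
  · exact exists_localModel_of_const hc hz h
  · exact exists_localModel_of_nonconst hc hz h

end constant

/-! ### The homogeneous area and the invariant ratio. -/

section polygon

variable {N : ℕ} [NeZero N]

/-- The product of the `a j` over all `j` except `i` and `i + 1`. -/
def prodOthers (a : ZMod N → ℂ) (i : ZMod N) : ℂ := ∏ j, if j = i ∨ j = i + 1 then 1 else a j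

theorem prodOthers_mul (hN : 2 ≤ N) (a : ZMod N → ℂ) (i : ZMod N) :
    prodOthers a i * (a i * a (i + 1)) = ∏ j, a j := by
  have hne : i ≠ i + 1 := by
    intro h
    have : Fact (1 < N) := ⟨hN⟩
    exact one_ne_zero (left_eq_add.1 h)
  have h2 : a i * a (i + 1) = ∏ j, if j = i ∨ j = i + 1 then a j else 1 := by
    rw [← Finset.prod_filter, ← Finset.prod_pair hne]
    refine Finset.prod_congr ?_ fun _ _ => rfl
    ext j
    simp
  rw [h2, prodOthers, ← Finset.prod_mul_distrib]
  refine Finset.prod_congr rfl fun j _ => ?_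
  split_ifs <;> simp

theorem prodOthers_shift (a : ZMod N → ℂ) (i : ZMod N) :
    prodOthers (fun j => a (j + 1)) i = prodOthers a (i + 1) := by
  rw [prodOthers, prodOthers, ← Equiv.prod_comp (Equiv.addRight (1 : ZMod N))
    fun j => if j = i + 1 ∨ j = i + 1 + 1 then 1 else a j]
  simp

theorem prodOthers_neg (a : ZMod N → ℂ) (i : ZMod N) :
    prodOthers (fun j => a (-j)) i = prodOthers a (-i - 1) := by
  rw [prodOthers, prodOthers, ← Equiv.prod_comp (Equiv.neg (ZMod N))]
  refine Finset.prod_congr rfl fun j _ => ?_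
  simp only [Equiv.neg_apply, neg_neg]
  refine if_congr ?_ rfl rfl
  rw [neg_eq_iff_eq_neg, neg_eq_iff_eq_neg, neg_add', sub_add_cancel, or_comm]

theorem analyticAt_prodOthers (v : ZMod N → Fin 3 → ℂ) (i : ZMod N) :
    AnalyticAt ℂ (fun v : ZMod N → Fin 3 → ℂ => prodOthers (fun j => v j 2) i) v := by
  unfold prodOthers
  refine Finset.analyticAt_fun_prod _ fun j _ => ?_
  split_ifs
  · exact analyticAt_const
  · exact (ContinuousLinearMap.proj (R := ℂ) (φ := fun _ : Fin 3 => ℂ) 2 ∘L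
      ContinuousLinearMap.proj (R := ℂ) (φ := fun _ : ZMod N => Fin 3 → ℂ) j).analyticAt v

theorem analyticAt_entry (v : ZMod N → Fin 3 → ℂ) (i : ZMod N) (k : Fin 3) :
    AnalyticAt ℂ (fun v : ZMod N → Fin 3 → ℂ => v i k) v :=
  (ContinuousLinearMap.proj (R := ℂ) (φ := fun _ : Fin 3 => ℂ) k ∘L
    ContinuousLinearMap.proj (R := ℂ) (φ := fun _ : ZMod N => Fin 3 → ℂ) i).analyticAt v

/-- The area of a polygon in homogeneous coordinates. -/
noncomputable def homArea (v : ZMod N → Fin 3 → ℂ) : ℂ :=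
  1 / 2 * ∑ i, (v i 0 * v (i + 1) 1 - v (i + 1) 0 * v i 1) * prodOthers (fun j => v j 2) i

theorem homArea_isOddCyclic : IsOddCyclic (homArea (N := N)) := by
  refine ⟨fun y => ?_, fun y => ?_⟩
  · unfold homArea
    rw [← Equiv.sum_comp (Equiv.addRight (1 : ZMod N))
      fun i => (y i 0 * y (i + 1) 1 - y (i + 1) 0 * y i 1) * prodOthers (fun j => y j 2) i]
    simp only [Equiv.coe_addRight, prodOthers_shift (fun j => y j 2)]
  · unfold homArea
    rw [← mul_neg, ← Finset.sum_neg_distrib,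
      ← Equiv.sum_comp ((Equiv.neg (ZMod N)).trans (Equiv.subRight (1 : ZMod N)))
        fun i => -((y i 0 * y (i + 1) 1 - y (i + 1) 0 * y i 1) * prodOthers (fun j => y j 2) i)]
    simp only [prodOthers_neg (fun j => y j 2)]
    congr 1
    refine Finset.sum_congr rfl fun i _ => ?_
    simp only [Equiv.trans_apply, Equiv.neg_apply, Equiv.subRight_apply]
    ring_nf

theorem analyticAt_homArea (v : ZMod N → Fin 3 → ℂ) : AnalyticAt ℂ (homArea (N := N)) v := by
  unfold homArea
  refine analyticAt_const.mul (Finset.analyticAt_fun_sum (N := Finset.univ) fun i _ => ?_)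
  exact (((analyticAt_entry v i 0).mul (analyticAt_entry v (i + 1) 1)).sub
    ((analyticAt_entry v (i + 1) 0).mul (analyticAt_entry v i 1))).mul (analyticAt_prodOthers v i)

theorem homArea_smul (hN : 2 ≤ N) (a : ZMod N → ℂ) (v : ZMod N → Fin 3 → ℂ) :
    homArea (fun i => a i • v i) = (∏ i, a i) * homArea v := by
  unfold homArea
  rw [mul_left_comm]
  congr 1
  rw [Finset.mul_sum]
  refine Finset.sum_congr rfl fun i _ => ?_
  have : prodOthers (fun j => (a j • v j) 2) i
      = prodOthers a i * prodOthers (fun j => v j 2) i := by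
    simp only [prodOthers, ← Finset.prod_mul_distrib]
    refine Finset.prod_congr rfl fun j _ => ?_
    split_ifs <;> simp
  rw [this, ← prodOthers_mul hN a i]
  simp only [Pi.smul_apply, smul_eq_mul]
  ring

theorem homArea_affine (Q : ZMod N → ℂ × ℂ) :
    homArea (fun i => ![(Q i).1, (Q i).2, 1]) = polygonArea Q := by
  simp [homArea, polygonArea, prodOthers]

variable {C D : SmoothConic}

/-- Each vector enters four times: twice in its own dual form and once in the pairing with each of
its two neighbours. -/
theorem specialProduct_smul (a : ZMod N → ℂ) (v : ZMod N → Fin 3 → ℂ) :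
    specialProduct C D (fun i => a i • v i) = (∏ i, a i) ^ 4 * specialProduct C D v := by
  have h : ∏ i, a (i + 1) = ∏ i, a i := Equiv.prod_comp (Equiv.addRight (1 : ZMod N)) a
  have : (∏ i, a i) ^ 4 = ∏ i, a (i + 1) ^ 3 * a i := by
    rw [Finset.prod_mul_distrib, Finset.prod_pow, h]; ring
  rw [this, specialProduct, specialProduct, ← Finset.prod_mul_distrib]
  refine Finset.prod_congr rfl fun i _ => ?_
  simp only [Matrix.mulVec_smul, smul_dotProduct, dotProduct_smul, smul_eq_mul]
  ring

theorem SmoothConic.dot_mulVec_comm (C : SmoothConic) (v w : Fin 3 → ℂ) :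
    v ⬝ᵥ C.M *ᵥ w = w ⬝ᵥ C.M *ᵥ v := by
  rw [Matrix.dotProduct_mulVec, ← Matrix.mulVec_transpose, C.symm.eq, dotProduct_comm]

theorem specialProduct_neg (v : ZMod N → Fin 3 → ℂ) :
    specialProduct C D (fun i => v (-i)) = specialProduct C D v := by
  rw [specialProduct, specialProduct, Finset.prod_mul_distrib, Finset.prod_mul_distrib]
  congr 1
  · exact (Equiv.prod_comp ((Equiv.addRight (1 : ZMod N)).trans (Equiv.neg _))
      fun i => v i ⬝ᵥ D.M⁻¹ *ᵥ v i).trans (Equiv.prod_comp (Equiv.addRight (1 : ZMod N))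
        fun i => v i ⬝ᵥ D.M⁻¹ *ᵥ v i).symm
  · rw [← Equiv.prod_comp ((Equiv.neg (ZMod N)).trans (Equiv.subRight (1 : ZMod N)))
      fun i => v i ⬝ᵥ C.M *ᵥ v (i + 1)]
    refine Finset.prod_congr rfl fun i _ => ?_
    simp only [Equiv.trans_apply, Equiv.neg_apply, Equiv.subRight_apply]
    rw [C.dot_mulVec_comm]
    ring_nf

theorem analyticAt_specialProduct (v : ZMod N → Fin 3 → ℂ) :
    AnalyticAt ℂ (specialProduct (N := N) C D) v := by
  unfold specialProduct
  refine Finset.analyticAt_fun_prod _ fun i _ => ?_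
  have h : ∀ (A : Matrix (Fin 3) (Fin 3) ℂ) (j k : ZMod N), AnalyticAt ℂ
      (fun v : ZMod N → Fin 3 → ℂ => v j ⬝ᵥ A *ᵥ v k) v := by
    intro A j k
    simp only [dotProduct, Matrix.mulVec]
    exact Finset.analyticAt_fun_sum _ fun a _ => (analyticAt_entry v j a).mul
      (Finset.analyticAt_fun_sum _ fun b _ => analyticAt_const.mul (analyticAt_entry v k b))
  exact (h _ _ _).mul (h _ _ _)

/-- The ratio which is constant along the family of nonspecial chains. -/
noncomputable def areaRatio (C D : SmoothConic) (v : ZMod N → Fin 3 → ℂ) : ℂ :=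
  homArea v ^ 4 / specialProduct C D v

theorem areaRatio_smul (hN : 2 ≤ N) {a : ZMod N → ℂ} (ha : ∀ i, a i ≠ 0)
    (v : ZMod N → Fin 3 → ℂ) : areaRatio C D (fun i => a i • v i) = areaRatio C D v := by
  rw [areaRatio, areaRatio, homArea_smul hN, specialProduct_smul, mul_pow]
  exact mul_div_mul_left _ _ (pow_ne_zero 4 (Finset.prod_ne_zero_iff.2 fun i _ => ha i))

theorem areaRatio_neg (v : ZMod N → Fin 3 → ℂ) :
    areaRatio C D (fun i => v (-i)) = areaRatio C D v := by
  rw [areaRatio, areaRatio, homArea_isOddCyclic.odd, specialProduct_neg]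
  ring_nf

/-- The `v i` are homogeneous coordinates of the even terms of a chain. -/
def IsLifting (z : ℤ → CP2) (v : ZMod N → Fin 3 → ℂ) : Prop :=
  ∀ i : ZMod N, IsLift (z (2 * i.val)) (v i)

variable {z w : ℤ → CP2} {v v' : ZMod N → Fin 3 → ℂ}

theorem isLifting_rep (z : ℤ → CP2) : IsLifting (N := N) z fun i => (z (2 * i.val)).rep :=
  fun _ => IsLift.rep _

theorem IsLifting.exists_smul (h : IsLifting z v) (h' : IsLifting z v') :
    ∃ a : ZMod N → ℂ, (∀ i, a i ≠ 0) ∧ v' = fun i => a i • v i := by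
  choose a ha e using fun i => (h i).exists_smul (h' i)
  exact ⟨a, ha, funext e⟩

theorem IsLifting.areaRatio_eq (hN : 2 ≤ N) (h : IsLifting z v) (h' : IsLifting z v') :
    areaRatio C D v' = areaRatio C D v := by
  obtain ⟨a, ha, rfl⟩ := h.exists_smul h'
  exact areaRatio_smul hN ha v

theorem Closing.eq_of_cast_eq (hc : Closing C D N) (hz : IsDualChain C D z) {a b : ℤ}
    (h : (a : ZMod N) = b) : z (2 * a) = z (2 * b) := by
  obtain ⟨t, ht⟩ := (ZMod.intCast_eq_intCast_iff_dvd_sub a b N).1 h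
  have hp : Function.Periodic z (2 * N : ℤ) := fun k => hc.periodic z hz k
  have := hp.int_mul t (2 * a)
  rw [← this, Int.cast_id]
  congr 1
  linear_combination -2 * ht

theorem IsLifting.reverse (hc : Closing C D N) (hz : IsDualChain C D z)
    (h : ∀ i : ZMod N, IsLift (z (-(2 * i.val))) (v i)) : IsLifting z fun i => v (-i) := by
  intro i
  have := h (-i)
  rwa [show -(2 * ((-i).val : ℤ)) = 2 * -((-i).val : ℤ) by ring,
    hc.eq_of_cast_eq hz (b := i.val) (by simp)] at this

theorem Closing.areaRatio_eq (hc : Closing C D N) (hN : 2 ≤ N) (hz : IsDualChain C D z)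
    (h : IsLifting z v ∨ ∀ i : ZMod N, IsLift (z (-(2 * i.val))) (v i)) (h' : IsLifting z v') :
    areaRatio C D v' = areaRatio C D v := by
  rcases h with h | h
  · exact h.areaRatio_eq hN h'
  · rw [(IsLifting.reverse hc hz h).areaRatio_eq hN h', areaRatio_neg]

theorem SmoothConic.eq_of_dot_eq_zero {p q : CP2} {v w : Fin 3 → ℂ} (hp : p ∈ C.points)
    (hq : q ∈ C.points) (hv : IsLift p v) (hw : IsLift q w) (h : v ⬝ᵥ C.M *ᵥ w = 0) : p = q := by
  obtain ⟨B, hB, hav⟩ := exists_isParam_avoid C ⟨p, hp⟩ (F := {p, q}) (by simp)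
  obtain ⟨x, hx⟩ := hB.exists_isLift_par hp (hav p (by simp))
  obtain ⟨y, hy⟩ := hB.exists_isLift_par hq (hav q (by simp))
  obtain ⟨a, ha, rfl⟩ := hx.exists_smul hv
  obtain ⟨b, hb, rfl⟩ := hy.exists_smul hw
  rw [Matrix.mulVec_smul, smul_dotProduct, dotProduct_smul, hB.par_dot_par] at h
  simp only [smul_eq_mul, mul_eq_zero, ha, hb, false_or, pow_eq_zero_iff two_ne_zero,
    sub_eq_zero] at h
  rw [h] at hx
  exact hx.unique hy

/-- A zero of the dual form marks a special vertex; a zero of the pairing makes consecutive vertices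
equal, so the side between them is special. -/
theorem IsLifting.specialProduct_ne_zero (hc : Closing C D N) (hz : IsDualChain C D z)
    (hns : ∀ k, z (k - 1) ≠ z (k + 1)) (h : IsLifting z v) : specialProduct C D v ≠ 0 := by
  refine Finset.prod_ne_zero_iff.2 fun i _ => mul_ne_zero (fun h0 => ?_) fun h0 => ?_
  · refine hns (2 * (i + 1).val) ((hz.special_iff (h (i + 1))).2 ?_)
    rwa [alt_of_odd _ _ ⟨_, rfl⟩]
  · have hm : ∀ j : ℤ, z (2 * j) ∈ C.points := fun j => by
      have := hz.mem_points (2 * j)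
      rwa [alt_of_even _ _ ⟨j, two_mul j⟩] at this
    have e := SmoothConic.eq_of_dot_eq_zero (hm _) (hm _) (h i) (h (i + 1)) h0
    apply hns (2 * i.val + 1)
    rw [add_sub_cancel_right, e, show 2 * (i.val : ℤ) + 1 + 1 = 2 * (i.val + 1) by ring]
    exact hc.eq_of_cast_eq hz (by simp)

end polygon

/-! ### Constancy of the ratio by Liouville's theorem. -/

/-- The singularities are removable and are filled in one at a time; what remains is a bounded
entire function. -/
theorem eq_of_bounded_off_finite {S : Set ℂ} (hS : S.Finite) {f : ℂ → ℂ}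
    (hf : DifferentiableOn ℂ f Sᶜ) (hb : BddAbove (norm ∘ f '' Sᶜ)) :
    ∀ u ∉ S, ∀ v ∉ S, f u = f v := by
  induction S, hS using Set.Finite.induction_on generalizing f with
  | empty =>
    intro u _ v _
    rw [Set.compl_empty] at hf hb
    refine (differentiableOn_univ.1 hf).apply_eq_apply_of_bounded ?_ u v
    obtain ⟨R, hR⟩ := hb
    refine (Metric.isBounded_closedBall (x := (0 : ℂ)) (r := R)).subset ?_
    rintro _ ⟨x, rfl⟩
    simpa using hR ⟨x, trivial, rfl⟩
  | @insert a S ha hS ih =>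
    have e : (insert a S)ᶜ = Sᶜ \ {a} := by
      ext x; simp [not_or, and_comm]
    rw [e] at hf hb
    have hn : Sᶜ ∈ 𝓝 a := hS.isClosed.isOpen_compl.mem_nhds ha
    have hg := Complex.differentiableOn_update_limUnder_of_bddAbove hn hf hb
    set g := Function.update f a (limUnder (𝓝[≠] a) f) with hgdef
    have hgf : ∀ x, x ≠ a → g x = f x := fun x hx => Function.update_of_ne hx _ _
    have := ih hg ((hb.insert ‖g a‖).mono ?_)
    · intro u hu v hv
      rw [Set.mem_insert_iff, not_or] at hu hv
      rw [← hgf u hu.1, ← hgf v hv.1]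
      exact this u hu.2 v hv.2
    · rintro _ ⟨x, hx, rfl⟩
      by_cases hxa : x = a
      · exact Or.inl (by rw [hxa]; rfl)
      · refine Or.inr ⟨x, ⟨hx, hxa⟩, ?_⟩
        simp [hgf x hxa]

section liouville

variable {C D : SmoothConic} {N : ℕ} [NeZero N]

/-- Local models give a bound near every chain, special ones included, and compactness of the set of
isotropic unit vectors makes it uniform. -/
theorem MinClosing.areaRatio_bounded (hc : MinClosing C D N) :
    ∃ R : ℝ, ∀ w, IsDualChain C D w → ∀ v : ZMod N → Fin 3 → ℂ, IsLifting w v →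
      ‖areaRatio C D v‖ ≤ R := by
  have hN : 2 ≤ N := by have := hc.three_le; omega
  have hcont : Continuous fun v : Fin 3 → ℂ => v ⬝ᵥ C.M *ᵥ v :=
    Continuous.dotProduct continuous_id (Continuous.matrix_mulVec continuous_const continuous_id)
  have hK : IsCompact (Metric.sphere (0 : Fin 3 → ℂ) 1 ∩ {v | v ⬝ᵥ C.M *ᵥ v = 0}) :=
    (isCompact_sphere 0 1).inter_right (isClosed_eq hcont continuous_const)
  obtain ⟨R, hR⟩ : ∃ R : ℝ, ∀ u ∈ Metric.sphere (0 : Fin 3 → ℂ) 1 ∩ {v | v ⬝ᵥ C.M *ᵥ v = 0},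
      ∀ w, IsDualChain C D w → IsLift (w 0) u → ∀ v : ZMod N → Fin 3 → ℂ, IsLifting w v →
        ‖areaRatio C D v‖ ≤ R := by
    refine hK.induction_on (p := fun s => ∃ R : ℝ, ∀ u ∈ s, ∀ w, IsDualChain C D w →
      IsLift (w 0) u → ∀ v : ZMod N → Fin 3 → ℂ, IsLifting w v → ‖areaRatio C D v‖ ≤ R)
      ⟨0, by simp⟩ ?_ ?_ ?_
    · rintro s t hst ⟨R, hR⟩
      exact ⟨R, fun u hu => hR u (hst hu)⟩
    · rintro s t ⟨R, hR⟩ ⟨R', hR'⟩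
      refine ⟨max R R', ?_⟩
      rintro u (hu | hu) w hw hl v hv
      · exact (hR u hu w hw hl v hv).trans (le_max_left _ _)
      · exact (hR' u hu w hw hl v hv).trans (le_max_right _ _)
    · rintro v₀ ⟨hv₀, hv₀'⟩
      have h0 : v₀ ≠ 0 := by
        rintro rfl
        simp at hv₀
      obtain ⟨p, hp⟩ := IsLift.of_ne_zero h0
      obtain ⟨z, hz, rfl⟩ := hc.exists_chain p ((hp.mem_points_iff C).2 hv₀')
      obtain ⟨m, v, L⟩ := exists_localModel hc hz
      obtain ⟨c, hc0, hlow⟩ := L.lower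
      obtain ⟨φ, hφ, hup⟩ := L.upper _ homArea_isOddCyclic (analyticAt_homArea _)
      have hφb : ∀ᶠ s in 𝓝 0, ‖φ s‖ < ‖φ 0‖ + 1 :=
        hφ.continuousAt.norm.tendsto.eventually (gt_mem_nhds (lt_add_one _))
      have hev : ∀ᶠ s in 𝓝 (0 : ℂ),
          ‖areaRatio C D fun i => v i s‖ ≤ (‖φ 0‖ + 1) ^ 4 / c := by
        filter_upwards [hlow, hup, hφb] with s h1 h2 h3
        -- Where the special product vanishes, the quotient has the default value 0 and the bound
        -- still holds.
        rw [areaRatio, norm_div, norm_pow, h2]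
        refine div_le_of_le_mul₀ (norm_nonneg _) (by positivity) ?_
        rw [norm_mul, norm_pow, mul_pow, ← pow_mul, mul_comm m 4]
        calc ‖s‖ ^ (4 * m) * ‖φ s‖ ^ 4 ≤ ‖s‖ ^ (4 * m) * (‖φ 0‖ + 1) ^ 4 := by gcongr
          _ = (‖φ 0‖ + 1) ^ 4 / c * (c * ‖s‖ ^ (4 * m)) := by field_simp
          _ ≤ _ := by gcongr
      have hcap := L.capture v₀ hp _ hev
      refine ⟨_, mem_nhdsWithin_of_mem_nhds hcap, (‖φ 0‖ + 1) ^ 4 / c, ?_⟩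
      intro u hu w hw hl v' hv'
      obtain ⟨s, hs, hs'⟩ := hu w hw hl
      rwa [hc.toClosing.areaRatio_eq hN hw hs' hv']
  refine ⟨R, fun w hw v hv => ?_⟩
  have hl := IsLift.rep (w 0)
  have hn : ‖(w 0).rep‖ ≠ 0 := norm_ne_zero_iff.2 hl.ne_zero
  have hl' := hl.smul (a := ((‖(w 0).rep‖⁻¹ : ℝ) : ℂ)) (by simpa using hl.ne_zero)
  refine hR _ ⟨?_, ?_⟩ w hw hl' v hv
  · rw [mem_sphere_zero_iff_norm, norm_smul, Complex.norm_real, norm_inv, norm_norm,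
      inv_mul_cancel₀ hn]
  · exact (hl'.mem_points_iff C).1 hw.zero_mem

theorem ParamPair.notMem_bad {P : ParamPair C D} {w : ℤ → CP2} {u : ℂ} (hw : IsDualChain C D w)
    (hPw : ∀ k, ¬ IsLift (w k) (infPar (P.mat k))) (hns : ∀ k, w (k - 1) ≠ w (k + 1))
    (hu : IsLift (w 0) (par (P.mat 0) u)) : u ∉ P.bad := by
  rintro ⟨z', hz', h0, k, hk⟩
  have e := h0.unique hu
  have hgood : ∀ k, ¬ (IsLift (w k) (infPar (P.mat k)) ∨ w (k - 1) = w (k + 1)) := by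
    intro k hk
    rcases hk with hk | hk
    exacts [hPw k hk, hns k hk]
  rcases hw.eq_or_eq_reverse hz' e.symm with rfl | rfl
  · exact hgood k hk
  · apply hgood (-k)
    have em : P.mat (-k) = P.mat k := by simpa using P.mat_two_mul_sub k 0
    rw [em]
    rcases hk with hk | hk
    · exact Or.inl hk
    · right
      rw [show -k - 1 = -(k + 1) by ring, show -k + 1 = -(k - 1) by ring]
      exact hk.symm

/-- The ratio ignores both the scaling of the vectors and the direction, so it is a well-defined
function of the first coordinate `u`, although the chain `ζ u` is chosen arbitrarily. -/
theorem MinClosing.areaRatio_const (hc : MinClosing C D N) {z z' : ℤ → CP2}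
    (hz : IsDualChain C D z) (hz' : IsDualChain C D z') (hn : ∀ k, z (k - 1) ≠ z (k + 1))
    (hn' : ∀ k, z' (k - 1) ≠ z' (k + 1)) {v v' : ZMod N → Fin 3 → ℂ} (hv : IsLifting z v)
    (hv' : IsLifting z' v') : areaRatio C D v = areaRatio C D v' := by
  have hN : 2 ≤ N := by have := hc.three_le; omega
  obtain ⟨P, hPz, hPz'⟩ := exists_paramPair_avoid hc.pos hc.toClosing hz hz'
  have hex : ∀ u : ℂ, ∃ w, IsDualChain C D w ∧ IsLift (w 0) (par (P.mat 0) u) := by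
    intro u
    obtain ⟨p, hp⟩ := IsLift.of_ne_zero ((P.isParam 0).par_ne_zero u)
    obtain ⟨w, hw, rfl⟩ := hc.exists_chain p ((P.isParam 0).par_mem_points hp)
    exact ⟨w, hw, hp⟩
  choose ζ hζ hζl using hex
  have hm0 : ∀ j : ℤ, P.mat (2 * j) = P.mat 0 := fun j => by
    rw [← P.mat_add_two_mul 0 j, zero_add]
  set f : ℂ → ℂ := fun u => areaRatio C D fun i : ZMod N => (ζ u (2 * i.val)).rep with hf
  have hfe : ∀ {w : ℤ → CP2} {u : ℂ} {y : ZMod N → Fin 3 → ℂ}, IsDualChain C D w →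
      IsLift (w 0) (par (P.mat 0) u) → IsLifting w y → areaRatio C D y = f u := by
    intro w u y hw hu hy
    simp only [hf]
    rcases (hζ u).eq_or_eq_reverse hw ((hζl u).unique hu) with h | h
    · exact IsLifting.areaRatio_eq hN (h ▸ isLifting_rep _) hy
    · rw [h] at hy
      exact (hc.toClosing.areaRatio_eq hN (hζ u) (Or.inr hy) (isLifting_rep _)).symm
  have hdiff : DifferentiableOn ℂ f P.badᶜ := by
    intro u₀ hu₀
    refine DifferentiableAt.differentiableWithinAt ?_
    obtain ⟨Z, hZ, hZc⟩ := P.exists_analytic_chain hc.toClosing (2 * N) hu₀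
    set y : ℂ → ZMod N → Fin 3 → ℂ := fun u i => par (P.mat 0) (Z (2 * i.val) u) with hy
    have hya : AnalyticAt ℂ y u₀ := analyticAt_pi_iff.2 fun i => analyticAt_par (hZ _)
    have hor : ∀ᶠ u in 𝓝 u₀, IsLifting (ζ u) (y u) ∨
        ∀ i : ZMod N, IsLift (ζ u (-(2 * i.val))) (y u i) := by
      filter_upwards [hZc] with u hu
      have hle : ∀ i : ZMod N, 2 * i.val ≤ 2 * N := fun i => by have := ZMod.val_lt i; omega
      refine (hu (ζ u) (hζ u) (hζl u)).imp (fun h i => ?_) fun h i => ?_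
      · have := h _ (hle i)
        push_cast at this
        rwa [hm0] at this
      · have := h _ (hle i)
        push_cast at this
        rwa [hm0] at this
    have hfy : f =ᶠ[𝓝 u₀] fun u => areaRatio C D (y u) := by
      filter_upwards [hor] with u hu
      exact hc.toClosing.areaRatio_eq hN (hζ u) hu (isLifting_rep _)
    have hns : ∀ k, ζ u₀ (k - 1) ≠ ζ u₀ (k + 1) := fun k h =>
      hu₀ ⟨_, hζ u₀, hζl u₀, k, Or.inr h⟩
    have hne : specialProduct C D (y u₀) ≠ 0 := by
      rcases hor.self_of_nhds with h | h
      · exact h.specialProduct_ne_zero hc.toClosing (hζ u₀) hns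
      · rw [← specialProduct_neg]
        exact (IsLifting.reverse hc.toClosing (hζ u₀) h).specialProduct_ne_zero hc.toClosing
          (hζ u₀) hns
    refine DifferentiableAt.congr_of_eventuallyEq ?_ hfy
    have h1 : AnalyticAt ℂ (fun u => homArea (y u)) u₀ :=
      AnalyticAt.comp (g := homArea) (analyticAt_homArea _) hya
    have h2 : AnalyticAt ℂ (fun u => specialProduct C D (y u)) u₀ :=
      AnalyticAt.comp (g := specialProduct C D) (analyticAt_specialProduct _) hya
    exact ((h1.pow 4).div h2 hne).differentiableAt
  obtain ⟨R, hR⟩ := hc.areaRatio_bounded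
  have hbdd : BddAbove (norm ∘ f '' P.badᶜ) := by
    refine ⟨R, ?_⟩
    rintro _ ⟨u, -, rfl⟩
    exact hR _ (hζ u) _ (isLifting_rep _)
  obtain ⟨a, ha⟩ := (P.isParam 0).exists_isLift_par (hz.mem_points 0) (hPz 0)
  obtain ⟨b, hb⟩ := (P.isParam 0).exists_isLift_par (hz'.mem_points 0) (hPz' 0)
  rw [hfe hz ha hv, hfe hz' hb hv']
  exact eq_of_bounded_off_finite (P.bad_finite hc) hdiff hbdd a
    (ParamPair.notMem_bad hz hPz hn ha) b (ParamPair.notMem_bad hz' hPz' hn' hb)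

end liouville

/-! ### Quotients of vertex sums by the area. -/

section sums

variable {N : ℕ} [NeZero N]

/-- A sum over the vertices of a polygon, of a function of three consecutive vertices. -/
def neighbourSum (g : ℂ × ℂ → ℂ × ℂ → ℂ × ℂ → ℂ) (Q : ZMod N → ℂ × ℂ) : ℂ :=
  ∑ i, g (Q (i - 1)) (Q i) (Q (i + 1))

/-- The standard homogeneous coordinates of finite vertices. -/
def affLift (Q : ZMod N → ℂ × ℂ) (i : ZMod N) : Fin 3 → ℂ := ![(Q i).1, (Q i).2, 1]

/-- The affine coordinates of a point given by homogeneous coordinates. -/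
noncomputable def affCoord (v : Fin 3 → ℂ) : ℂ × ℂ := (v 0 / v 2, v 1 / v 2)

theorem neighbourSum_shift (g : ℂ × ℂ → ℂ × ℂ → ℂ × ℂ → ℂ) (Q : ZMod N → ℂ × ℂ) :
    neighbourSum g (fun i => Q (i + 1)) = neighbourSum g Q := by
  unfold neighbourSum
  rw [← Equiv.sum_comp (Equiv.addRight (1 : ZMod N)) fun i => g (Q (i - 1)) (Q i) (Q (i + 1))]
  simp

theorem neighbourSum_neg {g : ℂ × ℂ → ℂ × ℂ → ℂ × ℂ → ℂ} (hg : ∀ a b c, g c b a = -g a b c)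
    (Q : ZMod N → ℂ × ℂ) : neighbourSum g (fun i => Q (-i)) = -neighbourSum g Q := by
  unfold neighbourSum
  rw [← Finset.sum_neg_distrib, ← Equiv.sum_comp (Equiv.neg (ZMod N))
    fun i => -g (Q (i - 1)) (Q i) (Q (i + 1))]
  refine Finset.sum_congr rfl fun i _ => ?_
  rw [← hg]
  simp only [Equiv.neg_apply]
  ring_nf

theorem isOddCyclic_neighbourSum {g : ℂ × ℂ → ℂ × ℂ → ℂ × ℂ → ℂ}
    (hg : ∀ a b c, g c b a = -g a b c) :
    IsOddCyclic fun v : ZMod N → Fin 3 → ℂ => neighbourSum g fun i => affCoord (v i) :=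
  ⟨fun v => neighbourSum_shift g fun i => affCoord (v i),
    fun v => neighbourSum_neg hg fun i => affCoord (v i)⟩

theorem analyticAt_neighbourSum {g : ℂ × ℂ → ℂ × ℂ → ℂ × ℂ → ℂ}
    (hg : ∀ p, AnalyticAt ℂ (fun p : (ℂ × ℂ) × (ℂ × ℂ) × (ℂ × ℂ) => g p.1 p.2.1 p.2.2) p)
    {v : ZMod N → Fin 3 → ℂ} (hv : ∀ i, v i 2 ≠ 0) :
    AnalyticAt ℂ (fun v : ZMod N → Fin 3 → ℂ => neighbourSum g fun i => affCoord (v i)) v := by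
  have h : ∀ i, AnalyticAt ℂ (fun v : ZMod N → Fin 3 → ℂ => affCoord (v i)) v := fun i =>
    ((analyticAt_entry v i 0).div (analyticAt_entry v i 2) (hv i)).prod
      ((analyticAt_entry v i 1).div (analyticAt_entry v i 2) (hv i))
  unfold neighbourSum
  refine Finset.analyticAt_fun_sum _ fun i _ => ?_
  exact (hg _).comp ((h (i - 1)).prod ((h i).prod (h (i + 1))))

theorem affCoord_of_isLift {p : CP2} {v : Fin 3 → ℂ} {x : ℂ × ℂ} (hp : IsLift p ![x.1, x.2, 1])
    (hv : IsLift p v) : v 2 ≠ 0 ∧ affCoord v = x := by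
  obtain ⟨a, ha, rfl⟩ := hp.exists_smul hv
  refine ⟨by simpa using ha, ?_⟩
  ext
  · simp [affCoord]; field_simp
  · simp [affCoord]; field_simp

theorem homArea_eq_mul_polygonArea (hN : 2 ≤ N) {v : ZMod N → Fin 3 → ℂ} (hv : ∀ i, v i 2 ≠ 0) :
    homArea v = (∏ i, v i 2) * polygonArea fun i => affCoord (v i) := by
  rw [← homArea_affine, ← homArea_smul hN]
  congr 1
  funext i
  have := hv i
  ext j
  fin_cases j
  · simp [affCoord]; field_simp
  · simp [affCoord]; field_simp
  · simp

theorem polygonArea_neg (Q : ZMod N → ℂ × ℂ) : polygonArea (fun i => Q (-i)) = -polygonArea Q := by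
  rw [← homArea_affine, ← homArea_affine]
  exact homArea_isOddCyclic.odd fun i => ![(Q i).1, (Q i).2, 1]

variable {C D : SmoothConic} {z : ℤ → CP2} {m : ℕ} {v : ZMod N → ℂ → Fin 3 → ℂ}

/-- Numerator and area are both odd cyclic and carry the same factor `s ^ m`; it cancels, as does
the sign caused by an unknown orientation. -/
theorem LocalModel.exists_tendsto (hc : MinClosing C D N) (L : LocalModel C D z m v) {H : ℂ}
    (hH : H ≠ 0) {ι : Type*} {l : Filter ι} [NeBot l] {p : ι → ZMod N → ℂ × ℂ}
    {p₀ : ZMod N → ℂ × ℂ} (hp : Tendsto p l (𝓝 p₀)) (hz : IsLifting z (affLift p₀))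
    (hw : ∀ᶠ t in l, ∃ w, IsDualChain C D w ∧ IsLifting w (affLift (p t)) ∧
      areaRatio C D (affLift (p t)) = H)
    {g : ℂ × ℂ → ℂ × ℂ → ℂ × ℂ → ℂ} (hg : ∀ a b c, g c b a = -g a b c)
    (hga : ∀ p, AnalyticAt ℂ (fun p : (ℂ × ℂ) × (ℂ × ℂ) × (ℂ × ℂ) => g p.1 p.2.1 p.2.2) p) :
    ∃ c, Tendsto (fun t => neighbourSum g (p t) / polygonArea (p t)) l (𝓝 c) := by
  have hN : 2 ≤ N := by have := hc.three_le; omega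
  have hv0 : ∀ i, v i 0 2 ≠ 0 := fun i => (affCoord_of_isLift (hz i) (L.lift i)).1
  -- The parameter `s` of `p t` need not depend continuously on `t`: it suffices that it can be
  -- chosen to satisfy any property valid near 0.
  have hcap : ∀ q : ℂ → Prop, (∀ᶠ s in 𝓝 0, q s) → ∀ᶠ t in l, ∃ s, q s ∧
      areaRatio C D (fun i => v i s) = H ∧ (p t = (fun i => affCoord (v i s)) ∨
        p t = fun i => affCoord (v (-i) s)) := by
    intro q hq
    have hl0 : IsLift (z 0) (affLift p₀ 0) := by simpa using hz 0
    have hu : Tendsto (fun t => affLift (p t) 0) l (𝓝 (affLift p₀ 0)) := by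
      have h0 : Tendsto (fun t => p t 0) l (𝓝 (p₀ 0)) := (tendsto_pi_nhds.1 hp) 0
      rw [tendsto_pi_nhds]
      intro j
      fin_cases j
      · exact (continuous_fst.tendsto _).comp h0
      · exact (continuous_snd.tendsto _).comp h0
      · exact tendsto_const_nhds
    filter_upwards [hu.eventually (L.capture _ hl0 q hq), hw] with t ht ⟨w, hw, hwl, hwr⟩
    obtain ⟨s, hs, hor⟩ := ht w hw (by simpa using hwl 0)
    refine ⟨s, hs, ?_, hor.imp (fun h => ?_) fun h => ?_⟩
    · rw [← hwr]
      exact (hc.toClosing.areaRatio_eq hN hw hor hwl).symm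
    · funext i
      exact (affCoord_of_isLift (hwl i) (h i)).2.symm
    · funext i
      exact (affCoord_of_isLift (hwl i) (IsLifting.reverse hc.toClosing hw h i)).2.symm
  obtain ⟨φ, hφ, hφe⟩ := L.upper _ homArea_isOddCyclic (analyticAt_homArea _)
  obtain ⟨ν, hν, hνe⟩ := L.upper _ (isOddCyclic_neighbourSum hg) (analyticAt_neighbourSum hga hv0)
  obtain ⟨c, hc0, hlow⟩ := L.lower
  -- Otherwise the fourth power of the area would be `o(‖s‖ ^ (4 * m))`, contradicting its equality
  -- with `H` times the special product.
  have hφ0 : φ 0 ≠ 0 := by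
    intro h0
    have hsmall : ∀ᶠ s in 𝓝 0, ‖φ s‖ ^ 4 < ‖H‖ * c := by
      have h1 : Tendsto (fun s => ‖φ s‖ ^ 4) (𝓝 0) (𝓝 (‖φ 0‖ ^ 4)) :=
        hφ.continuousAt.norm.tendsto.pow 4
      rw [h0, norm_zero, zero_pow four_ne_zero] at h1
      exact h1.eventually (gt_mem_nhds (mul_pos (norm_pos_iff.2 hH) hc0))
    obtain ⟨t, s, ⟨h1, h2, h3⟩, h4, -⟩ := (hcap _ (hsmall.and (hφe.and hlow))).exists
    have hK : specialProduct C D (fun i => v i s) ≠ 0 := by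
      intro hK
      rw [areaRatio, hK, div_zero] at h4
      exact hH h4.symm
    rw [areaRatio, div_eq_iff hK, h2] at h4
    have h5 := congrArg norm h4
    rw [norm_pow, norm_mul, norm_mul, norm_pow, mul_pow, ← pow_mul, mul_comm m 4] at h5
    have hs0 : 0 < ‖s‖ ^ (4 * m) := by
      have : 0 < ‖H‖ * ‖specialProduct C D fun i => v i s‖ :=
        mul_pos (norm_pos_iff.2 hH) (norm_pos_iff.2 hK)
      rw [← h5] at this
      exact pos_of_mul_pos_left this (by positivity)
    have h6 : ‖s‖ ^ (4 * m) * ‖φ s‖ ^ 4 < ‖s‖ ^ (4 * m) * (‖H‖ * c) := by gcongr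
    have h7 : ‖H‖ * (c * ‖s‖ ^ (4 * m)) ≤ ‖H‖ * ‖specialProduct C D fun i => v i s‖ := by gcongr
    rw [← h5] at h7
    linarith
  -- The product of last coordinates converts `homArea` back to the affine area.
  set θ : ℂ → ℂ := fun s => ν s * (∏ i, v i s 2) / φ s with hθ
  have hent : ∀ i, ContinuousAt (fun s => v i s 2) 0 := fun i =>
    (continuous_apply 2).continuousAt.comp (L.analytic i).continuousAt
  have hθc : ContinuousAt θ 0 :=
    (hν.continuousAt.mul (tendsto_finsetProd _ fun i _ => hent i)).div hφ.continuousAt hφ0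
  refine ⟨θ 0, fun W hW => ?_⟩
  have hv2 : ∀ᶠ s in 𝓝 0, ∀ i, v i s 2 ≠ 0 :=
    eventually_all.2 fun i => (hent i).eventually_ne (hv0 i)
  have hW' : ∀ᶠ s in 𝓝 0, θ s ∈ W := hθc.tendsto hW
  have hev := hcap _ (hW'.and
    (hv2.and (hφe.and (hνe.and (hφ.continuousAt.eventually_ne hφ0)))))
  change ∀ᶠ t in l, neighbourSum g (p t) / polygonArea (p t) ∈ W
  filter_upwards [hev] with t ⟨s, ⟨h1, h2, h3, h4, h5⟩, h6, h7⟩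
  have hA : homArea (fun i => v i s) ≠ 0 := by
    intro hA
    rw [areaRatio, hA, zero_pow four_ne_zero, zero_div] at h6
    exact hH h6.symm
  have hval : neighbourSum g (p t) / polygonArea (p t) =
      neighbourSum g (fun i => affCoord (v i s)) / polygonArea fun i => affCoord (v i s) := by
    rcases h7 with h7 | h7
    · rw [h7]
    · rw [h7, neighbourSum_neg hg fun i => affCoord (v i s),
        polygonArea_neg fun i => affCoord (v i s), neg_div_neg_eq]
  have hsm : s ^ m ≠ 0 := fun h => hA (by rw [h3, h, zero_mul])
  have hprod : ∏ i, v i s 2 ≠ 0 := Finset.prod_ne_zero_iff.2 fun i _ => h2 i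
  have hpa : polygonArea (fun i => affCoord (v i s)) = s ^ m * φ s / ∏ i, v i s 2 := by
    rw [eq_div_iff hprod, ← h3, homArea_eq_mul_polygonArea hN h2, mul_comm]
  have : neighbourSum g (p t) / polygonArea (p t) = θ s := by
    rw [hval, h4, hpa, hθ]
    field_simp
  rw [this]
  exact h1

end sums

/-! ### Poncelet polygons as chains. -/

section poncelet

variable {γ Γ : SmoothConic} {n : ℕ}

/-- The sequence of the vertices and sides of a polygon. -/
def interleave (V ℓ : ZMod n → CP2) (k : ℤ) : CP2 :=
  if Even k then V (k / 2 : ℤ) else ℓ (k / 2 : ℤ)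

theorem interleave_even (V ℓ : ZMod n → CP2) (i : ℤ) : interleave V ℓ (2 * i) = V i := by
  rw [interleave, if_pos ⟨i, two_mul i⟩]
  congr 2
  omega

theorem interleave_odd (V ℓ : ZMod n → CP2) (i : ℤ) : interleave V ℓ (2 * i + 1) = ℓ i := by
  rw [interleave, if_neg (Int.not_even_iff_odd.2 ⟨i, rfl⟩)]
  congr 2
  omega

theorem interleave_periodic (V ℓ : ZMod n → CP2) (k : ℤ) :
    interleave V ℓ (k + 2 * n) = interleave V ℓ k := by
  rcases Int.even_or_odd' k with ⟨i, rfl | rfl⟩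
  · rw [← mul_add, interleave_even, interleave_even]; simp
  · rw [show 2 * i + 1 + 2 * (n : ℤ) = 2 * (i + n) + 1 by ring, interleave_odd, interleave_odd]
    simp

theorem IsPonceletChain.isDualChain {V ℓ : ZMod n → CP2} (h : IsPonceletChain γ Γ V ℓ) :
    IsDualChain Γ γ.dual (interleave V ℓ) := by
  intro k
  rcases Int.even_or_odd' k with ⟨i, rfl | rfl⟩
  · have h2 := (h ((i - 1 : ℤ) : ZMod n)).2
    have e : ((i - 1 : ℤ) : ZMod n) + 1 = (i : ℤ) := by push_cast; ring
    rw [e, γ.tangents_eq] at h2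
    rw [alt_of_odd _ _ ⟨i, rfl⟩, interleave_even, interleave_odd,
      show 2 * i - 1 = 2 * (i - 1) + 1 by ring, interleave_odd, ← h2]
    ext p
    simp only [Set.mem_ofPred_eq, Projectivization.orthogonal_comm (v := p)]
  · have h1 := (h (i : ZMod n)).1
    rw [alt_of_even _ _ ⟨i + 1, by ring⟩, interleave_odd, add_sub_cancel_right, interleave_even,
      show 2 * i + 1 + 1 = 2 * (i + 1) by ring, interleave_even, h1]
    push_cast
    rfl

/-- A special vertex lies on `γ`. A special side is tangent to `Γ`, and its point of contact can
only be the vertex `V i`, the sole point of the section. -/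
theorem IsPonceletChain.isDegenerate_of_special {V ℓ : ZMod n → CP2}
    (h : IsPonceletChain γ Γ V ℓ) {k : ℤ}
    (hk : interleave V ℓ (k - 1) = interleave V ℓ (k + 1)) : IsDegeneratePolygon γ Γ V := by
  have hd := h.isDualChain
  have hm : ∀ i : ℤ, V i ∈ Γ.points := fun i => by
    have := hd.mem_points (2 * i)
    rwa [interleave_even, alt_of_even _ _ ⟨i, two_mul i⟩] at this
  rcases Int.even_or_odd' k with ⟨i, rfl | rfl⟩
  · have hl := IsLift.rep (V i)
    rw [hd.special_iff (v := (V i).rep) (by rwa [interleave_even]), alt_of_odd _ _ ⟨i, rfl⟩,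
      γ.dual_M_inv, ← hl.mem_points_iff] at hk
    exact ⟨i, Or.inl ⟨hk, hm i⟩⟩
  · have hl := IsLift.rep (ℓ i)
    have hV : V i = V (i + 1) := by
      rw [add_sub_cancel_right, show 2 * i + 1 + 1 = 2 * (i + 1) by ring, interleave_even,
        interleave_even] at hk
      push_cast at hk
      exact hk
    rw [hd.special_iff (v := (ℓ i).rep) (by rwa [interleave_odd]),
      alt_of_even _ _ ⟨i + 1, by ring⟩] at hk
    have hmem : ℓ i ∈ Γ.tangents := by
      rw [Γ.tangents_eq, hl.mem_points_iff]
      exact hk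
    obtain ⟨p, hp, hpl⟩ := hmem
    have hpV : p ∈ ({V i, V (i + 1)} : Set CP2) := by
      rw [← (h i).1]
      refine ⟨hp, ?_⟩
      rw [← hpl]
      exact hp
    rw [← hV, Set.pair_eq_singleton, Set.mem_singleton_iff] at hpV
    refine ⟨i, Or.inr ?_⟩
    rw [← hpV, hpl, γ.tangents_eq]
    have := hd.mem_points (2 * i + 1)
    rwa [interleave_odd, alt_of_odd _ _ ⟨i, rfl⟩] at this

/-- Any chain agrees with a polygon of the family in its first vertex and first side, hence
everywhere, and inherits its period. -/
theorem AdmitsPonceletFamily.closing (h : AdmitsPonceletFamily γ Γ n) (hγ : γ.dual.points.Nonempty) :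
    Closing Γ γ.dual n := by
  have key : ∀ p ∈ Γ.points, ∀ m ∈ γ.dual.points, Projectivization.orthogonal m p →
      ∃ z, IsDualChain Γ γ.dual z ∧ (∀ k, z (k + 2 * n) = z k) ∧ z 0 = p ∧ z 1 = m := by
    intro p hp m hm hpm
    obtain ⟨V, ℓ, hc, rfl, rfl⟩ := h p hp m (by rwa [γ.tangents_eq])
      (by rwa [Projectivization.orthogonal_comm])
    refine ⟨_, hc.isDualChain, interleave_periodic V ℓ, ?_, ?_⟩
    · simpa using interleave_even V ℓ 0
    · simpa using interleave_odd V ℓ 0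
  refine ⟨fun p hp => ?_, fun z hz => ?_⟩
  · obtain ⟨m, hm, hmp⟩ := exists_mem_points_orthogonal hγ p
    obtain ⟨z, hz, -, h0, -⟩ := key p hp m hm hmp
    exact ⟨z, hz, h0⟩
  · have hm : z 1 ∈ γ.dual.points := by
      have := hz.mem_points 1
      rwa [alt_of_odd _ _ (by decide)] at this
    obtain ⟨w, hw, hp, h0, h1⟩ := key _ hz.zero_mem _ hm (hz.orthogonal_succ 0)
    rw [hz.ext_of_eq hw 0 h0.symm h1.symm]
    exact hp

/-- The chain `w` without period 4 excludes the minimal values 1 and 2; divisibility follows by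
taking the remainder of `n`. -/
theorem Closing.exists_minClosing {C D : SmoothConic} (hc : Closing C D n) (hn : 0 < n)
    {w : ℤ → CP2} (hw : IsDualChain C D w) (hw4 : ¬ ∀ k, w (k + 2 * (2 : ℕ)) = w k) :
    ∃ N, MinClosing C D N ∧ N ∣ n := by
  classical
  have hex : ∃ j : ℕ, 0 < j ∧ ∀ z, IsDualChain C D z → ∀ k, z (k + 2 * j) = z k :=
    ⟨n, hn, hc.periodic⟩
  obtain ⟨hN0, hN⟩ := Nat.find_spec hex
  set N := Nat.find hex with hNdef
  have hcl : Closing C D N := ⟨hc.exists_chain, hN⟩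
  have hmin : ∀ j, 0 < j → j < N → ∃ z, IsDualChain C D z ∧ ¬ ∀ k, z (k + 2 * j) = z k := by
    intro j h0 hj
    have := Nat.find_min hex hj
    push Not at this
    obtain ⟨z, hz, k, hk⟩ := this h0
    exact ⟨z, hz, fun h => hk (h k)⟩
  refine ⟨N, ⟨hcl, ?_, hmin⟩, ?_⟩
  · by_contra hlt
    have : N = 1 ∨ N = 2 := by omega
    rcases this with h | h
    · refine hw4 fun k => ?_
      have := hcl.periodic_mul hw k 2
      rw [h] at this
      simpa using this
    · refine hw4 fun k => ?_
      rw [← h]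
      exact hN w hw k
  · by_contra hnd
    have hpos : 0 < n % N := Nat.pos_of_ne_zero fun h => hnd (Nat.dvd_of_mod_eq_zero h)
    obtain ⟨z, hz, hz'⟩ := hmin _ hpos (Nat.mod_lt _ hN0)
    refine hz' fun k => ?_
    rw [← hcl.periodic_mul hz (k + 2 * (n % N : ℕ)) (n / N), ← hc.periodic z hz k]
    congr 1
    have : (n : ℤ) = (n % N : ℕ) + (n / N : ℕ) * N := by
      exact_mod_cast (Nat.mod_add_div' n N).symm
    conv_rhs => rw [this]
    ring

end poncelet

theorem isLift_ofAffine (x : ℂ × ℂ) : IsLift (CP2.ofAffine x) ![x.1, x.2, 1] := ⟨_, rfl⟩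

theorem ofAffine_injective : Function.Injective CP2.ofAffine := by
  intro x y h
  have h1 := isLift_ofAffine x
  rw [h] at h1
  rw [← (affCoord_of_isLift (isLift_ofAffine y) h1).2,
    (affCoord_of_isLift (isLift_ofAffine x) (isLift_ofAffine x)).2]

/-! ### Polygons traversed several times. -/

section cover

variable {n N : ℕ} [NeZero n] [NeZero N]

/-- `K` is the common size of the fibres of the reduction homomorphism. -/
theorem sum_castHom (h : N ∣ n) : ∃ K : ℕ, K ≠ 0 ∧ ∀ F : ZMod N → ℂ,
    ∑ i : ZMod n, F (ZMod.castHom h (ZMod N) i) = K * ∑ j, F j := by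
  classical
  set π := ZMod.castHom h (ZMod N) with hπ
  have hs : Function.Surjective π := ZMod.castHom_surjective h
  refine ⟨(Finset.univ.filter fun i => π i = 0).card, ?_, fun F => ?_⟩
  · exact Finset.card_ne_zero.2 ⟨0, by simp⟩
  · rw [← Finset.sum_fiberwise Finset.univ π, Finset.mul_sum]
    refine Finset.sum_congr rfl fun j _ => ?_
    have hcard : (Finset.univ.filter fun i => π i = j).card =
        (Finset.univ.filter fun i => π i = 0).card :=
      AddMonoidHom.card_fiber_eq_of_mem_range π.toAddMonoidHom (hs j) (hs 0)
    rw [Finset.sum_congr rfl (g := fun _ => F j) (fun i hi => by rw [(Finset.mem_filter.1 hi).2]),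
      Finset.sum_const, hcard, nsmul_eq_mul]

theorem neighbourSum_castHom (h : N ∣ n) : ∃ K : ℂ, K ≠ 0 ∧
    ∀ (Q : ZMod n → ℂ × ℂ) (Q' : ZMod N → ℂ × ℂ), (∀ i, Q i = Q' (ZMod.castHom h (ZMod N) i)) →
      polygonArea Q = K * polygonArea Q' ∧
        ∀ g, neighbourSum g Q = K * neighbourSum g Q' := by
  obtain ⟨K, hK, hsum⟩ := sum_castHom (n := n) (N := N) h
  refine ⟨K, Nat.cast_ne_zero.2 hK, fun Q Q' hQ => ⟨?_, fun g => ?_⟩⟩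
  · unfold polygonArea
    rw [mul_left_comm, ← hsum fun j =>
      (Q' j).1 * (Q' (j + 1)).2 - (Q' (j + 1)).1 * (Q' j).2]
    simp only [hQ, map_add, map_one]
  · unfold neighbourSum
    rw [← hsum fun j => g (Q' (j - 1)) (Q' j) (Q' (j + 1))]
    simp only [hQ, map_add, map_sub, map_one]

end cover

/-! ### Assembly of the theorem. -/

section main

variable {γ Γ : SmoothConic} {n N : ℕ} [NeZero n] [NeZero N]

/-- The vertices of the primitive polygon which is traversed by a given one. -/
def primitivePart (N : ℕ) (Q : ZMod n → ℂ × ℂ) (j : ZMod N) : ℂ × ℂ := Q (j.val : ZMod n)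

theorem IsPonceletChain.eq_primitivePart (hc : Closing Γ γ.dual N) (h : N ∣ n)
    {Q : ZMod n → ℂ × ℂ} {ℓ : ZMod n → CP2}
    (hQ : IsPonceletChain γ Γ (fun i => CP2.ofAffine (Q i)) ℓ) (i : ZMod n) :
    Q i = primitivePart N Q (ZMod.castHom h (ZMod N) i) := by
  apply ofAffine_injective
  have h1 := hc.eq_of_cast_eq hQ.isDualChain (a := i.val)
    (b := (ZMod.castHom h (ZMod N) i).val) (by
      push_cast
      rw [ZMod.natCast_zmod_val, ← map_natCast (ZMod.castHom h (ZMod N)), ZMod.natCast_zmod_val])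
  rw [interleave_even, interleave_even] at h1
  simpa [primitivePart] using h1

theorem IsPonceletChain.isLifting {Q : ZMod n → ℂ × ℂ} {ℓ : ZMod n → CP2} :
    IsLifting (interleave (fun i => CP2.ofAffine (Q i)) ℓ) (affLift (primitivePart N Q)) := by
  intro i
  rw [interleave_even]
  simpa [primitivePart, affLift] using isLift_ofAffine (Q (i.val : ZMod n))

/-- Symmetry of the chain about index `k` exchanges the vertices `i` and `k - i`, so the odd
function area would vanish. -/
theorem IsPonceletChain.nonspecial_of_area {Q : ZMod n → ℂ × ℂ} {ℓ : ZMod n → CP2}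
    (hQ : IsPonceletChain γ Γ (fun i => CP2.ofAffine (Q i)) ℓ) (hA : polygonArea Q ≠ 0) (k : ℤ) :
    interleave (fun i => CP2.ofAffine (Q i)) ℓ (k - 1) ≠
      interleave (fun i => CP2.ofAffine (Q i)) ℓ (k + 1) := by
  intro hk
  apply hA
  rw [← homArea_affine]
  refine homArea_isOddCyclic.eq_zero_of_symmetric (k : ZMod n) fun i => ?_
  have := hQ.isDualChain.symmetric_of_special hk (2 * i.val)
  rw [← mul_sub, interleave_even, interleave_even] at this
  have e := ofAffine_injective this
  simp only [Int.cast_sub, Int.cast_natCast, ZMod.natCast_zmod_val] at e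
  rw [e]

theorem polygonArea_eq_zero_of_period_two {Q : ZMod n → ℂ × ℂ} (h : ∀ i, Q (i + 2) = Q i) :
    polygonArea Q = 0 := by
  have h1 : ∑ i, ((Q i).1 * (Q (i + 1)).2 - (Q (i + 1)).1 * (Q i).2) =
      -∑ i, ((Q i).1 * (Q (i + 1)).2 - (Q (i + 1)).1 * (Q i).2) := by
    conv_lhs => rw [← Equiv.sum_comp (Equiv.addRight (1 : ZMod n))]
    rw [← Finset.sum_neg_distrib]
    refine Finset.sum_congr rfl fun i _ => ?_
    simp only [Equiv.coe_addRight]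
    rw [add_assoc, one_add_one_eq_two, h]
    ring
  unfold polygonArea
  linear_combination (1 / 4) * h1

/-- The limits exist for all quotients of a sum over the vertices by the area. -/
theorem exists_tendsto_neighbourSum_div (hfam : AdmitsPonceletFamily γ Γ n)
    {Q : ZMod n → ℂ × ℂ} (hQ : IsPonceletPolygon γ Γ fun i => CP2.ofAffine (Q i))
    (hQA : polygonArea Q ≠ 0) {P : ZMod n → ℂ × ℂ}
    (hP : IsPonceletPolygon γ Γ fun i => CP2.ofAffine (P i)) {ι : Type*} {l : Filter ι} [NeBot l]
    {Pt : ι → ZMod n → ℂ × ℂ}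
    (hPt : ∀ᶠ t in l, IsPonceletPolygon γ Γ (fun i => CP2.ofAffine (Pt t i)) ∧
      ¬ IsDegeneratePolygon γ Γ fun i => CP2.ofAffine (Pt t i))
    (hlim : Tendsto Pt l (𝓝 P)) :
    (∀ᶠ t in l, polygonArea (Pt t) ≠ 0) ∧
      ∀ g : ℂ × ℂ → ℂ × ℂ → ℂ × ℂ → ℂ, (∀ a b c, g c b a = -g a b c) →
        (∀ p, AnalyticAt ℂ (fun p : (ℂ × ℂ) × (ℂ × ℂ) × (ℂ × ℂ) => g p.1 p.2.1 p.2.2) p) →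
          ∃ c, Tendsto (fun t => neighbourSum g (Pt t) / polygonArea (Pt t)) l (𝓝 c) := by
  obtain ⟨ℓ, hℓ⟩ := hQ
  obtain ⟨m, hm⟩ := hP
  have hdual : γ.dual.points.Nonempty := by
    have := hℓ.isDualChain.mem_points 1
    rw [alt_of_odd _ _ (by decide)] at this
    exact ⟨_, this⟩
  -- A chain of period 4 has vertices of period 2; each edge is then traversed back and forth and
  -- the area is zero.
  have h4 : ¬ ∀ k, interleave (fun i => CP2.ofAffine (Q i)) ℓ (k + 2 * (2 : ℕ)) =
      interleave (fun i => CP2.ofAffine (Q i)) ℓ k := by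
    intro h4
    refine hQA (polygonArea_eq_zero_of_period_two fun i => ofAffine_injective ?_)
    have := h4 (2 * i.val)
    rw [← mul_add, interleave_even, interleave_even] at this
    simpa using this
  obtain ⟨N, hc, hdvd⟩ :=
    (hfam.closing hdual).exists_minClosing (NeZero.pos n) hℓ.isDualChain h4
  have : NeZero N := ⟨hc.pos.ne'⟩
  obtain ⟨K, hK, hcov⟩ := neighbourSum_castHom (n := n) (N := N) hdvd
  set H := areaRatio Γ γ.dual (affLift (primitivePart N Q)) with hHdef
  have hQns := hℓ.nonspecial_of_area hQA
  have hH : H ≠ 0 := by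
    have hA : homArea (affLift (primitivePart N Q)) ≠ 0 := by
      intro h0
      apply hQA
      rw [(hcov Q _ (hℓ.eq_primitivePart hc.toClosing hdvd)).1]
      change homArea (fun i => ![(primitivePart N Q i).1, (primitivePart N Q i).2, 1]) = 0 at h0
      rw [homArea_affine] at h0
      rw [h0, mul_zero]
    exact div_ne_zero (pow_ne_zero 4 hA)
      (IsPonceletChain.isLifting.specialProduct_ne_zero hc.toClosing hℓ.isDualChain hQns)
  have hw : ∀ᶠ t in l, ∃ ℓt, IsPonceletChain γ Γ (fun i => CP2.ofAffine (Pt t i)) ℓt ∧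
      areaRatio Γ γ.dual (affLift (primitivePart N (Pt t))) = H := by
    filter_upwards [hPt] with t ⟨⟨ℓt, ht⟩, hnd⟩
    exact ⟨ℓt, ht, hc.areaRatio_const ht.isDualChain hℓ.isDualChain
      (fun k hk => hnd (ht.isDegenerate_of_special hk)) hQns IsPonceletChain.isLifting
      IsPonceletChain.isLifting⟩
  have hlim' : Tendsto (fun t => primitivePart N (Pt t)) l (𝓝 (primitivePart N P)) := by
    rw [tendsto_pi_nhds]
    exact fun j => (tendsto_pi_nhds.1 hlim) _
  refine ⟨?_, fun g hg hga => ?_⟩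
  · filter_upwards [hw] with t ht'
    obtain ⟨ℓt, ht, hr⟩ := ht'
    rw [(hcov _ _ (ht.eq_primitivePart hc.toClosing hdvd)).1]
    refine mul_ne_zero hK fun h0 => hH ?_
    rw [← hr, areaRatio]
    have : homArea (affLift (primitivePart N (Pt t))) = 0 := by
      rw [← h0, ← homArea_affine]
      rfl
    rw [this, zero_pow four_ne_zero, zero_div]
  · obtain ⟨k, v, L⟩ := exists_localModel hc hm.isDualChain
    obtain ⟨c, hct⟩ := L.exists_tendsto hc hH hlim' IsPonceletChain.isLifting
      (hw.mono fun t ⟨ℓt, ht, hr⟩ => ⟨_, ht.isDualChain, IsPonceletChain.isLifting, hr⟩) hg hga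
    refine ⟨c, hct.congr' ?_⟩
    filter_upwards [hw] with t ⟨ℓt, ht, _⟩
    obtain ⟨e1, e2⟩ := hcov _ _ (ht.eq_primitivePart hc.toClosing hdvd)
    rw [e1, e2, mul_div_mul_left _ _ hK]

theorem polygonCCM_eq (Q : ZMod n → ℂ × ℂ) : polygonCCM Q =
    (1 / 4 * (neighbourSum (fun a b c => b.2 * (a.1 ^ 2 + a.2 ^ 2 - c.1 ^ 2 - c.2 ^ 2)) Q
      / polygonArea Q),
     1 / 4 * (neighbourSum (fun a b c => -b.1 * (a.1 ^ 2 + a.2 ^ 2 - c.1 ^ 2 - c.2 ^ 2)) Q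
      / polygonArea Q)) := by
  ext
  · simp only [polygonCCM, neighbourSum, Prod.smul_fst, smul_eq_mul]
    ring
  · simp only [polygonCCM, neighbourSum, Prod.smul_snd, smul_eq_mul]
    ring

/-- Averaging over the two edges at a vertex gives, for antisymmetric `h`, a summand that changes
sign when its three arguments are reversed. -/
theorem sum_edges_eq_neighbourSum (h : ℂ × ℂ → ℂ × ℂ → ℂ) (Q : ZMod n → ℂ × ℂ) :
    ∑ i, h (Q i) (Q (i + 1)) = neighbourSum (fun a b c => 1 / 2 * (h a b + h b c)) Q := by
  have h1 : ∑ i, h (Q (i - 1)) (Q i) = ∑ i, h (Q i) (Q (i + 1)) := by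
    rw [← Equiv.sum_comp (Equiv.addRight (1 : ZMod n)) fun i => h (Q (i - 1)) (Q i)]
    simp
  rw [neighbourSum, ← Finset.mul_sum, Finset.sum_add_distrib, h1]
  ring

theorem polygonCM₂_eq (Q : ZMod n → ℂ × ℂ) : polygonCM₂ Q =
    (1 / 6 * (neighbourSum (fun a b c => 1 / 2 * ((a.1 * b.2 - b.1 * a.2) * (a.1 + b.1)
        + (b.1 * c.2 - c.1 * b.2) * (b.1 + c.1))) Q / polygonArea Q),
     1 / 6 * (neighbourSum (fun a b c => 1 / 2 * ((a.1 * b.2 - b.1 * a.2) * (a.2 + b.2)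
        + (b.1 * c.2 - c.1 * b.2) * (b.2 + c.2))) Q / polygonArea Q)) := by
  rw [← sum_edges_eq_neighbourSum fun a b => (a.1 * b.2 - b.1 * a.2) * (a.1 + b.1),
    ← sum_edges_eq_neighbourSum fun a b => (a.1 * b.2 - b.1 * a.2) * (a.2 + b.2)]
  ext
  · simp only [polygonCM₂, Prod.smul_fst, Prod.fst_sum, Prod.fst_add, smul_eq_mul]
    ring
  · simp only [polygonCM₂, Prod.smul_snd, Prod.snd_sum, Prod.snd_add, smul_eq_mul]
    ring

end main

theorem mainTheorem5 (γ Γ : SmoothConic) (n : ℕ) [NeZero n] (hn : 3 ≤ n)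
    (hfam : AdmitsPonceletFamily γ Γ n)
    (harea : ∃ Q : ZMod n → ℂ × ℂ,
      IsPonceletPolygon γ Γ (fun i => CP2.ofAffine (Q i)) ∧ polygonArea Q ≠ 0)
    (P : ZMod n → ℂ × ℂ)
    (hP : IsPonceletPolygon γ Γ (fun i => CP2.ofAffine (P i)))
    (hPdeg : IsDegeneratePolygon γ Γ (fun i => CP2.ofAffine (P i)))
    {𝕜 : Type*} [RCLike 𝕜] (Pt : 𝕜 → ZMod n → ℂ × ℂ)
    (hPt : ∀ᶠ t in 𝓝[≠] (0 : 𝕜),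
      IsPonceletPolygon γ Γ (fun i => CP2.ofAffine (Pt t i)) ∧
        ¬ IsDegeneratePolygon γ Γ (fun i => CP2.ofAffine (Pt t i)))
    (hlim : Tendsto Pt (𝓝[≠] (0 : 𝕜)) (𝓝 P)) :
    (∀ᶠ t in 𝓝[≠] (0 : 𝕜), polygonArea (Pt t) ≠ 0) ∧
      (∃ c : ℂ × ℂ, Tendsto (fun t => polygonCCM (Pt t)) (𝓝[≠] (0 : 𝕜)) (𝓝 c)) ∧
      (∃ g : ℂ × ℂ, Tendsto (fun t => polygonCM₂ (Pt t)) (𝓝[≠] (0 : 𝕜)) (𝓝 g)) := by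
  obtain ⟨Q, hQ, hQA⟩ := harea
  obtain ⟨hA, hG⟩ := exists_tendsto_neighbourSum_div hfam hQ hQA hP hPt hlim
  refine ⟨hA, ?_, ?_⟩
  · simp only [polygonCCM_eq]
    obtain ⟨c₁, h₁⟩ := hG (fun a b c => b.2 * (a.1 ^ 2 + a.2 ^ 2 - c.1 ^ 2 - c.2 ^ 2))
      (fun _ _ _ => by ring)
      fun _ => ContDiffAt.analyticAt (by fun_prop)
    obtain ⟨c₂, h₂⟩ := hG (fun a b c => -b.1 * (a.1 ^ 2 + a.2 ^ 2 - c.1 ^ 2 - c.2 ^ 2))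
      (fun _ _ _ => by ring)
      fun _ => ContDiffAt.analyticAt (by fun_prop)
    exact ⟨_, (h₁.const_mul _).prodMk_nhds (h₂.const_mul _)⟩
  · simp only [polygonCM₂_eq]
    obtain ⟨c₁, h₁⟩ := hG (fun a b c => 1 / 2 * ((a.1 * b.2 - b.1 * a.2) * (a.1 + b.1)
      + (b.1 * c.2 - c.1 * b.2) * (b.1 + c.1))) (fun _ _ _ => by ring)
      fun _ => ContDiffAt.analyticAt (by fun_prop)
    obtain ⟨c₂, h₂⟩ := hG (fun a b c => 1 / 2 * ((a.1 * b.2 - b.1 * a.2) * (a.2 + b.2)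
      + (b.1 * c.2 - c.1 * b.2) * (b.2 + c.2))) (fun _ _ _ => by ring)
      fun _ => ContDiffAt.analyticAt (by fun_prop)
    exact ⟨_, (h₁.const_mul _).prodMk_nhds (h₂.const_mul _)⟩
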